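/- Conventions. Let $g=(g_{ij})$ be a positive definite $n\times n$ matrix and $\hat\theta\in(0,\pi)$. Put $B=H^1(T^n,\mathbb R)=\mathbb R^n$ with lattice $H^1(T^n,\mathbb Z)=\mathbb Z^n$ and inner product $\langle x,y\rangle=\sum g_{ij}x_iy_j$, and $T^*T^n=B\times T^n\ni(\mu,\theta)$ with projection $\pi$ to $B$, $\omega=\sum d\theta_i\wedge d\mu_i$ and $\Omega=\bigwedge_i(d\theta_i+\sqrt{-1}\sum_jg_{ij}d\mu_j)$. Special Lagrangian means $\omega|_L=0$ and $\operatorname{Im}(e^{-i\hat\theta}\Omega)|_L=0$. For $m\in\mathbb Z^n$ put $\hat\theta_m(\mu,\theta)=\sum_im_i\theta_i-\cot\hat\theta\,\langle m,\mu\rangle\in\mathbb R/2\pi\mathbb Z$. A *tropical curve* $(G,h)$ is a connected finite graph $G=(V,E)$, $V\ne\emptyset$, with internal edges (between two vertices) and external edges (with one vertex), and a continuous $h:G\to B$, affine with nonzero rational slope on each edge, mapping internal edges to segments and external edges to unbounded rays, such that $\sum_{e\ni v}f_{v,e}=0$ at every vertex $v$, where $f_{v,e}\in\mathbb Z^n$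 is the primitive tangent vector of $h(e)$ pointing away from $h(v)$. It is *locally planar* if each vertex $v$ has valency $N_v\ge3$ and the $f_{v,e}$, $e\ni v$, span a lattice of rank two. A primitive subtorus $T_v\cong T^{n-2}$ of $T^n$ is the common kernel of the characters in a saturated sublattice of rank two of $\mathbb Z^n$; let $(b_1,b_2)$ be a $\mathbb Z$-basis of that sublattice. For $p_v\in\mathrm{Lie}(T_v)^*$, the Kähler quotient $T^*T^n/\!/_{p_v}T_v$ is identified with $(\mathbb C^*)^2$ by $$z_1=\exp\Big(-\tfrac{\sqrt{\det(\langle b_i,b_j\rangle)}}{\sin\hat\theta}\,\mu_2+\sqrt{-1}\,\hat\theta_{b_1}\Big),\qquad z_2=\exp\Big(\tfrac{\sqrt{\det(\langle b_i,b_j\rangle)}}{\sin\hat\theta}\,\mu_1+\sqrt{-1}\,\hat\theta_{b_2}\Big),$$ where $\mu_1b_1+\mu_2b_2$ is the orthogonal projection of $\mu$ to $\mathbb Rb_1+\mathbb Rb_2$. Translation of $(\mathbb C^*)^2$ by $a\in B$ multiplies $(z_1,z_2)$ by the positive reals that shift $(\mu_1,\mu_2)$ by the coordinates of the projection of $a$.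 A *matching datum* on $G$ with overlaps longer than $\Lambda$ consists of: for each $v\in V$, a primitive subtorus $T_v\cong T^{n-2}$ with a basis as above, $p_v\in\mathrm{Lie}(T_v)^*$, and a Laurent polynomial $f_v$ on $(\mathbb C^*)^2$ with smooth zero locus $\mathcal C_v$, whose lift $L_v\subset T^*T^n$ to the moment map fibre over $p_v$ is a special Lagrangian; and for each edge $e$ at $v$ a half cylinder $L_{v,e}=\{\mu\in a+\mathbb R_{\ge0}d,\ \hat\theta_d=\varphi\}$ with $a\in B$, $d\in\mathbb Z^n$ primitive, $\varphi\in U(1)$ its phase. The requirements are: the ends of $L_v$ are asymptotically cylindrical and in bijection with the edges $e$ at $v$, the end $e$ being asymptotic to $L_{v,e}$ (in $(\mathbb C^*)^2$, the curve $\mathcal C_v$ is, outside a relatively compact part, the disjoint union over $e$ of exponentially close holomorphic graphs over the ends of the cylinders $z^{m}=\alpha$ that contain the images of the $L_{v,e}$); and for each internal edge $e$ between $v,v'$, the half cylinders $L_{v,e}$, $L_{v',e}$ lie in one $T^{n-1}$-invariant special Lagrangian cylinder, and $\pi(L_{v,e}\cap L_{v',e})$ is a (non-empty) segment of length $l_e>\Lambda$.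 **Proposition.** Let $(G,h)$ be a locally planar tropical curve in $B$. Then $|V|\le|E|$. Orient the internal edges arbitrarily and the external edges outward, and let $S\subset U(1)^E$ be the set of $(\hat\theta_e)$ solving the phase balancing equations $$\sum_{e\ni v}\pm\hat\theta_e=N_v\pi\mod2\pi\mathbb Z\qquad(v\in V),$$ with sign $+$ if $e$ points away from $v$ and $-$ otherwise. There are an injective continuous homomorphism $\Psi:U(1)^{|E|-|V|}\to U(1)^E$ and $\varphi_0\in U(1)^E$ with $\varphi_0\cdot\Psi(U(1)^{|E|-|V|})=S$, an open dense set $U\subset U(1)^{|E|-|V|}$, subtori $T_v$ with bases as above, Laurent polynomials $f_{v,u}$ ($v\in V$, $u\in U$) with support in a finite set depending only on $v$ and with coefficients continuous in $u$, and a family of data $D_{T,u}$ with the following property. For every $\Lambda$ there is $T_0>0$ such that for all $T\ge T_0$ and all $u\in U$: 1. $D_{T,u}$ is a matching datum on $G$ with overlaps longer than $\Lambda$. 2. Its subtori and their bases are the given ones, independent of $T$ and $u$, and its curve $\mathcal C_{v,T,u}$ is the translate by $T\,h(v)$ of the zero locus of $f_{v,u}$, which is independent of $T$. 3. For every edge $e$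 at a vertex $v$, the half cylinder $L_{v,e,T,u}$ projects onto the ray in $B$ from $T\,h(v)$ in the direction $f_{v,e}$, i.e. along $h(e)$. 4. For every edge $e$, the phase of the half cylinder of $e$ at the vertex from which $e$ points away is the component $(\varphi_0\Psi(u))_e$. -/

import Mathlib

open scoped ContDiff

noncomputable section

namespace TropSL

/-! ### Graphs with internal edges and unbounded external edges -/

/-- A multigraph with vertices `V` and edges `E`. An internal edge `e` joins `src e` to the vertex
`w` with `tgt e = some w`; an external edge has the single end vertex `src e`, and `tgt e = none`.
The choice of `src` for an internal edge is an auxiliary orientation. -/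
structure RayGraph (V E : Type*) where
  src : E → V
  tgt : E → Option V

namespace RayGraph

variable {V E : Type*}

/-- The vertex at one of the two sides of an edge: `(e, true)` is the side of `src e`, and
`(e, false)` the other side, where an external edge has no vertex. -/
def endpoint (G : RayGraph V E) (x : E × Bool) : Option V :=
  if x.2 then some (G.src x.1) else G.tgt x.1

open Classical in
/-- The sides of edges at the vertex `v`, i.e. the edges adjacent to `v` (a loop would be counted
twice). -/
def flags [Fintype E] (G : RayGraph V E) (v : V) : Finset (E × Bool) :=
  Finset.univ.filter fun x => G.endpoint x = some v

/-- Connectedness (and non-emptiness). -/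
def Connected (G : RayGraph V E) : Prop :=
  Nonempty V ∧ ∀ v w, Relation.EqvGen (fun a b => ∃ e, G.src e = a ∧ G.tgt e = some b) v w

end RayGraph

/-! ### Tropical curves in `B = H¹(Tⁿ, ℝ) = ℝⁿ`, with lattice `H¹(Tⁿ, ℤ) = ℤⁿ` -/

/-- An integral vector as a vector of `B`. -/
def toB {n : ℕ} (m : Fin n → ℤ) : Fin n → ℝ := fun i => (m i : ℝ)

/-- A lattice vector is primitive if its coordinates have greatest common divisor one. -/
def IsPrimitive {n : ℕ} (m : Fin n → ℤ) : Prop := Finset.univ.gcd m = 1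

/-- The ray from `a` in the direction `d`. -/
def ray {n : ℕ} (a d : Fin n → ℝ) : Set (Fin n → ℝ) := {y | ∃ s : ℝ, 0 ≤ s ∧ y = a + s • d}

/-- A tropical curve `(G, h)` in `ℝⁿ` with unit edge weights. The map `h` is given by the images
`pos v = h(v)` of the vertices and by the primitive direction `dir e` of the affine image `h(e)`,
pointing away from `h(src e)`: an internal edge is mapped to the segment between the images of its
ends, an external edge `e` to the ray from `h(src e)` in the direction `dir e`. -/
structure TropicalCurve (n : ℕ) (V E : Type*) [Fintype E] extends RayGraph V E where
  pos : V → Fin n → ℝ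
  dir : E → Fin n → ℤ
  connected : toRayGraph.Connected
  primitive : ∀ e, IsPrimitive (dir e)
  internal : ∀ e w, tgt e = some w → ∃ l : ℝ, 0 < l ∧ pos w = pos (src e) + l • toB (dir e)
  balanced : ∀ v, ∑ x ∈ toRayGraph.flags v, (if x.2 then dir x.1 else -dir x.1) = 0

namespace TropicalCurve

variable {n : ℕ} {V E : Type*} [Fintype E]

/-- The primitive tangent vector of `h(e)` pointing outward from the vertex at the given side. -/
def outward (Γ : TropicalCurve n V E) (x : E × Bool) : Fin n → ℤ :=
  if x.2 then Γ.dir x.1 else -Γ.dir x.1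

/-- Every vertex has valency at least three, and the edges at it span a lattice of rank two. -/
def LocallyPlanar (Γ : TropicalCurve n V E) : Prop :=
  ∀ v, 3 ≤ (Γ.flags v).card ∧
    Module.finrank ℤ (Submodule.span ℤ (Γ.outward '' (Γ.flags v : Set (E × Bool)))) = 2

/-- The solutions of the phase balancing equations `∑ θ̂_e = N_v π` modulo `2π` at all vertices `v`,
where `N_v` is the valency. The phase of an edge refers to the orientation away from `src`; seen
from the other end vertex the direction, and with it the phase, changes sign. -/
def phaseSolutions (Γ : TropicalCurve n V E) : Set (E → Circle) :=
  {φ | ∀ v, ∏ x ∈ Γ.flags v, (if x.2 then φ x.1 else (φ x.1)⁻¹) =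
    Circle.exp ((Γ.flags v).card * Real.pi)}

end TropicalCurve

/-! ### The Kähler structure on `T^*Tⁿ` and special Lagrangians -/

/-- `T^*Tⁿ = B × Tⁿ`, with points `(μ, (e^{iθ₁}, …, e^{iθₙ}))`. -/
abbrev CotTorus (n : ℕ) : Type := (Fin n → ℝ) × (Fin n → Circle)

/-- The universal covering `(μ, θ) ↦ (μ, e^{iθ})`. -/
def covering {n : ℕ} (q : (Fin n → ℝ) × (Fin n → ℝ)) : CotTorus n :=
  (q.1, fun i => Circle.exp (q.2 i))

/-- The inner product on `B` with Gram matrix `g`. -/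
def ip {n : ℕ} (g : Matrix (Fin n) (Fin n) ℝ) (x y : Fin n → ℝ) : ℝ := x ⬝ᵥ g.mulVec y

/-- `ω = ∑ dθ_i ∧ dμ_i`. -/
def symp {n : ℕ} (v w : (Fin n → ℝ) × (Fin n → ℝ)) : ℝ :=
  ∑ i, (v.2 i * w.1 i - w.2 i * v.1 i)

/-- `Ω = ⋀ (dθ_i + √-1 ∑_j g_ij dμ_j)`, evaluated on `n` tangent vectors. -/
def holVol {n : ℕ} (g : Matrix (Fin n) (Fin n) ℝ) (v : Fin n → (Fin n → ℝ) × (Fin n → ℝ)) : ℂ :=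
  (Matrix.of fun i k => (((v k).2 i : ℝ) : ℂ) + Complex.I * ((g.mulVec (v k).1 i : ℝ) : ℂ)).det

/-- `L` is an embedded special Lagrangian submanifold of phase `θ`: near each of its points, `L` is
the zero set of a smooth `ℝⁿ`-valued submersion `F` (on the universal covering), and `ω` and
`Im (e^{-iθ} Ω)` vanish on the tangent space `ker dF` at that point. -/
def IsSpecialLagrangian {n : ℕ} (g : Matrix (Fin n) (Fin n) ℝ) (θ : ℝ)
    (L : Set (CotTorus n)) : Prop :=
  ∀ q : (Fin n → ℝ) × (Fin n → ℝ), covering q ∈ L →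
    ∃ (W : Set ((Fin n → ℝ) × (Fin n → ℝ)))
      (F : (Fin n → ℝ) × (Fin n → ℝ) → (Fin n → ℝ)),
      IsOpen W ∧ q ∈ W ∧ ContDiffOn ℝ ∞ F W ∧ (∀ y ∈ W, covering y ∈ L ↔ F y = 0) ∧
      Function.Surjective (fderiv ℝ F q) ∧
      (∀ v w, fderiv ℝ F q v = 0 → fderiv ℝ F q w = 0 → symp v w = 0) ∧
      (∀ v : Fin n → (Fin n → ℝ) × (Fin n → ℝ), (∀ k, fderiv ℝ F q (v k) = 0) →
        (Complex.exp (-(Complex.I * (θ : ℂ))) * holVol g v).im = 0)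

/-! ### Subtori and their edge cylinders -/

/-- The character `θ ↦ ∑ m_i θ_i` of `Tⁿ`, written multiplicatively. -/
def character {n : ℕ} (m : Fin n → ℤ) : (Fin n → Circle) →* Circle :=
  ∏ i, (Pi.evalMonoidHom (fun _ : Fin n => Circle) i) ^ (m i)

/-- The phase `θ_m - cot θ̂ ∑_{j} g_{mj} μ_j ∈ U(1)` of a point, in the lattice direction `m`. -/
def phaseAt {n : ℕ} (g : Matrix (Fin n) (Fin n) ℝ) (θ : ℝ) (m : Fin n → ℤ) (q : CotTorus n) :
    Circle :=
  character m q.2 * Circle.exp (-(Real.cot θ * ip g (toB m) q.1))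

/-- The data of a `T^{n-1}`-invariant half cylinder: the starting point and the direction of its
projection to `B`, and its phase constant. The torus `T^{n-1}` is the kernel of `character dir`. -/
structure HalfCylinder (n : ℕ) where
  start : Fin n → ℝ
  dir : Fin n → ℤ
  phase : Circle

/-- The half cylinder, as a subset of `T^*Tⁿ`. -/
def HalfCylinder.carrier {n : ℕ} (c : HalfCylinder n) (g : Matrix (Fin n) (Fin n) ℝ) (θ : ℝ) :
    Set (CotTorus n) :=
  {q | q.1 ∈ ray c.start (toB c.dir) ∧ phaseAt g θ c.dir q = c.phase}

/-- `C` is a `T^{n-1}`-invariant special Lagrangian cylinder: it lies over an affine line parallel to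
a primitive lattice vector `d`, where the phase in the direction `d` is constant, and it is special
Lagrangian. -/
def IsInvariantCylinder {n : ℕ} (g : Matrix (Fin n) (Fin n) ℝ) (θ : ℝ)
    (C : Set (CotTorus n)) : Prop :=
  IsSpecialLagrangian g θ C ∧ ∃ (a : Fin n → ℝ) (d : Fin n → ℤ) (φ : Circle), IsPrimitive d ∧
    C = {q | (∃ s : ℝ, q.1 = a + s • toB d) ∧ phaseAt g θ d q = φ}

/-- `b` is a `ℤ`-basis of a saturated sublattice of rank two of `ℤⁿ`. -/
def IsPrimitiveFrame {n : ℕ} (b : Fin 2 → Fin n → ℤ) : Prop :=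
  LinearIndependent ℤ b ∧ ∀ (k : ℤ) (m : Fin n → ℤ), k ≠ 0 →
    k • m ∈ Submodule.span ℤ (Set.range b) → m ∈ Submodule.span ℤ (Set.range b)

/-- The subgroup of `Tⁿ` annihilated by the characters `b 0` and `b 1`. The primitive subtori of
dimension `n - 2` are these subgroups, for the primitive frames `b`. -/
def subtorus {n : ℕ} (b : Fin 2 → Fin n → ℤ) : Subgroup (Fin n → Circle) :=
  ⨅ k, (character (b k)).ker

/-- The Lie algebra of `subtorus b`, in `Lie(Tⁿ) = ℝⁿ`. -/
def lieSubtorus {n : ℕ} (b : Fin 2 → Fin n → ℤ) : Submodule ℝ (Fin n → ℝ) where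
  carrier := {ξ | ∀ k, toB (b k) ⬝ᵥ ξ = 0}
  add_mem' := by
    intro x y hx hy k
    rw [dotProduct_add, hx k, hy k, add_zero]
  zero_mem' := by
    intro k
    exact dotProduct_zero _
  smul_mem' := by
    intro c x hx k
    rw [dotProduct_smul, hx k, smul_zero]

/-- The points at which the moment map of `subtorus b` has the value `p`. -/
def momentFibre {n : ℕ} (b : Fin 2 → Fin n → ℤ) (p : Module.Dual ℝ (lieSubtorus b)) :
    Set (CotTorus n) :=
  {q | ∀ ξ : lieSubtorus b, q.1 ⬝ᵥ (ξ : Fin n → ℝ) = p ξ}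

/-! ### The Kähler quotient, after hyperkähler rotation -/

/-- `g₁₁ g₂₂ - g₁₂²` for the metric restricted to the plane spanned by `b 0`, `b 1`. -/
def gramDet {n : ℕ} (g : Matrix (Fin n) (Fin n) ℝ) (b : Fin 2 → Fin n → ℤ) : ℝ :=
  ip g (toB (b 0)) (toB (b 0)) * ip g (toB (b 1)) (toB (b 1)) - ip g (toB (b 0)) (toB (b 1)) ^ 2

/-- The coordinates `(μ₁, μ₂)` of `μ` along the frame, i.e. the coordinates in the basis
`b 0`, `b 1` of the `g`-orthogonal projection of `μ` to the plane spanned by the frame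
(by Cramer's rule). -/
def planeCoord {n : ℕ} (g : Matrix (Fin n) (Fin n) ℝ) (b : Fin 2 → Fin n → ℤ)
    (μ : Fin n → ℝ) : Fin 2 → ℝ :=
  ![(ip g (toB (b 1)) (toB (b 1)) * ip g (toB (b 0)) μ
      - ip g (toB (b 0)) (toB (b 1)) * ip g (toB (b 1)) μ) / gramDet g b,
    (ip g (toB (b 0)) (toB (b 0)) * ip g (toB (b 1)) μ
      - ip g (toB (b 0)) (toB (b 1)) * ip g (toB (b 0)) μ) / gramDet g b]

/-- `(log |z₁|, log |z₂|)` in terms of `μ`: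
`log |z₁| = -(√(g₁₁g₂₂ - g₁₂²) / sin θ̂) μ₂` and `log |z₂| = (√(g₁₁g₂₂ - g₁₂²) / sin θ̂) μ₁`. -/
def logMod {n : ℕ} (g : Matrix (Fin n) (Fin n) ℝ) (θ : ℝ) (b : Fin 2 → Fin n → ℤ)
    (μ : Fin n → ℝ) : Fin 2 → ℝ :=
  ![-(Real.sqrt (gramDet g b) / Real.sin θ * planeCoord g b μ 1),
    Real.sqrt (gramDet g b) / Real.sin θ * planeCoord g b μ 0]

/-- The complex coordinates `(z₁, z₂)`, with values in `(ℂˣ)²`: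
`z_k` has modulus `exp (logMod k)` and argument `θ_k - cot θ̂ (g_{k1} μ₁ + g_{k2} μ₂)`.
As `(μ₁, μ₂)` comes from the orthogonal projection, `g_{k1} μ₁ + g_{k2} μ₂` is the inner product of
`b k` and `μ`. -/
def zCoord {n : ℕ} (g : Matrix (Fin n) (Fin n) ℝ) (θ : ℝ) (b : Fin 2 → Fin n → ℤ)
    (q : CotTorus n) : Fin 2 → ℂˣ :=
  fun k => Units.mk0 ((Real.exp (logMod g θ b q.1 k) : ℝ) : ℂ)
    (Complex.ofReal_ne_zero.mpr (Real.exp_ne_zero _)) * Circle.toUnits (phaseAt g θ (b k) q)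

/-- The translation of `(ℂˣ)²` by the vector `a` of `B` (through its projection to the plane of the
frame): it shifts the point of the base by `a` and keeps the arguments of `z₁, z₂`. -/
def translateBy {n : ℕ} (g : Matrix (Fin n) (Fin n) ℝ) (θ : ℝ) (b : Fin 2 → Fin n → ℤ)
    (a : Fin n → ℝ) (z : Fin 2 → ℂˣ) : Fin 2 → ℂˣ :=
  fun k => Units.mk0 ((Real.exp (logMod g θ b a k) : ℝ) : ℂ)
    (Complex.ofReal_ne_zero.mpr (Real.exp_ne_zero _)) * z k

/-- Laurent polynomials in two variables, as finitely supported families of coefficients. -/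
abbrev LaurentPoly : Type := (ℤ × ℤ) →₀ ℂ

/-- The monomial `z₁^{m₁} z₂^{m₂}`. -/
def monomialAt (m : ℤ × ℤ) (z : Fin 2 → ℂˣ) : ℂˣ := z 0 ^ m.1 * z 1 ^ m.2

/-- The zero locus in `(ℂˣ)²`. -/
def curve (f : LaurentPoly) : Set (Fin 2 → ℂˣ) :=
  {z | (f.sum fun m a => a * (monomialAt m z : ℂ)) = 0}

/-- The zero locus is smooth: at each of its points one of the logarithmic derivatives
`z₁ ∂f/∂z₁`, `z₂ ∂f/∂z₂` is nonzero. -/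
def IsSmoothCurve (f : LaurentPoly) : Prop :=
  ∀ z ∈ curve f, (f.sum fun m a => a * (m.1 : ℂ) * (monomialAt m z : ℂ)) ≠ 0 ∨
    (f.sum fun m a => a * (m.2 : ℂ) * (monomialAt m z : ℂ)) ≠ 0

/-- The lift of the curve of `f` to a `T_v`-invariant subset of the moment map fibre in `T^*Tⁿ`. -/
def liftCurve {n : ℕ} (g : Matrix (Fin n) (Fin n) ℝ) (θ : ℝ) (b : Fin 2 → Fin n → ℤ)
    (p : Module.Dual ℝ (lieSubtorus b)) (f : LaurentPoly) : Set (CotTorus n) :=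
  {q | q ∈ momentFibre b p ∧ zCoord g θ b q ∈ curve f}

/-- A graph over the end `|z^{m'}| < r` of the cylinder `z^m = α`, namely
`z^m = α exp (ψ (z^{m'}))`. -/
def endGraph (m m' : ℤ × ℤ) (α : ℂˣ) (r : ℝ) (ψ : ℂ → ℂ) : Set (Fin 2 → ℂˣ) :=
  {z | ‖(monomialAt m' z : ℂ)‖ < r ∧
    (monomialAt m z : ℂ) = (α : ℂ) * Complex.exp (ψ (monomialAt m' z : ℂ))}

/-- The asymptotically cylindrical ends of the lift of the curve of `f` are in bijection with the
finite set `S`, and the end labelled by `x ∈ S` is asymptotic to the half cylinder `c x`.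

In the quotient `(ℂˣ)²`, the half cylinder `c x` lies in `z^m = α`, where `m` is its direction in the
frame. With `m'` completing `m` to a basis of determinant `-1`, the coordinate `w = z^{m'}` tends to
zero exponentially when one moves along the half cylinder to infinity. The end labelled by `x` is the
graph `z^m = α exp (ψ (w))` of a holomorphic function on `0 < |w| < r` with `ψ(0) = 0`, so that `ψ`
and all its derivatives with respect to `log w` decay exponentially. The ends are
pairwise disjoint, and outside of them there is only a relatively compact part of the curve. -/
def HasEnds {n : ℕ} {ι : Type*} (g : Matrix (Fin n) (Fin n) ℝ) (θ : ℝ) (b : Fin 2 → Fin n → ℤ)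
    (p : Module.Dual ℝ (lieSubtorus b)) (f : LaurentPoly) (S : Finset ι)
    (c : ι → HalfCylinder n) : Prop :=
  ∃ (m m' : ι → ℤ × ℤ) (α : ι → ℂˣ) (r : ℝ) (ψ : ι → ℂ → ℂ), 0 < r ∧
    (∀ x ∈ S,
      (c x).dir = (m x).1 • b 0 + (m x).2 • b 1 ∧
      (m x).1 * (m' x).2 - (m x).2 * (m' x).1 = -1 ∧
      (∀ q ∈ (c x).carrier g θ, q ∈ momentFibre b p ∧ monomialAt (m x) (zCoord g θ b q) = α x) ∧
      DifferentiableOn ℂ (ψ x) (Metric.ball 0 r) ∧ ψ x 0 = 0 ∧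
      endGraph (m x) (m' x) (α x) r (ψ x) ⊆ curve f) ∧
    (∀ x ∈ S, ∀ y ∈ S, x ≠ y →
      Disjoint (endGraph (m x) (m' x) (α x) r (ψ x)) (endGraph (m y) (m' y) (α y) r (ψ y))) ∧
    ∃ K : Set (Fin 2 → ℂˣ), IsCompact K ∧
      curve f ⊆ K ∪ ⋃ x ∈ S, endGraph (m x) (m' x) (α x) r (ψ x)

/-! ### Matching data -/

/-- The data parametrized by a graph in a matching datum. -/
structure MatchingDatum (n : ℕ) (V E : Type*) where
  /-- the subtorus `T_v` -/
  torus : V → Subgroup (Fin n → Circle)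
  /-- a `ℤ`-basis of the characters of `Tⁿ/T_v`, giving coordinates on the quotient -/
  frame : V → Fin 2 → Fin n → ℤ
  /-- the value `p_v` of the moment map -/
  level : ∀ v, Module.Dual ℝ (lieSubtorus (frame v))
  /-- the Laurent polynomial `f_v` -/
  poly : V → LaurentPoly
  /-- the asymptotic half cylinder `L_{v,e}`, for the edge side `x = (e, _)` at the vertex `v`
  (irrelevant for the sides of external edges without a vertex) -/
  cyl : E × Bool → HalfCylinder n

/-- The requirements on a matching datum on the graph `G`, where the lengths `l_e` of the overlaps are
larger than `Λ`. -/
structure MatchingDatum.IsMatching {n : ℕ} {V E : Type*} [Fintype E] (D : MatchingDatum n V E)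
    (G : RayGraph V E) (g : Matrix (Fin n) (Fin n) ℝ) (θ Λ : ℝ) : Prop where
  /-- `T_v` is a primitive subtorus of dimension `n - 2` -/
  frame_primitive : ∀ v, IsPrimitiveFrame (D.frame v)
  torus_eq : ∀ v, D.torus v = subtorus (D.frame v)
  smooth : ∀ v, IsSmoothCurve (D.poly v)
  /-- the lift `L_v` of the curve is special Lagrangian -/
  lift_special : ∀ v, IsSpecialLagrangian g θ (liftCurve g θ (D.frame v) (D.level v) (D.poly v))
  cyl_primitive : ∀ v, ∀ x ∈ G.flags v, IsPrimitive (D.cyl x).dir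
  /-- the ends of `L_v` are in bijection with the edges at `v` -/
  ends : ∀ v, HasEnds g θ (D.frame v) (D.level v) (D.poly v) (G.flags v) D.cyl
  /-- the two half cylinders of an internal edge lie in a common special Lagrangian cylinder -/
  common_cylinder : ∀ e, (G.tgt e).isSome → ∃ C, IsInvariantCylinder g θ C ∧
    (D.cyl (e, true)).carrier g θ ⊆ C ∧ (D.cyl (e, false)).carrier g θ ⊆ C
  /-- they overlap over an interval of length larger than `Λ` -/
  overlap : ∀ e, (G.tgt e).isSome → ∃ a a' : Fin n → ℝ,
    Prod.fst '' ((D.cyl (e, true)).carrier g θ ∩ (D.cyl (e, false)).carrier g θ) = segment ℝ a a' ∧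
    Λ < Real.sqrt (ip g (a' - a) (a' - a))

end TropSL

end

/-! Local curves. In a primitive frame at a vertex the outward edge vectors become primitive vectors
m_x of ℤ² with sum zero, not all parallel. Order them by argument and put f = Σ_L ∏_{x∈L} β_x
z^{m_x}, where L runs over the upper sets other than the full one; vectors with equal argument may
be split arbitrarily. The exponents lie on the boundary of the lattice polygon dual to the fan:
`cross_lt_of_mem_restFamily` identifies the terms that dominate in a direction η, and by `fanSum_eq`
they add up to one monomial times ∏ (1 + β_x z^{m_x}) over the x with the direction of η. With β_x =
-1/α_x the curve therefore has the ends z^{m_x} = α_x. The implicit function theorem gives the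
graphs (`exists_end`), and a dominant-term argument shows that nothing else escapes to infinity
(`exists_near_end_of_tendsto`). The empty and the full set have to give the same monomial, that is ∏
β_x = 1. For unitary α_x this is exactly the phase balancing equation at the vertex
(`prod_neg_inv_outwardPhase`).

Smoothness for generic phases is an algebraic Sard argument. The hypersurface Σ_L ∏_{x∈L} γ_x = 0 in
the torus ∏ γ_x = 1 is smooth where parallel γ_x are distinct (`exists_fanDeriv_ne_zero`). If the
generic curve of the family had a singular point, derivations of the parameter ring would extend to
the residue field of that point (`exists_derivation_extension`), and differentiating the equation
there would contradict this smoothness. Hence singular parameters lie in the zero set of a nonzero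
polynomial (`exists_discriminant`), whose complement is dense in the compact torus of phases because
the latter is Zariski dense.

Global phases. The balancing equations read D φ = ε multiplicatively, with D the incidence matrix. A
maximum principle for linear functions on the tropical curve (`exists_exit`) shows that every vertex
bounds an integral chain of edges. So D is onto over ℤ and splits, which gives |V| ≤ |E| and the
parametrization by `Ψ`. For vertices other than v the chain can avoid the edges at v, so that any
balanced phases at v extend to a global solution. Hence restriction of phases to v (all but one of
its edges) is a surjective, thus open, homomorphism of tori, and generic conditions at the single
vertices pull back to open dense sets, whose finite intersection is `U`.

Special Lagrangians. On the lift of a smooth curve the n × n determinant in Ω is a real multiple of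
a 2 × 2 one (`det_add_I_smul_eq`). The factor √det/sin θ̂ in the coordinates z_k is the one that
makes its phase constant (`im_exp_mul_det_eq_zero`). Translation by T h(v) keeps the phases and
makes each end lie over the corresponding edge, so the half cylinders of an internal edge
automatically match and overlap over the whole dilated edge, whose length grows linearly in T. -/

namespace TropSL

/-! ### Balanced plane fans and the faces of the dual polygon -/

section Fan

open scoped Classical

/-- The determinant of two vectors of the plane. -/
def cross (η c : ℂ) : ℝ := η.re * c.im - η.im * c.re

lemma cross_eq_sin (η c : ℂ) : cross η c = ‖η‖ * ‖c‖ * Real.sin (c.arg - η.arg) := by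
  rw [Real.sin_sub, cross, ← Complex.norm_mul_cos_arg η, ← Complex.norm_mul_sin_arg η,
    ← Complex.norm_mul_cos_arg c, ← Complex.norm_mul_sin_arg c]
  ring

lemma cross_sum {J : Type*} (η : ℂ) (c : J → ℂ) (s : Finset J) :
    cross η (∑ x ∈ s, c x) = ∑ x ∈ s, cross η (c x) := by
  simp only [cross, Complex.re_sum, Complex.im_sum, Finset.mul_sum, Finset.sum_sub_distrib]

lemma cross_pos {η c : ℂ} (hη : η ≠ 0) (hc : c ≠ 0) (h0 : 0 < c.arg - η.arg)
    (h1 : c.arg - η.arg < Real.pi) : 0 < cross η c := by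
  rw [cross_eq_sin]
  have := Real.sin_pos_of_pos_of_lt_pi h0 h1
  have := norm_pos_iff.mpr hη
  have := norm_pos_iff.mpr hc
  positivity

lemma cross_neg {η c : ℂ} (hη : η ≠ 0) (hc : c ≠ 0) (h0 : c.arg - η.arg < 0)
    (h1 : -Real.pi < c.arg - η.arg) : cross η c < 0 := by
  rw [cross_eq_sin]
  have := Real.sin_neg_of_neg_of_neg_pi_lt h0 h1
  have := norm_pos_iff.mpr hη
  have := norm_pos_iff.mpr hc
  exact mul_neg_of_pos_of_neg (by positivity) ‹_›

lemma cross_eq_zero {η c : ℂ} (h : c.arg - η.arg = 0 ∨ c.arg - η.arg = Real.pi) :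
    cross η c = 0 := by
  rw [cross_eq_sin]
  rcases h with h | h <;> simp [h]

lemma cross_nonpos_of_ge {η c : ℂ} (h0 : Real.pi ≤ c.arg - η.arg) : cross η c ≤ 0 := by
  rw [cross_eq_sin]
  have h := Real.sin_nonneg_of_nonneg_of_le_pi (x := c.arg - η.arg - Real.pi) (by linarith)
    (by linarith [Complex.arg_le_pi c, Complex.neg_pi_lt_arg η])
  rw [Real.sin_sub_pi] at h
  exact mul_nonpos_of_nonneg_of_nonpos (by positivity) (by linarith)

lemma cross_nonneg_of_le {η c : ℂ} (h0 : c.arg - η.arg ≤ -Real.pi) : 0 ≤ cross η c := by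
  rw [cross_eq_sin]
  have h := Real.sin_nonneg_of_nonneg_of_le_pi (x := c.arg - η.arg + Real.pi + Real.pi)
    (by linarith [Complex.arg_le_pi η, Complex.neg_pi_lt_arg c]) (by linarith)
  rw [Real.sin_add_pi, Real.sin_add_pi] at h
  exact mul_nonneg (by positivity) (by linarith)

variable {I : Type*} [Fintype I]

/-- The sets of vectors that contain with a vector all vectors of larger argument. -/
noncomputable def upperFamily (c : I → ℂ) : Finset (Finset I) :=
  Finset.univ.filter fun L => ∀ x ∈ L, ∀ y, (c x).arg < (c y).arg → y ∈ L

/-- The vectors of argument larger than that of `η`. -/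
noncomputable def above (c : I → ℂ) (η : ℂ) : Finset I :=
  Finset.univ.filter fun x => η.arg < (c x).arg

/-- The vectors with the argument of `η`. -/
noncomputable def level (c : I → ℂ) (η : ℂ) : Finset I :=
  Finset.univ.filter fun x => (c x).arg = η.arg

/-- A balanced family of nonzero vectors of the plane that are not all parallel. -/
structure IsBalancedFan (c : I → ℂ) : Prop where
  ne_zero : ∀ x, c x ≠ 0
  sum_eq : ∑ x, c x = 0
  spanning : ∀ η : ℂ, η ≠ 0 → ∃ x, cross η (c x) ≠ 0

lemma mem_above {c : I → ℂ} {η : ℂ} {x : I} : x ∈ above c η ↔ η.arg < (c x).arg := by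
  simp [above]

lemma mem_level {c : I → ℂ} {η : ℂ} {x : I} : x ∈ level c η ↔ (c x).arg = η.arg := by
  simp [level]

lemma mem_upperFamily {c : I → ℂ} {L : Finset I} :
    L ∈ upperFamily c ↔ ∀ x ∈ L, ∀ y, (c x).arg < (c y).arg → y ∈ L := by
  simp [upperFamily]

lemma univ_mem_upperFamily (c : I → ℂ) : Finset.univ ∈ upperFamily c := by
  simp [mem_upperFamily]

lemma empty_mem_upperFamily (c : I → ℂ) : ∅ ∈ upperFamily c := by
  simp [mem_upperFamily]

lemma mem_upperFamily_of_between {c : I → ℂ} {η : ℂ} {L : Finset I} (h1 : above c η ⊆ L)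
    (h2 : L ⊆ above c η ∪ level c η) : L ∈ upperFamily c := by
  rw [mem_upperFamily]
  intro x hx y hy
  apply h1
  have := h2 hx
  rw [Finset.mem_union, mem_above, mem_level] at this
  rw [mem_above]
  rcases this with h | h <;> linarith

/-- The sum over an upper set inside `above c η` is dominated by the one over `above c η`. -/
lemma cross_sum_above_sdiff_pos {c : I → ℂ} (hc : IsBalancedFan c) {η : ℂ} (hη : η ≠ 0)
    {L : Finset I} (hL : L ∈ upperFamily c) (hs : L ⊆ above c η) (hne : L ≠ above c η)
    (hexc : ¬ (L = ∅ ∧ above c η ∪ level c η = Finset.univ)) :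
    0 < ∑ x ∈ above c η \ L, cross η (c x) := by
  rw [mem_upperFamily] at hL
  have hle : ∀ x ∈ L, ∀ y, y ∉ L → (c y).arg ≤ (c x).arg := by
    intro x hx y hy
    by_contra h
    exact hy (hL x hx y (not_le.mp h))
  have hnonempty : (above c η \ L).Nonempty := by
    rw [Finset.sdiff_nonempty]
    exact fun h => hne (Finset.Subset.antisymm hs h)
  -- Within a half turn from `η` every term is positive. Otherwise `L` lies at least a half turn
  -- away, so that all terms outside `above c η \ L` are nonpositive, and the balancing condition
  -- converts this into a lower bound.
  by_cases hall : ∀ y ∈ above c η \ L, (c y).arg - η.arg < Real.pi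
  · apply Finset.sum_pos _ hnonempty
    intro y hy
    have h1 := (Finset.mem_sdiff.mp hy).1
    rw [mem_above] at h1
    exact cross_pos hη (hc.ne_zero y) (by linarith) (hall y hy)
  · push Not at hall
    obtain ⟨y0, hy0, hy0'⟩ := hall
    have hy0L : y0 ∉ L := (Finset.mem_sdiff.mp hy0).2
    have hηle : η.arg ≤ 0 := by linarith [Complex.arg_le_pi (c y0)]
    have hLx : ∀ x ∈ L, Real.pi ≤ (c x).arg - η.arg := fun x hx => by
      linarith [hle x hx y0 hy0L]
    have hnon : ∀ x ∈ (above c η \ L)ᶜ, cross η (c x) ≤ 0 := by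
      intro x hx
      by_cases hxL : x ∈ L
      · exact cross_nonpos_of_ge (hLx x hxL)
      · have : x ∉ above c η := fun h => (Finset.mem_compl.mp hx) (Finset.mem_sdiff.mpr ⟨h, hxL⟩)
        rw [mem_above, not_lt] at this
        rcases this.eq_or_lt with h | h
        · exact (cross_eq_zero (Or.inl (by linarith))).le
        · exact (cross_neg hη (hc.ne_zero x) (by linarith)
            (by linarith [Complex.neg_pi_lt_arg (c x)])).le
    have htot : ∑ x ∈ above c η \ L, cross η (c x) + ∑ x ∈ (above c η \ L)ᶜ, cross η (c x) = 0 := by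
      rw [Finset.sum_add_sum_compl, ← cross_sum, hc.sum_eq]
      simp [cross]
    have hle0 := Finset.sum_nonpos hnon
    rcases hle0.lt_or_eq with h | h
    · linarith
    -- In the equality case all the complementary cross products vanish. If `L` is empty, no vector
    -- lies below the level of `η`, which is the excluded case. Otherwise a vector of `L` lies
    -- exactly opposite to `η`, which makes all the remaining terms nonnegative, hence zero, against
    -- `spanning`.
    exfalso
    have hzero := (Finset.sum_eq_zero_iff_of_nonpos hnon).mp h
    rcases L.eq_empty_or_nonempty with rfl | ⟨x1, hx1⟩
    · apply hexc
      refine ⟨rfl, ?_⟩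
      ext x
      simp only [Finset.mem_union, Finset.mem_univ, iff_true, mem_above, mem_level]
      by_contra hx
      push Not at hx
      have hlt : (c x).arg < η.arg := lt_of_le_of_ne hx.1 hx.2
      have := hzero x (by simp [mem_above, hx.1])
      have := cross_neg hη (hc.ne_zero x) (by linarith)
            (by linarith [Complex.neg_pi_lt_arg (c x)])
      linarith
    · have hx1' : (c x1).arg - η.arg = Real.pi := by
        by_contra hne1
        have h1 : Real.pi < (c x1).arg - η.arg := lt_of_le_of_ne (hLx x1 hx1) (Ne.symm hne1)
        have h2 := hzero x1 (by simp [hx1])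
        rw [cross_eq_sin] at h2
        have h3 : Real.sin ((c x1).arg - η.arg) < 0 := by
          have := Real.sin_pos_of_pos_of_lt_pi (x := (c x1).arg - η.arg - Real.pi)
            (by linarith) (by linarith [Complex.arg_le_pi (c x1), Complex.neg_pi_lt_arg η])
          rw [Real.sin_sub_pi] at this
          linarith
        have := norm_pos_iff.mpr hη
        have := norm_pos_iff.mpr (hc.ne_zero x1)
        have : ‖η‖ * ‖c x1‖ * Real.sin ((c x1).arg - η.arg) < 0 :=
          mul_neg_of_pos_of_neg (by positivity) h3
        linarith
      have hpos : ∀ y ∈ above c η \ L, 0 ≤ cross η (c y) := by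
        intro y hy
        obtain ⟨h1, h2⟩ := Finset.mem_sdiff.mp hy
        rw [mem_above] at h1
        rcases (hle x1 hx1 y h2).eq_or_lt with h | h
        · exact (cross_eq_zero (Or.inr (by linarith))).ge
        · exact (cross_pos hη (hc.ne_zero y) (by linarith) (by linarith)).le
      have hz2 := (Finset.sum_eq_zero_iff_of_nonneg hpos).mp (by linarith)
      obtain ⟨x, hx⟩ := hc.spanning η hη
      apply hx
      by_cases hmem : x ∈ above c η \ L
      · exact hz2 x hmem
      · exact hzero x (by simpa using hmem)

/-- The sum over the vectors below the level of `η` in an upper set is negative. -/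
lemma cross_sum_sdiff_neg {c : I → ℂ} (hc : IsBalancedFan c) {η : ℂ} (hη : η ≠ 0)
    {L : Finset I} (hL : L ∈ upperFamily c) (hs : above c η ∪ level c η ⊆ L)
    (hne : L ≠ above c η ∪ level c η) (hexc : ¬ (L = Finset.univ ∧ above c η = ∅)) :
    ∑ x ∈ L \ above c η, cross η (c x) < 0 := by
  rw [mem_upperFamily] at hL
  have hle : ∀ x ∈ L, ∀ y, y ∉ L → (c y).arg ≤ (c x).arg := by
    intro x hx y hy
    by_contra h
    exact hy (hL x hx y (not_le.mp h))
  obtain ⟨w, hwL, hw⟩ : ∃ w ∈ L, w ∉ above c η ∪ level c η := by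
    by_contra h
    push Not at h
    exact hne (Finset.Subset.antisymm h hs)
  have hlow : ∀ x, x ∉ above c η ∪ level c η ↔ (c x).arg < η.arg := by
    intro x
    rw [Finset.mem_union, mem_above, mem_level]
    push Not
    exact ⟨fun h => lt_of_le_of_ne h.1 h.2, fun h => ⟨h.le, h.ne⟩⟩
  -- The mirror image of the previous argument: the angles now run below `η`, and the wrap-around
  -- occurs beyond `-π`.
  by_cases hall : ∀ x ∈ L, -Real.pi < (c x).arg - η.arg
  · apply Finset.sum_neg'
    · intro x hx
      obtain ⟨h1, h2⟩ := Finset.mem_sdiff.mp hx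
      rw [mem_above, not_lt] at h2
      rcases h2.eq_or_lt with h | h
      · exact (cross_eq_zero (Or.inl (by linarith))).le
      · exact (cross_neg hη (hc.ne_zero x) (by linarith) (hall x h1)).le
    · refine ⟨w, ?_, ?_⟩
      · rw [Finset.mem_sdiff]
        exact ⟨hwL, fun h => hw (Finset.mem_union_left _ h)⟩
      · exact cross_neg hη (hc.ne_zero w) (by linarith [(hlow w).mp hw]) (hall w hwL)
  · push Not at hall
    obtain ⟨x0, hx0, hx0'⟩ := hall
    have hηpos : 0 < η.arg := by linarith [Complex.neg_pi_lt_arg (c x0)]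
    have hnL : ∀ y, y ∉ L → (c y).arg - η.arg ≤ -Real.pi := fun y hy => by
      linarith [hle x0 hx0 y hy]
    have habove : ∀ y ∈ above c η, 0 < cross η (c y) := by
      intro y hy
      rw [mem_above] at hy
      exact cross_pos hη (hc.ne_zero y) (by linarith) (by linarith [Complex.arg_le_pi (c y)])
    have hnon : ∀ x ∈ (L \ above c η)ᶜ, 0 ≤ cross η (c x) := by
      intro x hx
      by_cases hxL : x ∈ L
      · have : x ∈ above c η := by
          by_contra h
          exact (Finset.mem_compl.mp hx) (Finset.mem_sdiff.mpr ⟨hxL, h⟩)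
        exact (habove x this).le
      · exact cross_nonneg_of_le (hnL x hxL)
    have htot : ∑ x ∈ L \ above c η, cross η (c x) + ∑ x ∈ (L \ above c η)ᶜ, cross η (c x) = 0 := by
      rw [Finset.sum_add_sum_compl, ← cross_sum, hc.sum_eq]
      simp [cross]
    have hge0 := Finset.sum_nonneg hnon
    rcases hge0.lt_or_eq with h | h
    · linarith
    exfalso
    have hzero := (Finset.sum_eq_zero_iff_of_nonneg hnon).mp h.symm
    have hemp : above c η = ∅ := by
      rw [Finset.eq_empty_iff_forall_notMem]
      intro y hy
      have h1 := hzero y (by simp [hy])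
      have h2 := habove y hy
      linarith
    by_cases hu : L = Finset.univ
    · exact hexc ⟨hu, hemp⟩
    obtain ⟨y1, hy1⟩ : ∃ y, y ∉ L := by
      by_contra h
      push Not at h
      exact hu (Finset.eq_univ_iff_forall.mpr h)
    have hy1' : (c y1).arg - η.arg = -Real.pi := by
      by_contra hne1
      have h1 : (c y1).arg - η.arg < -Real.pi := lt_of_le_of_ne (hnL y1 hy1) hne1
      have h2 := hzero y1 (by simp [hy1])
      rw [cross_eq_sin] at h2
      have h3 : 0 < Real.sin ((c y1).arg - η.arg) := by
        have := Real.sin_pos_of_pos_of_lt_pi (x := (c y1).arg - η.arg + Real.pi + Real.pi)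
          (by linarith [Complex.arg_le_pi η, Complex.neg_pi_lt_arg (c y1)]) (by linarith)
        rw [Real.sin_add_pi, Real.sin_add_pi] at this
        linarith
      have := norm_pos_iff.mpr hη
      have := norm_pos_iff.mpr (hc.ne_zero y1)
      have : 0 < ‖η‖ * ‖c y1‖ * Real.sin ((c y1).arg - η.arg) := by positivity
      linarith
    have hneg : ∀ x ∈ L \ above c η, cross η (c x) ≤ 0 := by
      intro x hx
      obtain ⟨h1, h2⟩ := Finset.mem_sdiff.mp hx
      rw [mem_above, not_lt] at h2
      rcases h2.eq_or_lt with h | h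
      · exact (cross_eq_zero (Or.inl (by linarith))).le
      rcases (hle x h1 y1 hy1).eq_or_lt with h' | h'
      · rw [cross_eq_sin, ← h', hy1']
        simp
      · exact (cross_neg hη (hc.ne_zero x) (by linarith) (by linarith)).le
    have hz2 := (Finset.sum_eq_zero_iff_of_nonpos hneg).mp (by linarith)
    obtain ⟨x, hx⟩ := hc.spanning η hη
    apply hx
    by_cases hmem : x ∈ L \ above c η
    · exact hz2 x hmem
    · exact hzero x (by simpa using hmem)

/-- Otherwise all vectors would be parallel to `η`. Consequently the empty and the full set never
both lie on the face of `η`, and one of them can be discarded from the remaining terms. -/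
lemma not_above_eq_empty_and {c : I → ℂ} (hc : IsBalancedFan c) {η : ℂ} (hη : η ≠ 0)
    (h1 : above c η = ∅) : above c η ∪ level c η ≠ Finset.univ := by
  intro h2
  obtain ⟨x, hx⟩ := hc.spanning η hη
  apply hx
  have : x ∈ above c η ∪ level c η := by simp [h2]
  rw [h1, Finset.empty_union, mem_level] at this
  exact cross_eq_zero (Or.inl (by linarith))

/-- The upper sets between `above c η` and `above c η ∪ level c η`. -/
noncomputable def faceFamily (c : I → ℂ) (η : ℂ) : Finset (Finset I) :=
  (upperFamily c).filter fun L => above c η ⊆ L ∧ L ⊆ above c η ∪ level c η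

/-- The upper sets whose monomials do not lie on the face of `η`; of the empty and the full set,
which give the same monomial, one is left out. -/
noncomputable def restFamily (c : I → ℂ) (η : ℂ) : Finset (Finset I) :=
  ((upperFamily c).filter fun L => ¬ (above c η ⊆ L ∧ L ⊆ above c η ∪ level c η)).erase
    (if above c η ∪ level c η = Finset.univ then ∅ else Finset.univ)

/-- Off the face, an upper set is either strictly inside `above c η`, so that vectors with positive
total cross product are missing, or strictly larger than `above c η ∪ level c η`, so that vectors
with negative total have been added. The face terms thus strictly dominate in the direction `η`. -/
lemma cross_lt_of_mem_restFamily {c : I → ℂ} (hc : IsBalancedFan c) {η : ℂ} (hη : η ≠ 0)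
    {L : Finset I} (hL : L ∈ restFamily c η) :
    cross η (∑ x ∈ L, c x) < cross η (∑ x ∈ above c η, c x) := by
  rw [restFamily, Finset.mem_erase, Finset.mem_filter] at hL
  obtain ⟨hexc, hL, hbetween⟩ := hL
  have hexc1 : ¬ (L = ∅ ∧ above c η ∪ level c η = Finset.univ) := by
    rintro ⟨h1, h2⟩
    simp [h1, h2] at hexc
  have hexc2 : ¬ (L = Finset.univ ∧ above c η = ∅) := by
    rintro ⟨h1, h2⟩
    have := not_above_eq_empty_and hc hη h2
    simp [h1, this] at hexc
  rw [cross_sum, cross_sum]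
  by_cases hsub : L ⊆ above c η ∪ level c η
  · have hnot : ¬ above c η ⊆ L := fun h => hbetween ⟨h, hsub⟩
    have hLs : L ⊆ above c η := by
      obtain ⟨y, hy, hyL⟩ := Finset.not_subset.mp hnot
      intro x hx
      rcases Finset.mem_union.mp (hsub hx) with h | h
      · exact h
      · exfalso
        rw [mem_level] at h
        rw [mem_above] at hy
        exact hyL (mem_upperFamily.mp hL x hx y (by linarith))
    have := cross_sum_above_sdiff_pos hc hη hL hLs (fun h => hnot h.ge) hexc1
    rw [← Finset.sum_sdiff hLs]
    linarith
  · obtain ⟨x, hx, hx'⟩ := Finset.not_subset.mp hsub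
    have hsup : above c η ∪ level c η ⊆ L := by
      intro y hy
      apply mem_upperFamily.mp hL x hx y
      rw [Finset.mem_union, mem_above, mem_level] at hx' hy
      push Not at hx'
      have : (c x).arg < η.arg := lt_of_le_of_ne hx'.1 hx'.2
      rcases hy with h | h <;> linarith
    have hne : L ≠ above c η ∪ level c η := fun h => hsub h.le
    have := cross_sum_sdiff_neg hc hη hL hsup hne hexc2
    rw [← Finset.sum_sdiff (Finset.subset_union_left.trans hsup : above c η ⊆ L)]
    linarith

/-- The universal expression whose restriction to `γ x = β x * z ^ m x` is the Laurent polynomial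
with prescribed ends. -/
noncomputable def fanSum {A : Type*} [CommRing A] (c : I → ℂ) (γ : I → A) : A :=
  ∑ L ∈ (upperFamily c).erase Finset.univ, ∏ x ∈ L, γ x

/-- The upper sets on the face are `above c η` together with an arbitrary subset of `level c η`;
expanding the product runs over these subsets. -/
lemma sum_faceFamily {A : Type*} [CommRing A] (c : I → ℂ) (η : ℂ) (γ : I → A) :
    ∑ L ∈ faceFamily c η, ∏ x ∈ L, γ x =
      (∏ x ∈ above c η, γ x) * ∏ x ∈ level c η, (1 + γ x) := by
  have hdisj : Disjoint (above c η) (level c η) := by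
    rw [Finset.disjoint_left]
    intro x h1 h2
    rw [mem_above] at h1
    rw [mem_level] at h2
    linarith
  rw [Finset.prod_one_add, Finset.mul_sum]
  symm
  apply Finset.sum_bij (fun J _ => above c η ∪ J)
  · intro J hJ
    rw [Finset.mem_powerset] at hJ
    rw [faceFamily, Finset.mem_filter]
    have h1 : above c η ⊆ above c η ∪ J := Finset.subset_union_left
    have h2 : above c η ∪ J ⊆ above c η ∪ level c η := Finset.union_subset_union_right hJ
    exact ⟨mem_upperFamily_of_between h1 h2, h1, h2⟩
  · intro J hJ J' hJ' h
    rw [Finset.mem_powerset] at hJ hJ'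
    have e1 : (above c η ∪ J) \ above c η = J :=
      Finset.union_sdiff_cancel_left (hdisj.mono_right hJ)
    have e2 : (above c η ∪ J') \ above c η = J' :=
      Finset.union_sdiff_cancel_left (hdisj.mono_right hJ')
    rw [← e1, ← e2, h]
  · intro L hL
    rw [faceFamily, Finset.mem_filter] at hL
    refine ⟨L \ above c η, ?_, ?_⟩
    · rw [Finset.mem_powerset]
      intro x hx
      obtain ⟨h1, h2⟩ := Finset.mem_sdiff.mp hx
      exact (Finset.mem_union.mp (hL.2.2 h1)).resolve_left h2
    · exact Finset.union_sdiff_of_subset hL.2.1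
  · intro J hJ
    rw [Finset.mem_powerset] at hJ
    rw [Finset.prod_union (hdisj.mono_right hJ)]

/-- Splitting off the terms on the face in the direction `η`. -/
lemma fanSum_eq {A : Type*} [CommRing A] {c : I → ℂ} (hc : IsBalancedFan c) {η : ℂ} (hη : η ≠ 0)
    (γ : I → A) (hγ : ∏ x, γ x = 1) :
    fanSum c γ = (∏ x ∈ above c η, γ x) * ∏ x ∈ level c η, (1 + γ x) +
      ∑ L ∈ restFamily c η, ∏ x ∈ L, γ x := by
  have h1 := Finset.sum_erase_add (upperFamily c) (fun L => ∏ x ∈ L, γ x) (univ_mem_upperFamily c)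
  have h2 := Finset.sum_filter_add_sum_filter_not (upperFamily c)
    (fun L => above c η ⊆ L ∧ L ⊆ above c η ∪ level c η) (fun L => ∏ x ∈ L, γ x)
  have h3 : (if above c η ∪ level c η = Finset.univ then (∅ : Finset I) else Finset.univ) ∈
      (upperFamily c).filter fun L => ¬ (above c η ⊆ L ∧ L ⊆ above c η ∪ level c η) := by
    rw [Finset.mem_filter]
    split_ifs with h
    · refine ⟨empty_mem_upperFamily c, fun h' => ?_⟩
      exact not_above_eq_empty_and hc hη (Finset.subset_empty.mp h'.1) h
    · refine ⟨univ_mem_upperFamily c, fun h' => h ?_⟩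
      exact Finset.univ_subset_iff.mp h'.2
  have h4 := Finset.sum_erase_add _ (fun L => ∏ x ∈ L, γ x) h3
  have h5 : ∏ x ∈ (if above c η ∪ level c η = Finset.univ then (∅ : Finset I) else Finset.univ),
      γ x = 1 := by
    split_ifs
    · simp
    · exact hγ
  rw [h5] at h4
  rw [hγ] at h1
  have h6 := sum_faceFamily c η γ
  rw [faceFamily] at h6
  unfold fanSum restFamily
  rw [← h6]
  linear_combination h1 - h2 - h4

end Fan


/-! ### Extension of derivations in characteristic zero -/

section Derivations

/-- In characteristic zero, derivations extend to finitely generated field extensions. -/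
lemma exists_derivation_extension {R L : Type*} [CommRing R] [IsDomain R] [CharZero R] [Field L]
    [Algebra R L] [Algebra.EssFiniteType R L] (hinj : Function.Injective (algebraMap R L))
    (δ : R →+ R) (hδ : ∀ a b, δ (a * b) = a * δ b + b * δ a) :
    ∃ D : Derivation ℤ L L, ∀ r, D (algebraMap R L r) = algebraMap R L (δ r) := by
  let K := FractionRing R
  have hδ1 : δ 1 = 0 := by simpa using hδ 1 1
  have : FaithfulSMul R L := (faithfulSMul_iff_algebraMap_injective R L).mpr hinj
  let : Algebra K L := FractionRing.liftAlgebra R L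
  have : IsScalarTower R K L := inferInstance
  have : CharZero K := charZero_of_injective_algebraMap (IsFractionRing.injective R K)
  have : Algebra.EssFiniteType K L := Algebra.EssFiniteType.of_comp R K L
  -- Characteristic zero enters here: a finitely generated field extension is separable and so
  -- formally smooth. The fraction field is formally smooth over `R` as a localization.
  have : Algebra.FormallySmooth K L := inferInstance
  have : Algebra.FormallySmooth R K := Algebra.FormallySmooth.of_isLocalization (nonZeroDivisors R)
  have : Algebra.FormallySmooth R L := Algebra.FormallySmooth.comp R K L
  -- The dual numbers L[ε] become an `R`-algebra through r ↦ r + δ(r)ε. Formal smoothness lifts the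
  -- identity of `L` along L[ε] → L, and the ε-component of the lift is the derivation sought.
  let φ : R →+* TrivSqZeroExt L L :=
    { toFun := fun r => TrivSqZeroExt.inl (algebraMap R L r) + TrivSqZeroExt.inr (algebraMap R L (δ r))
      map_one' := by simp only [map_one, hδ1, map_zero]; ext <;> simp
      map_zero' := by simp only [map_zero]; ext <;> simp
      map_add' := by
        intro a b
        simp only [map_add, TrivSqZeroExt.inl_add, TrivSqZeroExt.inr_add]
        abel
      map_mul' := by
        intro a b
        ext
        · simp
        · simp only [hδ, map_add, map_mul, TrivSqZeroExt.snd_add,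
            TrivSqZeroExt.snd_inl, TrivSqZeroExt.snd_inr, TrivSqZeroExt.snd_mul,
            TrivSqZeroExt.fst_add, TrivSqZeroExt.fst_inl, TrivSqZeroExt.fst_inr,
            MulOpposite.smul_eq_mul_unop, MulOpposite.unop_op]
          ring }
  let alg : Algebra R (TrivSqZeroExt L L) := φ.toAlgebra
  let g : TrivSqZeroExt L L →ₐ[R] L :=
    { toRingHom := (TrivSqZeroExt.fstHom L L L).toRingHom
      commutes' := by
        intro r
        change TrivSqZeroExt.fst (φ r) = _
        simp [φ] }
  have hg : Function.Surjective g := fun x => ⟨TrivSqZeroExt.inl x, rfl⟩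
  have hnil : IsNilpotent (RingHom.ker (g : TrivSqZeroExt L L →+* L)) := by
    refine ⟨2, ?_⟩
    refine (pow_two (RingHom.ker (g : TrivSqZeroExt L L →+* L))).trans ?_
    rw [Ideal.zero_eq_bot, eq_bot_iff, Ideal.mul_le]
    intro a ha b hb
    have ha' : TrivSqZeroExt.fst a = 0 := ha
    have hb' : TrivSqZeroExt.fst b = 0 := hb
    rw [Ideal.mem_bot]
    ext <;> simp [ha', hb']
  let σ : L →ₐ[R] TrivSqZeroExt L L :=
    Algebra.FormallySmooth.liftOfSurjective (AlgHom.id R L) g hg hnil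
  have hfst : ∀ x, TrivSqZeroExt.fst (σ x) = x := fun x =>
    Algebra.FormallySmooth.liftOfSurjective_apply (AlgHom.id R L) g hg hnil x
  refine ⟨Derivation.mk' ((TrivSqZeroExt.sndHom L L).toAddMonoidHom.comp
    σ.toRingHom.toAddMonoidHom).toIntLinearMap ?_, ?_⟩
  · intro a b
    change TrivSqZeroExt.snd (σ (a * b)) = a • TrivSqZeroExt.snd (σ b) + b • TrivSqZeroExt.snd (σ a)
    rw [map_mul, TrivSqZeroExt.snd_mul, hfst, hfst]
    simp only [smul_eq_mul, MulOpposite.smul_eq_mul_unop, MulOpposite.unop_op]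
    ring
  · intro r
    change TrivSqZeroExt.snd (σ (algebraMap R L r)) = _
    rw [σ.commutes]
    change TrivSqZeroExt.snd (TrivSqZeroExt.inl (algebraMap R L r) +
      TrivSqZeroExt.inr (algebraMap R L (δ r))) = _
    rw [TrivSqZeroExt.snd_add, TrivSqZeroExt.snd_inl, TrivSqZeroExt.snd_inr, zero_add]

end Derivations

/-! ### Smoothness of the universal hypersurface -/

section Fan

open scoped Classical

variable {I : Type*} [Fintype I]

/-- The derivative of `fanSum` in the direction of the vector field `k x * γ x ∂/∂γ x`. -/
noncomputable def fanDeriv {A : Type*} [CommRing A] (c : I → ℂ) (k γ : I → A) : A :=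
  ∑ L ∈ (upperFamily c).erase Finset.univ, (∑ x ∈ L, k x) * ∏ x ∈ L, γ x

lemma fanDeriv_add {A : Type*} [CommRing A] (c : I → ℂ) (k k' γ : I → A) :
    fanDeriv c (fun x => k x + k' x) γ = fanDeriv c k γ + fanDeriv c k' γ := by
  simp [fanDeriv, Finset.sum_add_distrib, add_mul]

lemma fanDeriv_mul {A : Type*} [CommRing A] (c : I → ℂ) (a : A) (k γ : I → A) :
    fanDeriv c (fun x => k x * a) γ = a * fanDeriv c k γ := by
  simp only [fanDeriv, Finset.mul_sum, Finset.sum_mul]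
  refine Finset.sum_congr rfl fun L _ => Finset.sum_congr rfl fun x _ => ?_
  ring

/-- Replacing `γ x` by zero deletes exactly the terms with `x ∈ L`, so this is a difference of two
instances of `sum_faceFamily`. -/
lemma sum_faceFamily_mem {A : Type*} [CommRing A] (c : I → ℂ) (η : ℂ) (γ : I → A) {x : I}
    (hx : x ∈ level c η) :
    ∑ L ∈ faceFamily c η, (if x ∈ L then ∏ y ∈ L, γ y else 0) =
      (∏ y ∈ above c η, γ y) * (γ x * ∏ y ∈ (level c η).erase x, (1 + γ y)) := by
  have hxa : x ∉ above c η := by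
    rw [mem_above, mem_level.mp hx]
    exact lt_irrefl _
  have h1 := sum_faceFamily c η γ
  have h2 := sum_faceFamily c η (Function.update γ x 0)
  have h3 : ∀ L : Finset I, ∏ y ∈ L, Function.update γ x 0 y = if x ∈ L then 0 else ∏ y ∈ L, γ y := by
    intro L
    split_ifs with h
    · exact Finset.prod_eq_zero h (by simp)
    · refine Finset.prod_congr rfl fun y hy => ?_
      rw [Function.update_of_ne]
      rintro rfl
      exact h hy
  rw [h3, if_neg hxa, ← Finset.mul_prod_erase _ _ hx, Function.update_self] at h2
  have h4 : ∏ y ∈ (level c η).erase x, (1 + Function.update γ x 0 y) =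
      ∏ y ∈ (level c η).erase x, (1 + γ y) := by
    refine Finset.prod_congr rfl fun y hy => ?_
    rw [Function.update_of_ne (Finset.ne_of_mem_erase hy)]
  rw [h4] at h2
  rw [← Finset.mul_prod_erase _ _ hx] at h1
  have h5 : ∑ L ∈ faceFamily c η, (if x ∈ L then ∏ y ∈ L, γ y else 0) =
      ∑ L ∈ faceFamily c η, ∏ y ∈ L, γ y -
        ∑ L ∈ faceFamily c η, ∏ y ∈ L, Function.update γ x 0 y := by
    rw [← Finset.sum_sub_distrib]
    refine Finset.sum_congr rfl fun L _ => ?_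
    rw [h3]
    split_ifs <;> ring
  rw [h5, h1, h2]
  ring

/-- The hypersurface `fanSum = 0` in the torus `∏ γ = 1` is smooth where the coordinates of the
same direction are distinct. -/
lemma exists_fanDeriv_ne_zero {K : Type*} [Field K] {c : I → ℂ} (hc : IsBalancedFan c) (x0 : I)
    (γ : I → K) (hγ : ∀ x, γ x ≠ 0)
    (hsep : ∀ x y, x ≠ y → (c x).arg = (c y).arg → γ x ≠ γ y) :
    ∃ k : I → ℤ, ∑ x, k x = 0 ∧ fanDeriv c (fun x => (k x : K)) γ ≠ 0 := by
  have hsum : ∀ x y : I, x ≠ y →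
      ∑ z, ((if z = x then 1 else 0) - if z = y then 1 else 0 : ℤ) = 0 := by
    intro x y _
    simp
  have hder : ∀ x y : I, fanDeriv c
      (fun z => (((if z = x then 1 else 0) - if z = y then 1 else 0 : ℤ) : K)) γ =
      ∑ L ∈ (upperFamily c).erase Finset.univ,
        ((if x ∈ L then ∏ z ∈ L, γ z else 0) - if y ∈ L then ∏ z ∈ L, γ z else 0) := by
    intro x y
    refine Finset.sum_congr rfl fun L _ => ?_
    push_cast
    rw [Finset.sum_sub_distrib]
    simp only [Finset.sum_ite_eq']
    split_ifs <;> ring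
  by_contra hcon
  push Not at hcon
  by_cases hdup : ∃ x y, x ≠ y ∧ (c x).arg = (c y).arg
  -- In the derivative along `x` minus `y` the upper sets that do not separate the parallel `x` and
  -- `y` cancel. The rest is a unit times (γ x - γ y) ∏ (1 + γ z) over the other parallel z, so one
  -- of those z has γ z = -1. Applying this to (x, y) and then to (x, z) gives two distinct parallel
  -- entries equal to -1.
  · have key : ∀ x y, x ≠ y → (c x).arg = (c y).arg →
        ∃ z, z ≠ x ∧ z ≠ y ∧ (c z).arg = (c x).arg ∧ γ z = -1 := by
      intro x y hxy harg
      have h1 := hcon _ (hsum x y hxy)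
      rw [hder] at h1
      have hxl : x ∈ level c (c x) := by rw [mem_level]
      have hyl : y ∈ level c (c x) := by rw [mem_level, harg]
      have h2 : ∑ L ∈ (upperFamily c).erase Finset.univ,
          ((if x ∈ L then ∏ z ∈ L, γ z else 0) - if y ∈ L then ∏ z ∈ L, γ z else 0) =
          ∑ L ∈ faceFamily c (c x),
          ((if x ∈ L then ∏ z ∈ L, γ z else 0) - if y ∈ L then ∏ z ∈ L, γ z else 0) := by
        have e1 : ∑ L ∈ (upperFamily c).erase Finset.univ,
            ((if x ∈ L then ∏ z ∈ L, γ z else 0) - if y ∈ L then ∏ z ∈ L, γ z else 0) =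
            ∑ L ∈ upperFamily c,
            ((if x ∈ L then ∏ z ∈ L, γ z else 0) - if y ∈ L then ∏ z ∈ L, γ z else 0) := by
          rw [← Finset.sum_erase_add _ _ (univ_mem_upperFamily c)]
          simp
        rw [e1]
        symm
        apply Finset.sum_subset (Finset.filter_subset _ _)
        intro L hL hLf
        have hiff : x ∈ L ↔ y ∈ L := by
          by_contra hne
          apply hLf
          rw [Finset.mem_filter]
          refine ⟨hL, ?_⟩
          rw [mem_upperFamily] at hL
          have hw : ∃ w ∈ L, (c w).arg = (c x).arg := by
            by_cases hx : x ∈ L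
            · exact ⟨x, hx, rfl⟩
            · exact ⟨y, by tauto, harg.symm⟩
          have hw' : ∃ w, w ∉ L ∧ (c w).arg = (c x).arg := by
            by_cases hx : x ∈ L
            · exact ⟨y, by tauto, harg.symm⟩
            · exact ⟨x, hx, rfl⟩
          obtain ⟨w, hw, hwx⟩ := hw
          obtain ⟨w', hw', hwx'⟩ := hw'
          constructor
          · intro z hz
            rw [mem_above] at hz
            exact hL w hw z (by linarith)
          · intro z hz
            rw [Finset.mem_union, mem_above, mem_level]
            rcases lt_trichotomy (c x).arg (c z).arg with h | h | h
            · exact Or.inl h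
            · exact Or.inr h.symm
            · exact absurd (hL z hz w' (by linarith)) hw'
        by_cases hx : x ∈ L
        · rw [if_pos hx, if_pos (hiff.mp hx), sub_self]
        · rw [if_neg hx, if_neg (fun h => hx (hiff.mpr h)), sub_self]
      rw [h2, Finset.sum_sub_distrib, sum_faceFamily_mem c _ γ hxl,
        sum_faceFamily_mem c _ γ hyl] at h1
      have hy' : y ∈ (level c (c x)).erase x := Finset.mem_erase.mpr ⟨hxy.symm, hyl⟩
      have hx' : x ∈ (level c (c x)).erase y := Finset.mem_erase.mpr ⟨hxy, hxl⟩
      rw [← Finset.mul_prod_erase _ _ hy', ← Finset.mul_prod_erase _ _ hx',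
        Finset.erase_right_comm (a := y) (b := x)] at h1
      have h3 : (∏ z ∈ above c (c x), γ z) * ((γ x - γ y) *
          ∏ z ∈ ((level c (c x)).erase x).erase y, (1 + γ z)) = 0 := by
        linear_combination h1
      have h4 : ∏ z ∈ above c (c x), γ z ≠ 0 := Finset.prod_ne_zero_iff.mpr fun z _ => hγ z
      have h5 : γ x - γ y ≠ 0 := sub_ne_zero.mpr (hsep x y hxy harg)
      have h6 := (mul_eq_zero.mp ((mul_eq_zero.mp h3).resolve_left h4)).resolve_left h5
      obtain ⟨z, hz, hz0⟩ := Finset.prod_eq_zero_iff.mp h6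
      simp only [Finset.mem_erase, mem_level] at hz
      exact ⟨z, hz.2.1, hz.1, hz.2.2, by linear_combination hz0⟩
    obtain ⟨x, y, hxy, harg⟩ := hdup
    obtain ⟨z, hzx, hzy, hza, hz⟩ := key x y hxy harg
    obtain ⟨w, hwx, hwz, hwa, hw⟩ := key x z hzx.symm hza.symm
    exact hsep w z hwz (hwa.trans hza.symm) (hw.trans hz.symm)
  · push Not at hdup
    -- Without ties the upper sets form a chain. With `x` and `y` of largest and second largest
    -- argument, only {x} contains `x` but not `y`, and the derivative equals γ x.
    obtain ⟨x, _, hx⟩ := Finset.exists_max_image Finset.univ (fun z => (c z).arg) ⟨x0, by simp⟩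
    obtain ⟨x', hx'⟩ := hc.spanning (c x) (hc.ne_zero x)
    have hne : x' ≠ x := by
      rintro rfl
      exact hx' (cross_eq_zero (Or.inl (sub_self _)))
    obtain ⟨y, hy, hymax⟩ := Finset.exists_max_image (Finset.univ.erase x) (fun z => (c z).arg)
      ⟨x', by simp [hne]⟩
    have hyx : y ≠ x := Finset.ne_of_mem_erase hy
    have hlt : (c y).arg < (c x).arg := lt_of_le_of_ne (hx y (by simp)) (hdup y x hyx)
    have h1 := hcon _ (hsum x y hyx.symm)
    rw [hder] at h1
    have hmem : ({x} : Finset I) ∈ (upperFamily c).erase Finset.univ := by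
      rw [Finset.mem_erase, mem_upperFamily]
      refine ⟨fun h => ?_, ?_⟩
      · have : y ∈ ({x} : Finset I) := by simp [h]
        exact hyx (by simpa using this)
      · intro z hz w hw
        rw [Finset.mem_singleton] at hz
        subst hz
        exact absurd (hx w (by simp)) (not_le.mpr hw)
    rw [Finset.sum_eq_single_of_mem _ hmem] at h1
    · simp [hyx] at h1
      exact hγ x h1
    · intro L hL hLx
      rw [Finset.mem_erase, mem_upperFamily] at hL
      by_cases hyL : y ∈ L
      · have hxL : x ∈ L := hL.2 y hyL x hlt
        simp [hxL, hyL]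
      · by_cases hxL : x ∈ L
        · exfalso
          apply hLx
          ext z
          rw [Finset.mem_singleton]
          constructor
          · intro hz
            by_contra hzx
            have hzy : z ≠ y := by
              rintro rfl
              exact hyL hz
            have := hymax z (by simp [hzx])
            exact hyL (hL.2 z hz y (lt_of_le_of_ne this (hdup z y hzy)))
          · rintro rfl
            exact hxL
        · simp [hxL, hyL]

end Fan


universe u

/-! ### Generic smoothness and the discriminant -/

section Discriminant

open scoped Classical

variable {I : Type*} [Fintype I]

/-- A lattice vector as a vector of the plane `ℂ`. -/
def latticeToComplex (p : ℤ × ℤ) : ℂ := ⟨p.1, p.2⟩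

/-- A balanced family of primitive lattice vectors of the plane that are not all parallel. -/
structure IsLatticeFan (m : I → ℤ × ℤ) : Prop where
  balanced : IsBalancedFan fun x => latticeToComplex (m x)
  primitive : ∀ x, ∃ m' : ℤ × ℤ, (m x).1 * m'.2 - (m x).2 * m'.1 = -1

lemma cross_latticeToComplex (p q : ℤ × ℤ) :
    cross (latticeToComplex p) (latticeToComplex q) = ((p.1 * q.2 - p.2 * q.1 : ℤ) : ℝ) := by
  simp [cross, latticeToComplex]

/-- Parallel primitive lattice vectors agree up to sign. -/
lemma eq_or_eq_neg_of_parallel {p q p' q' : ℤ × ℤ} (hp : p.1 * p'.2 - p.2 * p'.1 = -1)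
    (hq : q.1 * q'.2 - q.2 * q'.1 = -1) (h : p.1 * q.2 - p.2 * q.1 = 0) : p = q ∨ p = -q := by
  have h1 : q.1 = -(q.1 * p'.2 - q.2 * p'.1) * p.1 := by linear_combination q.1 * hp - p'.1 * h
  have h2 : q.2 = -(q.1 * p'.2 - q.2 * p'.1) * p.2 := by linear_combination q.2 * hp - p'.2 * h
  set t := -(q.1 * p'.2 - q.2 * p'.1) with ht
  -- `q` is `t` times `p`, and its primitivity forces `t` to be a unit.
  have h3 : t ∣ 1 := by
    refine ⟨-(p.1 * q'.2 - p.2 * q'.1), ?_⟩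
    linear_combination hq - h1 * q'.2 + h2 * q'.1
  rcases Int.isUnit_iff.mp (isUnit_of_dvd_one h3) with h4 | h4
  · left
    rw [h4] at h1 h2
    ext <;> linarith
  · right
    rw [h4] at h1 h2
    ext <;> simp <;> linarith

/-- Parallel primitive vectors agree up to sign, and opposite vectors have different arguments.
Hence a level of the fan consists of copies of one vector. -/
lemma IsLatticeFan.eq_of_arg_eq {m : I → ℤ × ℤ} (hm : IsLatticeFan m) {x y : I}
    (h : (latticeToComplex (m x)).arg = (latticeToComplex (m y)).arg) : m x = m y := by
  have h1 : cross (latticeToComplex (m x)) (latticeToComplex (m y)) = 0 :=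
    cross_eq_zero (Or.inl (by rw [h, sub_self]))
  rw [cross_latticeToComplex] at h1
  obtain ⟨p', hp'⟩ := hm.primitive x
  obtain ⟨q', hq'⟩ := hm.primitive y
  rcases eq_or_eq_neg_of_parallel hp' hq' (by exact_mod_cast h1) with h2 | h2
  · exact h2
  · exfalso
    have h3 := hm.balanced.ne_zero y
    have h4 : latticeToComplex (m x) = -latticeToComplex (m y) := by
      rw [h2]
      apply Complex.ext <;> simp [latticeToComplex]
    rw [h4, Complex.arg_eq_arg_iff (neg_ne_zero.mpr h3) h3] at h
    rw [norm_neg, div_self (by exact_mod_cast norm_ne_zero_iff.mpr h3)] at h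
    simp only [one_mul] at h
    exact h3 (by linear_combination (-1 / 2 : ℂ) * h)

lemma map_fanSum {A B : Type*} [CommRing A] [CommRing B] (φ : A →+* B) (c : I → ℂ) (γ : I → A) :
    φ (fanSum c γ) = fanSum c fun x => φ (γ x) := by
  simp [fanSum, map_sum, map_prod]

lemma map_fanDeriv {A B : Type*} [CommRing A] [CommRing B] (φ : A →+* B) (c : I → ℂ)
    (k γ : I → A) : φ (fanDeriv c k γ) = fanDeriv c (fun x => φ (k x)) fun x => φ (γ x) := by
  simp [fanDeriv, map_sum, map_prod]

lemma derivation_prod {K J : Type*} [Field K] (D : Derivation ℤ K K) (s : Finset J) (γ l : J → K)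
    (h : ∀ x ∈ s, D (γ x) = l x * γ x) : D (∏ x ∈ s, γ x) = (∑ x ∈ s, l x) * ∏ x ∈ s, γ x := by
  induction s using Finset.induction_on with
  | empty => simp
  | insert a s ha ih =>
    rw [Finset.prod_insert ha, D.leibniz, ih fun x hx => h x (Finset.mem_insert_of_mem hx),
      h a (Finset.mem_insert_self a s), Finset.sum_insert ha]
    simp only [smul_eq_mul]
    ring

lemma derivation_zpow {K : Type*} [Field K] (D : Derivation ℤ K K) {z : K} (hz : z ≠ 0) (n : ℤ) :
    D (z ^ n) = n * (D z / z) * z ^ n := by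
  have hnat : ∀ n : ℕ, D (z ^ n) = n * (D z / z) * z ^ n := by
    intro n
    have := derivation_prod D (Finset.range n) (fun _ => z) (fun _ => D z / z)
      (fun _ _ => by field_simp)
    simpa using this
  obtain ⟨k, rfl | rfl⟩ := n.eq_nat_or_neg
  · simpa using hnat k
  · have h1 : D (z ^ (-(k : ℤ)) * z ^ k) = 0 := by
      rw [zpow_neg, zpow_natCast, inv_mul_cancel₀ (pow_ne_zero k hz)]
      simp
    rw [D.leibniz, hnat k] at h1
    simp only [smul_eq_mul] at h1
    have hk : z ^ k ≠ 0 := pow_ne_zero k hz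
    apply mul_left_cancel₀ hk
    push_cast
    linear_combination h1

lemma derivation_fanSum {K : Type*} [Field K] (D : Derivation ℤ K K) (c : I → ℂ) (γ l : I → K)
    (h : ∀ x, D (γ x) = l x * γ x) : D (fanSum c γ) = fanDeriv c l γ := by
  rw [fanSum, fanDeriv, map_sum]
  exact Finset.sum_congr rfl fun L _ => derivation_prod D L γ l fun x _ => h x

/-- For the tuples `b` with product one, given by their entries other than `b x0`, a polynomial whose
non-vanishing means that `b x ≠ b y`. -/
noncomputable def separator (x0 x y : I) : MvPolynomial {x : I // x ≠ x0} ℂ :=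
  if hx : x = x0 then
    (if hy : y = x0 then 1 else MvPolynomial.X ⟨y, hy⟩ * (∏ w, MvPolynomial.X w) - 1)
  else (if hy : y = x0 then MvPolynomial.X ⟨x, hx⟩ * (∏ w, MvPolynomial.X w) - 1
    else MvPolynomial.X ⟨x, hx⟩ - MvPolynomial.X ⟨y, hy⟩)

lemma separator_ne_zero (x0 x y : I) (hxy : x ≠ y) : separator x0 x y ≠ 0 := by
  unfold separator
  split_ifs with hx hy hy
  · exact one_ne_zero
  · intro h
    have := congrArg (MvPolynomial.eval fun _ => (0 : ℂ)) h
    simp at this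
  · intro h
    have := congrArg (MvPolynomial.eval fun _ => (0 : ℂ)) h
    simp at this
  · rw [sub_ne_zero]
    intro h
    exact hxy (congrArg Subtype.val (MvPolynomial.X_injective h))

/-- The entry at `x0` is the inverse of the product of the others. Comparing with it therefore
becomes polynomial after multiplication by that product. -/
lemma ne_of_separator {A : Type*} [CommRing A] (x0 : I) (φ : MvPolynomial {x : I // x ≠ x0} ℂ →+* A)
    (b : I → A) (hb : ∀ x (h : x ≠ x0), φ (MvPolynomial.X ⟨x, h⟩) = b x) (hprod : ∏ x, b x = 1)
    {x y : I} (hxy : x ≠ y) (h : φ (separator x0 x y) ≠ 0) : b x ≠ b y := by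
  have hP : b x0 * φ (∏ w, MvPolynomial.X w) = 1 := by
    rw [map_prod, ← hprod, Fintype.prod_eq_mul_prod_subtype_ne b x0]
    congr 1
    exact Finset.prod_congr rfl fun w _ => hb w.1 w.2
  intro heq
  apply h
  unfold separator
  split_ifs with hx hy hy
  · exact absurd (hx.trans hy.symm) hxy
  · rw [map_sub, map_mul, hb, map_one, ← heq, hx, hP, sub_self]
  · rw [map_sub, map_mul, hb, map_one, heq, hy, hP, sub_self]
  · rw [map_sub, hb, hb, heq, sub_self]

/-- Singular points of the curve given by `β x` and the directions `m x`, in logarithmic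
coordinates. -/
def IsSingularAt {K : Type*} [Field K] (m : I → ℤ × ℤ) (β : I → K) (z : Fin 2 → K) : Prop :=
  fanSum (fun x => latticeToComplex (m x)) (fun x => β x * (z 0 ^ (m x).1 * z 1 ^ (m x).2)) = 0 ∧
  fanDeriv (fun x => latticeToComplex (m x)) (fun x => ((m x).1 : K))
    (fun x => β x * (z 0 ^ (m x).1 * z 1 ^ (m x).2)) = 0 ∧
  fanDeriv (fun x => latticeToComplex (m x)) (fun x => ((m x).2 : K))
    (fun x => β x * (z 0 ^ (m x).1 * z 1 ^ (m x).2)) = 0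

/-- Over a field generated by generic `β` with product one and a point `z`, the point `z` is not
singular. -/
lemma not_isSingularAt_of_generic {m : I → ℤ × ℤ} (hm : IsLatticeFan m) (x0 : I) {L : Type*}
    [Field L] [Algebra (MvPolynomial {x : I // x ≠ x0} ℂ) L]
    [Algebra.EssFiniteType (MvPolynomial {x : I // x ≠ x0} ℂ) L]
    (hinj : Function.Injective (algebraMap (MvPolynomial {x : I // x ≠ x0} ℂ) L))
    (b : I → L) (hb : ∀ x (h : x ≠ x0),
      algebraMap (MvPolynomial {x : I // x ≠ x0} ℂ) L (MvPolynomial.X ⟨x, h⟩) = b x)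
    (hprod : ∏ x, b x = 1) (z : Fin 2 → L) (hz : ∀ k, z k ≠ 0) : ¬ IsSingularAt m b z := by
  rintro ⟨h0, h1, h2⟩
  have hb0 : ∀ x, b x ≠ 0 := by
    intro x hx
    rw [Finset.prod_eq_zero (Finset.mem_univ x) hx] at hprod
    exact zero_ne_one hprod
  have hsep : ∀ x y, x ≠ y → b x ≠ b y := fun x y hxy =>
    ne_of_separator x0 (algebraMap _ L) b hb hprod hxy
      ((map_ne_zero_iff _ hinj).mpr (separator_ne_zero x0 x y hxy))
  have hmono : ∀ x, z 0 ^ (m x).1 * z 1 ^ (m x).2 ≠ 0 := fun x =>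
    mul_ne_zero (zpow_ne_zero _ (hz 0)) (zpow_ne_zero _ (hz 1))
  obtain ⟨k, hk0, hk⟩ := exists_fanDeriv_ne_zero hm.balanced x0
    (fun x => b x * (z 0 ^ (m x).1 * z 1 ^ (m x).2))
    (fun x => mul_ne_zero (hb0 x) (hmono x)) (by
      intro x y hxy harg heq
      have e := hm.eq_of_arg_eq harg
      simp only [e] at heq
      exact hsep x y hxy (mul_right_cancel₀ (hmono y) heq))
  apply hk
  -- The vector field Σ k_w X_w ∂/∂X_w on the parameter space, along which the universal equation
  -- has nonzero derivative.
  obtain ⟨δ, hδ⟩ : ∃ δ : Derivation ℂ (MvPolynomial {x : I // x ≠ x0} ℂ)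
      (MvPolynomial {x : I // x ≠ x0} ℂ), ∀ w, δ (MvPolynomial.X w) =
        (k w.1 : MvPolynomial {x : I // x ≠ x0} ℂ) * MvPolynomial.X w :=
    ⟨MvPolynomial.mkDerivation ℂ _, fun w => MvPolynomial.mkDerivation_X _ _ w⟩
  obtain ⟨D, hD⟩ := exists_derivation_extension hinj δ.toLinearMap.toAddMonoidHom (by
    intro f g
    exact δ.leibniz f g)
  -- The entry at `x0` is determined by ∏ b = 1, and Σ k = 0 makes its logarithmic derivative `k x0`
  -- as well.
  have hDb : ∀ x, D (b x) = k x * b x := by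
    have hne : ∀ x, x ≠ x0 → D (b x) = k x * b x := by
      intro x hx
      rw [← hb x hx, hD]
      change algebraMap (MvPolynomial {x : I // x ≠ x0} ℂ) L (δ _) = _
      rw [hδ, map_mul, map_intCast]
    intro x
    by_cases hx : x = x0
    · subst hx
      have e1 := derivation_prod D Finset.univ b (fun y => D (b y) / b y)
        (fun y _ => by rw [div_mul_cancel₀ _ (hb0 y)])
      rw [hprod, Derivation.map_one_eq_zero, mul_one,
        Fintype.sum_eq_add_sum_subtype_ne _ x] at e1
      have e2 : ∑ y : {y // y ≠ x}, D (b y) / b y = ∑ y : {y // y ≠ x}, (k y : L) := by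
        refine Finset.sum_congr rfl fun y _ => ?_
        rw [hne y.1 y.2, mul_div_cancel_right₀ _ (hb0 _)]
      have e3 : (k x : L) + ∑ y : {y // y ≠ x}, (k y : L) = 0 := by
        have := congrArg (Int.cast : ℤ → L) hk0
        rw [Fintype.sum_eq_add_sum_subtype_ne _ x] at this
        push_cast at this
        exact this
      have e4 : D (b x) / b x = k x := by
        rw [e2] at e1
        linear_combination -e1 - e3
      rw [← e4, div_mul_cancel₀ _ (hb0 x)]
    · exact hne x hx
  have hDγ : ∀ x, D (b x * (z 0 ^ (m x).1 * z 1 ^ (m x).2)) =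
      ((k x : L) + ((m x).1 * (D (z 0) / z 0) + (m x).2 * (D (z 1) / z 1))) *
        (b x * (z 0 ^ (m x).1 * z 1 ^ (m x).2)) := by
    intro x
    rw [D.leibniz, D.leibniz, derivation_zpow D (hz 0), derivation_zpow D (hz 1), hDb]
    simp only [smul_eq_mul]
    ring
  -- Differentiating the vanishing equation gives the derivative along `k` plus multiples of the two
  -- logarithmic derivatives of the curve. At a singular point the latter vanish, and so would the
  -- former.
  have e := derivation_fanSum D (fun x => latticeToComplex (m x)) _ _ hDγ
  rw [h0, map_zero, fanDeriv_add, fanDeriv_add, fanDeriv_mul, fanDeriv_mul, h1, h2] at e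
  simpa using e.symm

/-- The monomial of exponent `p` in coordinates `X 1`, `X 3` with inverses `X 2`, `X 4`. -/
noncomputable def monomialPoly (R : Type*) [CommRing R] (p : ℤ × ℤ) : MvPolynomial (Fin 5) R :=
  (MvPolynomial.X 1 ^ p.1.toNat * MvPolynomial.X 2 ^ (-p.1).toNat) *
    (MvPolynomial.X 3 ^ p.2.toNat * MvPolynomial.X 4 ^ (-p.2).toNat)

lemma zpow_eq_toNat {K : Type*} [Field K] (z w : K) (h : z * w = 1) (n : ℤ) :
    z ^ n.toNat * w ^ (-n).toNat = z ^ n := by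
  have hz : z ≠ 0 := left_ne_zero_of_mul_eq_one h
  obtain rfl : w = z⁻¹ := eq_inv_of_mul_eq_one_right h
  rw [inv_pow, ← zpow_natCast, ← zpow_natCast, ← zpow_neg, ← zpow_add₀ hz]
  congr 1
  omega

lemma map_monomialPoly {R K : Type*} [CommRing R] [Field K] (φ : MvPolynomial (Fin 5) R →+* K)
    (h1 : φ (MvPolynomial.X 1) * φ (MvPolynomial.X 2) = 1)
    (h2 : φ (MvPolynomial.X 3) * φ (MvPolynomial.X 4) = 1) (p : ℤ × ℤ) :
    φ (monomialPoly R p) = φ (MvPolynomial.X 1) ^ p.1 * φ (MvPolynomial.X 3) ^ p.2 := by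
  simp only [monomialPoly, map_mul, map_pow]
  rw [zpow_eq_toNat _ _ h1, zpow_eq_toNat _ _ h2]

/-- The tuple with product one, in terms of its entries other than the one at `x0`, and the entry at
`x0` as a further variable. -/
noncomputable def tuplePoly (x0 x : I) :
    MvPolynomial (Fin 5) (MvPolynomial {x : I // x ≠ x0} ℂ) :=
  if h : x = x0 then MvPolynomial.X 0 else MvPolynomial.C (MvPolynomial.X ⟨x, h⟩)

/-- The equations for a singular point. -/
noncomputable def singularIdeal (m : I → ℤ × ℤ) (x0 : I) :
    Ideal (MvPolynomial (Fin 5) (MvPolynomial {x : I // x ≠ x0} ℂ)) :=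
  Ideal.span {∏ x, tuplePoly x0 x - 1,
    MvPolynomial.X 1 * MvPolynomial.X 2 - 1, MvPolynomial.X 3 * MvPolynomial.X 4 - 1,
    fanSum (fun x => latticeToComplex (m x)) (fun x => tuplePoly x0 x * monomialPoly _ (m x)),
    fanDeriv (fun x => latticeToComplex (m x)) (fun x => ((m x).1 : MvPolynomial (Fin 5) _))
      (fun x => tuplePoly x0 x * monomialPoly _ (m x)),
    fanDeriv (fun x => latticeToComplex (m x)) (fun x => ((m x).2 : MvPolynomial (Fin 5) _))
      (fun x => tuplePoly x0 x * monomialPoly _ (m x))}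

/-- The dictionary between points of the scheme of singular points, with values in a field, and
actual singular points. It is used at the generic point and at complex points. -/
lemma singularIdeal_le_ker_iff (m : I → ℤ × ℤ) (x0 : I) {K : Type*} [Field K]
    (φ : MvPolynomial (Fin 5) (MvPolynomial {x : I // x ≠ x0} ℂ) →+* K) :
    singularIdeal m x0 ≤ RingHom.ker φ ↔ ∏ x, φ (tuplePoly x0 x) = 1 ∧
      φ (MvPolynomial.X 1) * φ (MvPolynomial.X 2) = 1 ∧
      φ (MvPolynomial.X 3) * φ (MvPolynomial.X 4) = 1 ∧
      IsSingularAt m (fun x => φ (tuplePoly x0 x))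
        ![φ (MvPolynomial.X 1), φ (MvPolynomial.X 3)] := by
  rw [singularIdeal, Ideal.span_le]
  simp only [Set.insert_subset_iff, Set.singleton_subset_iff, SetLike.mem_coe, RingHom.mem_ker,
    map_sub, map_mul, map_one, map_prod, sub_eq_zero, map_fanSum, map_fanDeriv, map_intCast,
    IsSingularAt, Matrix.cons_val_zero, Matrix.cons_val_one]
  refine and_congr_right fun _ => and_congr_right fun h1 => and_congr_right fun h2 => ?_
  simp only [map_monomialPoly φ h1 h2]

/-- The residue field at a prime, as a finitely generated extension. -/
lemma exists_field_of_isPrime (R : Type*) {S : Type u} [CommRing R] [CommRing S] [Algebra R S]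
    [Algebra.FiniteType R S] (P : Ideal S) [P.IsPrime] :
    ∃ (L : Type u) (_ : Field L) (_ : Algebra R L) (φ : S →ₐ[R] L),
      Algebra.EssFiniteType R L ∧ RingHom.ker φ.toRingHom = P := by
  refine ⟨FractionRing (S ⧸ P), inferInstance, inferInstance,
    (IsScalarTower.toAlgHom R (S ⧸ P) (FractionRing (S ⧸ P))).comp (Ideal.Quotient.mkₐ R P),
    inferInstance, ?_⟩
  ext x
  rw [RingHom.mem_ker, ← Ideal.Quotient.eq_zero_iff_mem]
  exact map_eq_zero_iff (algebraMap (S ⧸ P) (FractionRing (S ⧸ P)))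
    (IsFractionRing.injective (S ⧸ P) (FractionRing (S ⧸ P)))

/-- The singular curves form a proper closed subset of the family of curves with given directions
`m` of the ends: outside of the zeros of a nonzero polynomial, the positions `β` of parallel ends are
distinct and the curve is smooth. -/
theorem exists_discriminant {m : I → ℤ × ℤ} (hm : IsLatticeFan m) (x0 : I) :
    ∃ Δ : MvPolynomial {x : I // x ≠ x0} ℂ, Δ ≠ 0 ∧ ∀ β : I → ℂ, ∏ x, β x = 1 →
      MvPolynomial.eval (fun x => β x.1) Δ ≠ 0 →
      (∀ x y, x ≠ y → β x ≠ β y) ∧ ∀ z : Fin 2 → ℂ, (∀ k, z k ≠ 0) → ¬ IsSingularAt m β z := by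
  obtain ⟨Δ, hΔ0, hΔ⟩ : ∃ Δ : MvPolynomial {x : I // x ≠ x0} ℂ, Δ ≠ 0 ∧
      MvPolynomial.C Δ ∈ singularIdeal m x0 := by
    -- If the ideal meets the parameter ring only in zero, some prime above it does too. Its residue
    -- field carries a singular point over generic parameters.
    by_contra hcon
    push Not at hcon
    obtain ⟨P, hIP, hP, hle⟩ := Ideal.exists_ideal_comap_le_prime
      (f := (MvPolynomial.C : _ →+* MvPolynomial (Fin 5) (MvPolynomial {x : I // x ≠ x0} ℂ)))
      (⊥ : Ideal (MvPolynomial {x : I // x ≠ x0} ℂ)) (singularIdeal m x0) (by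
        intro r hr
        rw [Ideal.mem_comap] at hr
        by_contra h
        exact hcon r (by simpa using h) hr)
    obtain ⟨L, _, _, φ, hfin, hker⟩ :=
      exists_field_of_isPrime (MvPolynomial {x : I // x ≠ x0} ℂ) P
    have halg : ∀ r, algebraMap (MvPolynomial {x : I // x ≠ x0} ℂ) L r =
        φ (MvPolynomial.C r) := fun r => (φ.commutes r).symm
    have hinj : Function.Injective (algebraMap (MvPolynomial {x : I // x ≠ x0} ℂ) L) := by
      rw [injective_iff_map_eq_zero]
      intro r hr
      have hr' : MvPolynomial.C r ∈ RingHom.ker φ.toRingHom := by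
        rw [RingHom.mem_ker, ← hr, halg]
        rfl
      rw [hker] at hr'
      simpa using hle hr'
    obtain ⟨h1, h2, h3, h4⟩ := (singularIdeal_le_ker_iff m x0 φ.toRingHom).mp (by rwa [hker])
    refine not_isSingularAt_of_generic hm x0 hinj _ ?_ h1 _ ?_ h4
    · intro x hx
      rw [halg, tuplePoly, dif_neg hx]
      rfl
    · intro k
      fin_cases k
      · exact left_ne_zero_of_mul_eq_one h2
      · exact left_ne_zero_of_mul_eq_one h3
  -- The additional factors keep all entries of `β` apart.
  refine ⟨Δ * ∏ w ∈ Finset.univ.filter (fun w : I × I => w.1 ≠ w.2), separator x0 w.1 w.2, ?_, ?_⟩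
  · refine mul_ne_zero hΔ0 (Finset.prod_ne_zero_iff.mpr fun w hw => ?_)
    exact separator_ne_zero _ _ _ (Finset.mem_filter.mp hw).2
  intro β hβ hne
  rw [map_mul, map_prod] at hne
  constructor
  · intro x y hxy
    refine ne_of_separator x0 (MvPolynomial.eval fun x => β x.1) β (fun x h => by simp) hβ hxy ?_
    exact Finset.prod_ne_zero_iff.mp (right_ne_zero_of_mul hne) (x, y) (by simp [hxy])
  · intro z hz hsing
    let φ : MvPolynomial (Fin 5) (MvPolynomial {x : I // x ≠ x0} ℂ) →+* ℂ :=
      MvPolynomial.eval₂Hom (MvPolynomial.eval fun x => β x.1) ![β x0, z 0, (z 0)⁻¹, z 1, (z 1)⁻¹]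
    have hφt : ∀ x, φ (tuplePoly x0 x) = β x := by
      intro x
      rw [tuplePoly]
      split_ifs with h
      · simp [φ, h]
      · simp [φ]
    have h1 : φ (MvPolynomial.X 1) = z 0 := by simp [φ]
    have h2 : φ (MvPolynomial.X 2) = (z 0)⁻¹ := by simp [φ]
    have h3 : φ (MvPolynomial.X 3) = z 1 := by simp [φ]
    have h4 : φ (MvPolynomial.X 4) = (z 1)⁻¹ := by simp [φ]
    have hle : singularIdeal m x0 ≤ RingHom.ker φ := by
      rw [singularIdeal_le_ker_iff]
      simp only [hφt, h1, h2, h3, h4]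
      refine ⟨hβ, mul_inv_cancel₀ (hz 0), mul_inv_cancel₀ (hz 1), ?_⟩
      convert hsing using 1
      ext k
      fin_cases k <;> rfl
    have := hle hΔ
    rw [RingHom.mem_ker] at this
    apply left_ne_zero_of_mul hne
    simpa [φ] using this

end Discriminant


/-! ### The Laurent polynomial of a fan -/

section LaurentPolynomials

open scoped Classical

variable {I : Type*} [Fintype I]

lemma monomialAt_add (p q : ℤ × ℤ) (z : Fin 2 → ℂˣ) :
    monomialAt (p + q) z = monomialAt p z * monomialAt q z := by
  simp only [monomialAt, Prod.fst_add, Prod.snd_add, zpow_add]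
  exact mul_mul_mul_comm _ _ _ _

lemma monomialAt_zero (z : Fin 2 → ℂˣ) : monomialAt 0 z = 1 := by simp [monomialAt]

lemma monomialAt_neg (p : ℤ × ℤ) (z : Fin 2 → ℂˣ) :
    monomialAt (-p) z = (monomialAt p z)⁻¹ := by
  rw [eq_inv_iff_mul_eq_one, ← monomialAt_add, neg_add_cancel, monomialAt_zero]

lemma monomialAt_sub (p q : ℤ × ℤ) (z : Fin 2 → ℂˣ) :
    monomialAt (p - q) z = monomialAt p z / monomialAt q z := by
  rw [sub_eq_add_neg, monomialAt_add, monomialAt_neg, div_eq_mul_inv]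

lemma monomialAt_zsmul (n : ℤ) (p : ℤ × ℤ) (z : Fin 2 → ℂˣ) :
    monomialAt (n • p) z = monomialAt p z ^ n := by
  simp only [monomialAt, Prod.smul_fst, Prod.smul_snd, smul_eq_mul, mul_zpow]
  rw [← zpow_mul, ← zpow_mul, mul_comm n, mul_comm n]

lemma monomialAt_sum {J : Type*} (s : Finset J) (m : J → ℤ × ℤ) (z : Fin 2 → ℂˣ) :
    monomialAt (∑ x ∈ s, m x) z = ∏ x ∈ s, monomialAt (m x) z := by
  induction s using Finset.induction_on with
  | empty => simp [monomialAt_zero]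
  | insert a s ha ih => rw [Finset.sum_insert ha, Finset.prod_insert ha, monomialAt_add, ih]

lemma coe_monomialAt (p : ℤ × ℤ) (z : Fin 2 → ℂˣ) :
    (monomialAt p z : ℂ) = (z 0 : ℂ) ^ p.1 * (z 1 : ℂ) ^ p.2 := by
  simp [monomialAt]

/-- The Laurent polynomial with ends in the directions `m`, at the positions given by `β`. -/
noncomputable def fanPoly (m : I → ℤ × ℤ) (β : I → ℂ) : LaurentPoly :=
  ∑ L ∈ (upperFamily fun x => latticeToComplex (m x)).erase Finset.univ,
    Finsupp.single (∑ x ∈ L, m x) (∏ x ∈ L, β x)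

lemma fanPoly_sum (m : I → ℤ × ℤ) (β : I → ℂ) (h : ℤ × ℤ → ℂ) :
    ((fanPoly m β).sum fun q a => a * h q) =
      ∑ L ∈ (upperFamily fun x => latticeToComplex (m x)).erase Finset.univ,
        (∏ x ∈ L, β x) * h (∑ x ∈ L, m x) := by
  rw [fanPoly, ← Finsupp.sum_finsetSum_index (by simp) (by intros; ring)]
  exact Finset.sum_congr rfl fun L _ => Finsupp.sum_single_index (by simp)

lemma fanPoly_support (m : I → ℤ × ℤ) (β : I → ℂ) : (fanPoly m β).support ⊆
    ((upperFamily fun x => latticeToComplex (m x)).erase Finset.univ).image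
      fun L => ∑ x ∈ L, m x := by
  intro q hq
  rw [Finsupp.mem_support_iff, fanPoly, Finsupp.finsetSum_apply] at hq
  obtain ⟨L, hL, hne⟩ := Finset.exists_ne_zero_of_sum_ne_zero hq
  rw [Finset.mem_image]
  refine ⟨L, hL, ?_⟩
  by_contra h
  exact hne (Finsupp.single_eq_of_ne (Ne.symm h))

lemma continuous_fanPoly_apply (m : I → ℤ × ℤ) (q : ℤ × ℤ) :
    Continuous fun β : I → ℂ => fanPoly m β q := by
  have : (fun β : I → ℂ => fanPoly m β q) = fun β =>
      ∑ L ∈ (upperFamily fun x => latticeToComplex (m x)).erase Finset.univ,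
        if ∑ x ∈ L, m x = q then ∏ x ∈ L, β x else 0 := by
    ext β
    rw [fanPoly, Finsupp.finsetSum_apply]
    exact Finset.sum_congr rfl fun L _ => Finsupp.single_apply
  rw [this]
  refine continuous_finsetSum _ fun L _ => ?_
  split_ifs
  · fun_prop
  · fun_prop

lemma prod_mul_monomialAt {J : Type*} (m : J → ℤ × ℤ) (β : J → ℂ) (z : Fin 2 → ℂˣ) (L : Finset J) :
    ∏ x ∈ L, β x * (monomialAt (m x) z : ℂ) =
      (∏ x ∈ L, β x) * (monomialAt (∑ x ∈ L, m x) z : ℂ) := by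
  rw [Finset.prod_mul_distrib, monomialAt_sum, Units.coe_prod]

lemma mem_curve_fanPoly (m : I → ℤ × ℤ) (β : I → ℂ) (z : Fin 2 → ℂˣ) :
    z ∈ curve (fanPoly m β) ↔
      fanSum (fun x => latticeToComplex (m x)) (fun x => β x * (monomialAt (m x) z : ℂ)) = 0 := by
  rw [curve, Set.mem_ofPred_eq, fanPoly_sum, fanSum]
  simp only [prod_mul_monomialAt]

/-- Exponents are additive along an upper set, so `fanDeriv` with the coordinates of `m x` as
weights is the logarithmic derivative z_k ∂f/∂z_k. -/
lemma isSmoothCurve_fanPoly (m : I → ℤ × ℤ) (β : I → ℂ)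
    (h : ∀ z : Fin 2 → ℂ, (∀ k, z k ≠ 0) → ¬ IsSingularAt m β z) :
    IsSmoothCurve (fanPoly m β) := by
  intro z hz
  by_contra hcon
  push Not at hcon
  apply h (fun k => (z k : ℂ)) (fun k => (z k).ne_zero)
  have e : ∀ k : ℤ × ℤ → ℂ, (∀ p q, k (p + q) = k p + k q) → k 0 = 0 →
      fanDeriv (fun x => latticeToComplex (m x)) (fun x => k (m x))
        (fun x => β x * (monomialAt (m x) z : ℂ)) =
        (fanPoly m β).sum fun q a => a * (k q * (monomialAt q z : ℂ)) := by
    intro k hk hk0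
    rw [fanPoly_sum, fanDeriv]
    refine Finset.sum_congr rfl fun L _ => ?_
    have : ∑ x ∈ L, k (m x) = k (∑ x ∈ L, m x) :=
      (map_sum (⟨⟨k, hk0⟩, hk⟩ : (ℤ × ℤ) →+ ℂ) m L).symm
    rw [prod_mul_monomialAt, this]
    ring
  simp only [IsSingularAt, ← coe_monomialAt]
  refine ⟨(mem_curve_fanPoly m β z).mp hz, ?_, ?_⟩
  · rw [e (fun p => (p.1 : ℂ)) (by intro p q; simp) (by simp), ← hcon.1]
    simp only [mul_assoc]
  · rw [e (fun p => (p.2 : ℂ)) (by intro p q; simp) (by simp), ← hcon.2]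
    simp only [mul_assoc]

/-- Multiplication of the coordinates by `t` moves the ends. -/
lemma mem_curve_fanPoly_mul (m : I → ℤ × ℤ) (β : I → ℂ) (t z : Fin 2 → ℂˣ) :
    t * z ∈ curve (fanPoly m fun x => β x * (monomialAt (m x) t : ℂ)⁻¹) ↔
      z ∈ curve (fanPoly m β) := by
  rw [mem_curve_fanPoly, mem_curve_fanPoly]
  have : ∀ x, β x * (monomialAt (m x) t : ℂ)⁻¹ * (monomialAt (m x) (t * z) : ℂ) =
      β x * (monomialAt (m x) z : ℂ) := by
    intro x
    have h : monomialAt (m x) (t * z) = monomialAt (m x) t * monomialAt (m x) z := by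
      simp only [monomialAt, Pi.mul_apply, mul_zpow]
      exact mul_mul_mul_comm _ _ _ _
    rw [h, Units.val_mul]
    field_simp
  simp only [this]

/-- The products β_x z^{m_x} are unchanged; hence smoothness survives translation. -/
lemma isSingularAt_mul_iff (m : I → ℤ × ℤ) (β : I → ℂ) (t z : Fin 2 → ℂ) (ht : ∀ k, t k ≠ 0) :
    IsSingularAt m (fun x => β x * (t 0 ^ (m x).1 * t 1 ^ (m x).2)⁻¹) (t * z) ↔
      IsSingularAt m β z := by
  have : ∀ x, β x * (t 0 ^ (m x).1 * t 1 ^ (m x).2)⁻¹ *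
      ((t * z) 0 ^ (m x).1 * (t * z) 1 ^ (m x).2) = β x * (z 0 ^ (m x).1 * z 1 ^ (m x).2) := by
    intro x
    have h0 := zpow_ne_zero (m x).1 (ht 0)
    have h1 := zpow_ne_zero (m x).2 (ht 1)
    simp only [Pi.mul_apply, mul_zpow]
    field_simp
  simp only [IsSingularAt, this]

end LaurentPolynomials

/-! ### Construction of the cylindrical ends -/

section Ends

open scoped Classical
open Filter Topology

/-- Besides existence, the local uniqueness in the last clause is needed: it places every point of
the curve near an asymptotic position on the graph. -/
lemma exists_implicit_function {H : ℂ × ℂ → ℂ} (hH : ContDiff ℂ 1 H) (h0 : H (0, 0) = 0) {d : ℂ}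
    (hd : HasDerivAt (fun s => H (0, s)) d 0) (hd0 : d ≠ 0) :
    ∃ ψ : ℂ → ℂ, ψ 0 = 0 ∧ (∀ᶠ w in 𝓝 0, DifferentiableAt ℂ ψ w) ∧
      (∀ᶠ w in 𝓝 0, H (w, ψ w) = 0) ∧ ∀ᶠ v in 𝓝 ((0, 0) : ℂ × ℂ), H v = 0 → ψ v.1 = v.2 := by
  have cdf : ContDiffAt ℂ 1 H (0, 0) := hH.contDiffAt
  have hpart : fderiv ℂ H (0, 0) ∘L .inr ℂ ℂ ℂ =
      (ContinuousLinearEquiv.unitsEquivAut ℂ (Units.mk0 d hd0) : ℂ →L[ℂ] ℂ) := by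
    ext
    have h1 : HasFDerivAt H (fderiv ℂ H (0, 0)) ((0 : ℂ), (0 : ℂ)) :=
      (cdf.differentiableAt (by simp)).hasFDerivAt
    have h2 : HasDerivAt (fun s : ℂ => ((0 : ℂ), s)) ((0 : ℂ), (1 : ℂ)) 0 :=
      (hasDerivAt_const (0 : ℂ) (0 : ℂ)).prodMk (hasDerivAt_id (0 : ℂ))
    have h3 := h1.comp_hasDerivAt (0 : ℂ) h2
    have h4 := h3.unique hd
    simpa using h4
  have if₂ : (fderiv ℂ H (0, 0) ∘L .inr ℂ ℂ ℂ).IsInvertible := by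
    rw [hpart]
    exact ContinuousLinearMap.isInvertible_equiv
  refine ⟨cdf.implicitFunction one_ne_zero if₂, cdf.implicitFunction_apply_self one_ne_zero if₂,
    ?_, ?_, ?_⟩
  · have := (cdf.contDiffAt_implicitFunction one_ne_zero if₂).eventually (by simp)
    exact this.mono fun w hw => hw.differentiableAt (by simp)
  · have := cdf.eventually_apply_implicitFunction one_ne_zero if₂
    rwa [h0] at this
  · have := cdf.eventually_apply_eq_iff_implicitFunction one_ne_zero if₂
    rw [h0] at this
    exact this.mono fun v hv h => hv.mp h

variable {I : Type*} [Fintype I]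

/-- The expression of a monomial in the coordinates `z ^ m`, `z ^ m'`. -/
lemma monomialAt_eq_of_basis {m m' : ℤ × ℤ} (h : m.1 * m'.2 - m.2 * m'.1 = -1) (p : ℤ × ℤ)
    (z : Fin 2 → ℂˣ) : monomialAt p z =
      monomialAt m z ^ (-(p.1 * m'.2 - p.2 * m'.1)) * monomialAt m' z ^ (-(m.1 * p.2 - m.2 * p.1)) := by
  rw [← monomialAt_zsmul, ← monomialAt_zsmul, ← monomialAt_add]
  congr 1
  ext
  · simp
    linear_combination p.1 * h
  · simp
    linear_combination p.2 * h

/-- The equation of the curve near an end, divided by the monomial of a vertex, in the coordinates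
`w = z ^ m'` and `s`, where `z ^ m = α exp s`. -/
noncomputable def endEquation (m : I → ℤ × ℤ) (β : I → ℂ) (μ m' : ℤ × ℤ) (α : ℂ) (v : ℂ × ℂ) : ℂ :=
  ∏ y ∈ level (fun x => latticeToComplex (m x)) (latticeToComplex μ), (1 + β y * (α * Complex.exp v.2)) +
    ∑ L ∈ restFamily (fun x => latticeToComplex (m x)) (latticeToComplex μ),
      (∏ x ∈ L, β x) * (∏ x ∈ above (fun x => latticeToComplex (m x)) (latticeToComplex μ), β x)⁻¹ *
      (α ^ (-((∑ x ∈ L, m x - ∑ x ∈ above (fun x => latticeToComplex (m x)) (latticeToComplex μ), m x).1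
          * m'.2 -
        (∑ x ∈ L, m x - ∑ x ∈ above (fun x => latticeToComplex (m x)) (latticeToComplex μ), m x).2
          * m'.1)) *
        Complex.exp ((-((∑ x ∈ L, m x -
          ∑ x ∈ above (fun x => latticeToComplex (m x)) (latticeToComplex μ), m x).1 * m'.2 -
        (∑ x ∈ L, m x - ∑ x ∈ above (fun x => latticeToComplex (m x)) (latticeToComplex μ), m x).2
          * m'.1) : ℤ) * v.2)) *
      v.1 ^ (-(μ.1 * (∑ x ∈ L, m x -
          ∑ x ∈ above (fun x => latticeToComplex (m x)) (latticeToComplex μ), m x).2 -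
        μ.2 * (∑ x ∈ L, m x -
          ∑ x ∈ above (fun x => latticeToComplex (m x)) (latticeToComplex μ), m x).1)).toNat

lemma latticeToComplex_sub (p q : ℤ × ℤ) :
    latticeToComplex (p - q) = latticeToComplex p - latticeToComplex q := by
  apply Complex.ext <;> simp [latticeToComplex]

lemma latticeToComplex_sum {J : Type*} (s : Finset J) (m : J → ℤ × ℤ) :
    latticeToComplex (∑ x ∈ s, m x) = ∑ x ∈ s, latticeToComplex (m x) := by
  apply Complex.ext <;> simp [latticeToComplex, Prod.fst_sum, Prod.snd_sum]

lemma cross_sub (η a b : ℂ) : cross η (a - b) = cross η a - cross η b := by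
  simp [cross]
  ring

/-- Relative to the dominant monomial, every term off the face has an exponent pointing strictly
away from `η`. This gives positive powers of w = z^{m'} near an end, and decay at infinity. -/
lemma cross_exponent_neg {m : I → ℤ × ℤ} (hm : IsLatticeFan m) {η : ℂ} (hη : η ≠ 0) {L : Finset I}
    (hL : L ∈ restFamily (fun x => latticeToComplex (m x)) η) :
    cross η (latticeToComplex (∑ x ∈ L, m x -
      ∑ x ∈ above (fun x => latticeToComplex (m x)) η, m x)) < 0 := by
  rw [latticeToComplex_sub, cross_sub, latticeToComplex_sum, latticeToComplex_sum]
  have := cross_lt_of_mem_restFamily hm.balanced hη hL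
  linarith

lemma IsLatticeFan.level_eq {m : I → ℤ × ℤ} (hm : IsLatticeFan m) (x : I) :
    level (fun x => latticeToComplex (m x)) (latticeToComplex (m x)) =
      Finset.univ.filter fun y => m y = m x := by
  ext y
  rw [mem_level, Finset.mem_filter]
  exact ⟨fun h => ⟨Finset.mem_univ _, hm.eq_of_arg_eq h⟩, fun h => by rw [h.2]⟩

/-- Division by the nonvanishing monomial of the upper set `above` leaves only nonnegative powers of
w. So `endEquation` makes sense at w = 0, the point at infinity of the end. -/
lemma fanSum_eq_endEquation {m : I → ℤ × ℤ} (hm : IsLatticeFan m) {β : I → ℂ}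
    (hβ : ∏ x, β x = 1) (x : I) {m' : ℤ × ℤ} (hm' : (m x).1 * m'.2 - (m x).2 * m'.1 = -1) (α : ℂ)
    (z : Fin 2 → ℂˣ) (v : ℂ × ℂ) (hw : (monomialAt m' z : ℂ) = v.1)
    (hs : (monomialAt (m x) z : ℂ) = α * Complex.exp v.2) :
    z ∈ curve (fanPoly m β) ↔ endEquation m β (m x) m' α v = 0 := by
  rw [mem_curve_fanPoly]
  have hη := hm.balanced.ne_zero x
  have hsum : ∑ x, m x = 0 := by
    have := hm.balanced.sum_eq
    rw [← latticeToComplex_sum] at this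
    have h1 := congrArg Complex.re this
    have h2 := congrArg Complex.im this
    simp only [latticeToComplex, Complex.zero_re, Complex.zero_im] at h1 h2
    exact Prod.ext (by exact_mod_cast h1) (by exact_mod_cast h2)
  have hβ0 : ∀ y, β y ≠ 0 := fun y hy => by
    rw [Finset.prod_eq_zero (Finset.mem_univ y) hy] at hβ
    exact zero_ne_one hβ
  rw [fanSum_eq hm.balanced hη _ (by
    rw [prod_mul_monomialAt, hβ, hsum, monomialAt_zero]
    simp)]
  simp only [prod_mul_monomialAt]
  set A := above (fun x => latticeToComplex (m x)) (latticeToComplex (m x)) with hA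
  have hA0 : (∏ y ∈ A, β y) * (monomialAt (∑ y ∈ A, m y) z : ℂ) ≠ 0 :=
    mul_ne_zero (Finset.prod_ne_zero_iff.mpr fun y _ => hβ0 y) (Units.ne_zero _)
  suffices h : (∏ y ∈ A, β y) * (monomialAt (∑ y ∈ A, m y) z : ℂ) *
      ∏ y ∈ level (fun x => latticeToComplex (m x)) (latticeToComplex (m x)),
        (1 + β y * (monomialAt (m y) z : ℂ)) +
      ∑ L ∈ restFamily (fun x => latticeToComplex (m x)) (latticeToComplex (m x)),
        (∏ y ∈ L, β y) * (monomialAt (∑ y ∈ L, m y) z : ℂ) =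
      (∏ y ∈ A, β y) * (monomialAt (∑ y ∈ A, m y) z : ℂ) * endEquation m β (m x) m' α v by
    rw [h, mul_eq_zero, or_iff_right hA0]
  rw [endEquation, mul_add, Finset.mul_sum]
  congr 1
  · congr 1
    refine Finset.prod_congr rfl fun y hy => ?_
    rw [hm.level_eq, Finset.mem_filter] at hy
    rw [hy.2, hs]
  · refine Finset.sum_congr rfl fun L hL => ?_
    have hneg := cross_exponent_neg hm hη hL
    rw [← hA] at hneg ⊢
    set e := ∑ y ∈ L, m y - ∑ y ∈ A, m y with he
    have hL' : ∑ y ∈ L, m y = e + ∑ y ∈ A, m y := by rw [he, sub_add_cancel]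
    rw [cross_latticeToComplex] at hneg
    have hneg' : (m x).1 * e.2 - (m x).2 * e.1 < 0 := by exact_mod_cast hneg
    have hk : (((-((m x).1 * e.2 - (m x).2 * e.1)).toNat : ℕ) : ℤ) =
        -((m x).1 * e.2 - (m x).2 * e.1) := Int.toNat_of_nonneg (by omega)
    have hmon : (monomialAt e z : ℂ) = α ^ (-(e.1 * m'.2 - e.2 * m'.1)) *
        Complex.exp ((-(e.1 * m'.2 - e.2 * m'.1) : ℤ) * v.2) *
        v.1 ^ (-((m x).1 * e.2 - (m x).2 * e.1)).toNat := by
      rw [monomialAt_eq_of_basis hm' e z, Units.val_mul, Units.val_zpow_eq_zpow_val,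
        Units.val_zpow_eq_zpow_val, hs, hw, mul_zpow, Complex.exp_int_mul, ← zpow_natCast v.1, hk]
    rw [hL', monomialAt_add, Units.val_mul, hmon]
    have hA1 : ∏ y ∈ A, β y ≠ 0 := Finset.prod_ne_zero_iff.mpr fun y _ => hβ0 y
    field_simp

lemma contDiff_endEquation (m : I → ℤ × ℤ) (β : I → ℂ) (μ m' : ℤ × ℤ) (α : ℂ) :
    ContDiff ℂ 1 (endEquation m β μ m' α) := by
  unfold endEquation
  refine ContDiff.add ?_ ?_
  · refine contDiff_prod fun y _ => ?_
    fun_prop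
  · refine ContDiff.sum fun L _ => ?_
    fun_prop

/-- The end of the curve at `z ^ m x = α x`. -/
lemma exists_end {m : I → ℤ × ℤ} (hm : IsLatticeFan m) {α : I → ℂˣ}
    (hα : ∏ x, (-(α x : ℂ)⁻¹) = 1) (hsep : ∀ x y, x ≠ y → m x = m y → α x ≠ α y) (x : I)
    {m' : ℤ × ℤ} (hm' : (m x).1 * m'.2 - (m x).2 * m'.1 = -1) :
    ∃ ψ : ℂ → ℂ, ψ 0 = 0 ∧ (∀ᶠ w in 𝓝 0, DifferentiableAt ℂ ψ w) ∧
      (∀ᶠ w in 𝓝 (0 : ℂ), ∀ z, (monomialAt m' z : ℂ) = w →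
        (monomialAt (m x) z : ℂ) = α x * Complex.exp (ψ w) →
        z ∈ curve (fanPoly m fun x => -(α x : ℂ)⁻¹)) ∧
      ∀ᶠ v in 𝓝 ((0, 0) : ℂ × ℂ), ∀ z ∈ curve (fanPoly m fun x => -(α x : ℂ)⁻¹),
        (monomialAt m' z : ℂ) = v.1 → (monomialAt (m x) z : ℂ) = α x * Complex.exp v.2 →
        ψ v.1 = v.2 := by
  set β : I → ℂ := fun x => -(α x : ℂ)⁻¹ with hβ
  have hαx : (α x : ℂ) ≠ 0 := (α x).ne_zero
  have hxlev : x ∈ level (fun x => latticeToComplex (m x)) (latticeToComplex (m x)) := by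
    rw [mem_level]
  -- At w = 0 the terms off the face drop out, as their powers of w are positive.
  have hrest : ∀ s : ℂ, endEquation m β (m x) m' (α x) (0, s) =
      ∏ y ∈ level (fun x => latticeToComplex (m x)) (latticeToComplex (m x)),
        (1 + β y * (α x * Complex.exp s)) := by
    intro s
    rw [endEquation, add_eq_left]
    refine Finset.sum_eq_zero fun L hL => ?_
    have hneg := cross_exponent_neg hm (hm.balanced.ne_zero x) hL
    rw [cross_latticeToComplex, ← Int.cast_zero, Int.cast_lt] at hneg
    dsimp only
    rw [zero_pow, mul_zero]
    omega
  have hx1 : 1 + β x * (α x * Complex.exp 0) = 0 := by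
    simp [hβ, hαx]
  have h0 : endEquation m β (m x) m' (α x) (0, 0) = 0 := by
    rw [hrest]
    exact Finset.prod_eq_zero hxlev hx1
  have hder : HasDerivAt (fun s => endEquation m β (m x) m' (α x) (0, s))
      (β x * α x * ∏ y ∈ (level (fun x => latticeToComplex (m x))
        (latticeToComplex (m x))).erase x, (1 + β y * (α x * Complex.exp 0))) 0 := by
    have e : (fun s => endEquation m β (m x) m' (α x) (0, s)) = fun s =>
        (1 + β x * (α x * Complex.exp s)) * ∏ y ∈ (level (fun x => latticeToComplex (m x))
          (latticeToComplex (m x))).erase x, (1 + β y * (α x * Complex.exp s)) := by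
      ext s
      rw [hrest]
      exact (Finset.mul_prod_erase _ (fun y => 1 + β y * (α x * Complex.exp s)) hxlev).symm
    rw [e]
    have h1 : HasDerivAt (fun s => 1 + β x * (α x * Complex.exp s)) (β x * α x) 0 := by
      have := (((Complex.hasDerivAt_exp 0).const_mul (α x : ℂ)).const_mul (β x)).const_add 1
      rw [Complex.exp_zero, mul_one] at this
      exact this
    have h2 : DifferentiableAt ℂ (fun s => ∏ y ∈ (level (fun x => latticeToComplex (m x))
          (latticeToComplex (m x))).erase x, (1 + β y * (α x * Complex.exp s))) 0 := by
      fun_prop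
    have h3 := h1.mul h2.hasDerivAt
    rw [hx1, zero_mul, add_zero] at h3
    exact h3
  -- The zero s = 0 of the face polynomial is simple because parallel ends have distinct positions.
  have hne : β x * α x * ∏ y ∈ (level (fun x => latticeToComplex (m x))
        (latticeToComplex (m x))).erase x, (1 + β y * (α x * Complex.exp 0)) ≠ 0 := by
    refine mul_ne_zero (mul_ne_zero (neg_ne_zero.mpr (inv_ne_zero hαx)) hαx)
      (Finset.prod_ne_zero_iff.mpr fun y hy => ?_)
    obtain ⟨hyx, hy⟩ := Finset.mem_erase.mp hy
    rw [hm.level_eq, Finset.mem_filter] at hy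
    intro h
    apply hsep y x hyx hy.2
    have hαy : (α y : ℂ) ≠ 0 := (α y).ne_zero
    rw [Complex.exp_zero, mul_one, hβ] at h
    ext
    field_simp at h
    linear_combination h
  obtain ⟨ψ, h1, h2, h3, h4⟩ := exists_implicit_function (contDiff_endEquation m β (m x) m' (α x))
    h0 hder hne
  refine ⟨ψ, h1, h2, h3.mono fun w hw z hz hz' => ?_, h4.mono fun v hv z hz hz1 hz2 => ?_⟩
  · exact (fanSum_eq_endEquation hm hα x hm' (α x) z (w, ψ w) hz hz').mpr hw
  · exact hv ((fanSum_eq_endEquation hm hα x hm' (α x) z v hz1 hz2).mp hz)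

end Ends


/-! ### The curve at infinity: disjointness and completeness of the ends -/

section Ends

open scoped Classical
open Filter Topology

variable {I : Type*} [Fintype I]

lemma log_norm_monomialAt (p : ℤ × ℤ) (z : Fin 2 → ℂˣ) :
    Real.log ‖(monomialAt p z : ℂ)‖ =
      p.1 * Real.log ‖(z 0 : ℂ)‖ + p.2 * Real.log ‖(z 1 : ℂ)‖ := by
  rw [coe_monomialAt, norm_mul, norm_zpow, norm_zpow, Real.log_mul, Real.log_zpow, Real.log_zpow]
  · exact zpow_ne_zero _ (norm_ne_zero_iff.mpr (z 0).ne_zero)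
  · exact zpow_ne_zero _ (norm_ne_zero_iff.mpr (z 1).ne_zero)

lemma norm_monomialAt_pos (p : ℤ × ℤ) (z : Fin 2 → ℂˣ) : 0 < ‖(monomialAt p z : ℂ)‖ :=
  norm_pos_iff.mpr (Units.ne_zero _)

lemma eventually_forall_norm_lt {P : ℂ → Prop} (h : ∀ᶠ w in 𝓝 (0 : ℂ), P w) :
    ∀ᶠ r in 𝓝[>] (0 : ℝ), ∀ w, ‖w‖ < r → P w := by
  obtain ⟨ε, hε, h⟩ := Metric.eventually_nhds_iff_ball.mp h
  filter_upwards [Ioo_mem_nhdsGT hε] with r hr w hw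
  exact h w (by simpa using hw.trans hr.2)

lemma eventually_log_lt (B : ℝ) : ∀ᶠ r in 𝓝[>] (0 : ℝ), Real.log r < B :=
  Real.tendsto_log_nhdsGT_zero.eventually (eventually_lt_atBot B)

/-- In polar coordinates this is the image of a compact box times a torus. -/
lemma isCompact_log_norm_le (R : ℝ) :
    IsCompact {z : Fin 2 → ℂˣ | ∀ k, |Real.log ‖(z k : ℂ)‖| ≤ R} := by
  let F : (Fin 2 → ℝ) × (Fin 2 → Circle) → (Fin 2 → ℂˣ) := fun q k =>
    Units.mk0 ((Real.exp (q.1 k) : ℝ) : ℂ) (Complex.ofReal_ne_zero.mpr (Real.exp_ne_zero _)) *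
      Circle.toUnits (q.2 k)
  have hF : Continuous F := by
    refine continuous_pi fun k => ?_
    refine Continuous.mul ?_ ?_
    · rw [Units.continuous_iff]
      constructor
      · change Continuous fun q : (Fin 2 → ℝ) × (Fin 2 → Circle) => ((Real.exp (q.1 k) : ℝ) : ℂ)
        fun_prop
      · have : (fun q : (Fin 2 → ℝ) × (Fin 2 → Circle) =>
            (((Units.mk0 ((Real.exp (q.1 k) : ℝ) : ℂ)
              (Complex.ofReal_ne_zero.mpr (Real.exp_ne_zero _)))⁻¹ : ℂˣ) : ℂ)) =
            fun q => ((Real.exp (-(q.1 k)) : ℝ) : ℂ) := by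
          ext q
          rw [Units.val_inv_eq_inv_val, Units.val_mk0, Real.exp_neg, Complex.ofReal_inv]
        rw [this]
        fun_prop
    · rw [Units.continuous_iff]
      constructor
      · change Continuous fun q : (Fin 2 → ℝ) × (Fin 2 → Circle) => ((q.2 k : Circle) : ℂ)
        fun_prop
      · have : (fun q : (Fin 2 → ℝ) × (Fin 2 → Circle) =>
            (((Circle.toUnits (q.2 k))⁻¹ : ℂˣ) : ℂ)) = fun q => (((q.2 k)⁻¹ : Circle) : ℂ) := by
          ext q
          rw [← map_inv]
          rfl
        rw [this]
        fun_prop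
  have hK : IsCompact ((Set.univ.pi fun _ : Fin 2 => Set.Icc (-R) R) ×ˢ
      (Set.univ : Set (Fin 2 → Circle))) :=
    (isCompact_univ_pi fun _ => isCompact_Icc).prod isCompact_univ
  convert hK.image hF using 1
  ext z
  constructor
  · intro hz
    have hne : ∀ k, ‖(z k : ℂ)‖ ≠ 0 := fun k => norm_ne_zero_iff.mpr (z k).ne_zero
    refine ⟨(fun k => Real.log ‖(z k : ℂ)‖, fun k => ⟨(z k : ℂ) / ‖(z k : ℂ)‖, ?_⟩), ?_, ?_⟩
    · refine mem_sphere_zero_iff_norm.mpr ?_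
      rw [norm_div, Complex.norm_real, norm_norm, div_self (hne k)]
    · refine ⟨fun k _ => abs_le.mp (hz k), Set.mem_univ _⟩
    · ext k
      change ((Real.exp (Real.log ‖(z k : ℂ)‖) : ℝ) : ℂ) * ((z k : ℂ) / ‖(z k : ℂ)‖) = z k
      rw [Real.exp_log (norm_pos_iff.mpr (z k).ne_zero), mul_div_cancel₀]
      exact_mod_cast hne k
  · rintro ⟨q, ⟨hq, _⟩, rfl⟩ k
    have : ‖((F q k : ℂˣ) : ℂ)‖ = Real.exp (q.1 k) := by
      change ‖((Real.exp (q.1 k) : ℝ) : ℂ) * ((q.2 k : Circle) : ℂ)‖ = _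
      rw [norm_mul, Circle.norm_coe, mul_one, Complex.norm_real, Real.norm_eq_abs, Real.abs_exp]
    rw [this, Real.log_exp, abs_le]
    exact hq k (Set.mem_univ k)

/-- Points going to infinity near the ray of `p` and near the ray of `q ≠ p` are different. -/
lemma not_near_two_rays {p q p' q' : ℤ × ℤ} (hp : p.1 * p'.2 - p.2 * p'.1 = -1)
    (hq : q.1 * q'.2 - q.2 * q'.1 = -1) (hne : p ≠ q) {A : ℝ} (z : Fin 2 → ℂˣ)
    (h1 : |Real.log ‖(monomialAt p z : ℂ)‖| ≤ A) (h2 : |Real.log ‖(monomialAt q z : ℂ)‖| ≤ A)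
    {B : ℝ} (hB1 : B ≤ -(A * (1 + |((q.1 * p'.2 - q.2 * p'.1 : ℤ) : ℝ)|)))
    (hB2 : 2 * B ≤ -(A * |((q'.1 * p'.2 - q'.2 * p'.1 : ℤ) : ℝ)|))
    (h3 : Real.log ‖(monomialAt p' z : ℂ)‖ < B) (h4 : Real.log ‖(monomialAt q' z : ℂ)‖ < B) :
    False := by
  have hpR : (p.1 : ℝ) * p'.2 - p.2 * p'.1 = -1 := by exact_mod_cast hp
  have hqR : (q.1 : ℝ) * q'.2 - q.2 * q'.1 = -1 := by exact_mod_cast hq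
  rw [log_norm_monomialAt] at h1 h2 h3 h4
  push_cast at hB1 hB2
  set u := Real.log ‖(z 0 : ℂ)‖
  set v := Real.log ‖(z 1 : ℂ)‖
  have hA : 0 ≤ A := (abs_nonneg _).trans h1
  -- For opposite rays, p' + q' is parallel to `p`, so the two logarithms cannot both be very
  -- negative. For rays that are not parallel, bounds on z^p and z^q bound the whole point.
  by_cases h : p.1 * q.2 - p.2 * q.1 = 0
  · rcases eq_or_eq_neg_of_parallel hp hq h with h5 | h5
    · exact hne h5
    · have e1 : (p.1 : ℝ) = -q.1 := by rw [h5]; simp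
      have e2 : (p.2 : ℝ) = -q.2 := by rw [h5]; simp
      have key : ((p'.1 : ℝ) * u + p'.2 * v) + (q'.1 * u + q'.2 * v) =
          -(q'.1 * p'.2 - q'.2 * p'.1) * (p.1 * u + p.2 * v) := by
        rw [e1, e2] at hpR ⊢
        linear_combination (q'.1 * u + q'.2 * v) * hpR + (p'.1 * u + p'.2 * v) * hqR
      have h6 : |(q'.1 * p'.2 - q'.2 * p'.1 : ℝ) * (p.1 * u + p.2 * v)| ≤
          A * |(q'.1 * p'.2 - q'.2 * p'.1 : ℝ)| := by
        rw [abs_mul, mul_comm]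
        exact mul_le_mul_of_nonneg_right h1 (abs_nonneg _)
      have h7 := le_abs_self ((q'.1 * p'.2 - q'.2 * p'.1 : ℝ) * (p.1 * u + p.2 * v))
      linarith
  · have key : (q.1 : ℝ) * u + q.2 * v = -(q.1 * p'.2 - q.2 * p'.1) * (p.1 * u + p.2 * v) -
        (p.1 * q.2 - p.2 * q.1) * (p'.1 * u + p'.2 * v) := by
      linear_combination (q.1 * u + q.2 * v) * hpR
    have h5 : (1 : ℝ) ≤ |(p.1 * q.2 - p.2 * q.1 : ℝ)| := by
      have := Int.one_le_abs h
      exact_mod_cast this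
    have h6 : |(p.1 * q.2 - p.2 * q.1 : ℝ) * (p'.1 * u + p'.2 * v)| ≤
        A + A * |(q.1 * p'.2 - q.2 * p'.1 : ℝ)| := by
      have e : (p.1 * q.2 - p.2 * q.1 : ℝ) * (p'.1 * u + p'.2 * v) =
          -(q.1 * u + q.2 * v) - (q.1 * p'.2 - q.2 * p'.1) * (p.1 * u + p.2 * v) := by
        linear_combination key
      rw [e]
      refine (abs_sub _ _).trans ?_
      rw [abs_neg, abs_mul]
      refine add_le_add h2 ?_
      rw [mul_comm A]
      exact mul_le_mul_of_nonneg_left h1 (abs_nonneg _)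
    rw [abs_mul] at h6
    have h7 : |(p'.1 * u + p'.2 * v : ℝ)| ≤ A + A * |(q.1 * p'.2 - q.2 * p'.1 : ℝ)| :=
      (le_mul_of_one_le_left (abs_nonneg _) h5).trans h6
    have h8 := neg_abs_le (p'.1 * u + p'.2 * v : ℝ)
    linarith

lemma cross_smul_left (t : ℝ) (η c : ℂ) : cross ((t : ℂ) * η) c = t * cross η c := by
  simp [cross]
  ring

/-- Far out, a point of the curve is near the position of an end. -/
lemma exists_near_end_of_tendsto {m : I → ℤ × ℤ} (hm : IsLatticeFan m) {α : I → ℂˣ}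
    (hα : ∏ x, (-(α x : ℂ)⁻¹) = 1) {m' : I → ℤ × ℤ}
    (hm' : ∀ x, (m x).1 * (m' x).2 - (m x).2 * (m' x).1 = -1) (Z : ℕ → Fin 2 → ℂˣ)
    (hZ : ∀ n, Z n ∈ curve (fanPoly m fun x => -(α x : ℂ)⁻¹))
    (hfar : ∀ n : ℕ, ∃ k, (n : ℝ) < |Real.log ‖(Z n k : ℂ)‖|) {δ : ℝ} (hδ : 0 < δ) :
    ∃ n x, ‖(monomialAt (m' x) (Z n) : ℂ)‖ < δ ∧
      ‖(monomialAt (m x) (Z n) : ℂ) / α x - 1‖ < δ := by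
  set β : I → ℂ := fun x => -(α x : ℂ)⁻¹ with hβ
  have hβ0 : ∀ y, β y ≠ 0 := fun y => neg_ne_zero.mpr (inv_ne_zero (α y).ne_zero)
  let ξ : ℕ → ℂ := fun n => ⟨Real.log ‖(Z n 0 : ℂ)‖, Real.log ‖(Z n 1 : ℂ)‖⟩
  have hξ : ∀ n : ℕ, (n : ℝ) < ‖ξ n‖ := by
    intro n
    obtain ⟨k, hk⟩ := hfar n
    fin_cases k
    · exact hk.trans_le (Complex.abs_re_le_norm (ξ n))
    · exact hk.trans_le (Complex.abs_im_le_norm (ξ n))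
  have hξpos : ∀ n, 0 < ‖ξ n‖ := fun n => (Nat.cast_nonneg n).trans_lt (hξ n)
  -- A limit of the normalized logarithms along an ultrafilter replaces the passage to a convergent
  -- subsequence.
  let 𝒰 : Ultrafilter ℕ := hyperfilter ℕ
  have h𝒰 : (𝒰 : Filter ℕ) ≤ atTop := by
    rw [← Nat.cofinite_eq_atTop]
    exact hyperfilter_le_cofinite
  have hξtop : Tendsto (fun n => ‖ξ n‖) 𝒰 atTop :=
    (tendsto_atTop_mono (fun n => (hξ n).le) tendsto_natCast_atTop_atTop).mono_left h𝒰
  obtain ⟨u, hu, hlim⟩ := (isCompact_sphere (0 : ℂ) 1).ultrafilter_le_nhds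
    (𝒰.map fun n => ξ n / ‖ξ n‖) (by
      rw [Ultrafilter.coe_map, le_principal_iff, mem_map]
      refine Filter.univ_mem' fun n => ?_
      simp only [Set.mem_preimage, mem_sphere_zero_iff_norm, norm_div, Complex.norm_real, norm_norm]
      exact div_self (hξpos n).ne')
  rw [Ultrafilter.coe_map] at hlim
  have hlim' : Tendsto (fun n => ξ n / ‖ξ n‖) 𝒰 (𝓝 u) := hlim
  -- The rotation makes `cross η` the inner product with `u`, so log |z^p| grows like ‖ξ‖ times
  -- `cross η p`.
  set η : ℂ := -(Complex.I * u) with hη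
  have hη0 : η ≠ 0 := by
    rw [mem_sphere_zero_iff_norm] at hu
    rw [hη, neg_ne_zero]
    refine mul_ne_zero Complex.I_ne_zero fun h => ?_
    rw [h, norm_zero] at hu
    exact zero_ne_one hu
  have hto0 : ∀ p : ℤ × ℤ, cross η (latticeToComplex p) < 0 →
      Tendsto (fun n => (monomialAt p (Z n) : ℂ)) 𝒰 (𝓝 0) := by
    intro p hp
    rw [tendsto_zero_iff_norm_tendsto_zero]
    have e : ∀ n, ‖(monomialAt p (Z n) : ℂ)‖ =
        Real.exp (‖ξ n‖ * cross (-(Complex.I * (ξ n / ‖ξ n‖))) (latticeToComplex p)) := by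
      intro n
      rw [← Real.exp_log (norm_monomialAt_pos p (Z n)), log_norm_monomialAt]
      congr 1
      have h1 := (hξpos n).ne'
      simp only [cross, latticeToComplex, Complex.neg_re, Complex.neg_im, Complex.mul_re,
        Complex.mul_im, Complex.I_re, Complex.I_im, Complex.div_ofReal_re, Complex.div_ofReal_im]
      field_simp
      simp only [ξ]
      ring
    simp only [e]
    refine Real.tendsto_exp_atBot.comp ?_
    refine hξtop.atTop_mul_neg hp ?_
    have hcont : Continuous fun a : ℂ => cross (-(Complex.I * a)) (latticeToComplex p) := by
      unfold cross
      fun_prop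
    exact (hcont.tendsto u).comp hlim'
  -- Divided by the monomial of `above`, the equation of the curve says that the face product equals
  -- minus a sum of terms tending to zero.
  have hprod : Tendsto (fun n => ∏ y ∈ level (fun x => latticeToComplex (m x)) η,
      (1 + β y * (monomialAt (m y) (Z n) : ℂ))) 𝒰 (𝓝 0) := by
    have hsum : ∑ x, m x = 0 := by
      have := hm.balanced.sum_eq
      rw [← latticeToComplex_sum] at this
      have h1 := congrArg Complex.re this
      have h2 := congrArg Complex.im this
      simp only [latticeToComplex, Complex.zero_re, Complex.zero_im] at h1 h2
      exact Prod.ext (by exact_mod_cast h1) (by exact_mod_cast h2)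
    set A := above (fun x => latticeToComplex (m x)) η with hA
    have hA1 : ∏ y ∈ A, β y ≠ 0 := Finset.prod_ne_zero_iff.mpr fun y _ => hβ0 y
    have e : ∀ n, ∏ y ∈ level (fun x => latticeToComplex (m x)) η,
        (1 + β y * (monomialAt (m y) (Z n) : ℂ)) =
        -∑ L ∈ restFamily (fun x => latticeToComplex (m x)) η,
          (∏ y ∈ L, β y) * (∏ y ∈ A, β y)⁻¹ *
            (monomialAt (∑ y ∈ L, m y - ∑ y ∈ A, m y) (Z n) : ℂ) := by
      intro n
      have h1 := (mem_curve_fanPoly m β (Z n)).mp (hZ n)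
      rw [fanSum_eq hm.balanced hη0 _ (by
        rw [prod_mul_monomialAt, hα, hsum, monomialAt_zero]
        simp)] at h1
      simp only [prod_mul_monomialAt] at h1
      rw [← hA] at h1
      have hmA : (monomialAt (∑ y ∈ A, m y) (Z n) : ℂ) ≠ 0 := Units.ne_zero _
      have h2 : ∑ L ∈ restFamily (fun x => latticeToComplex (m x)) η,
          (∏ y ∈ L, β y) * (∏ y ∈ A, β y)⁻¹ *
            (monomialAt (∑ y ∈ L, m y - ∑ y ∈ A, m y) (Z n) : ℂ) =
          (∑ L ∈ restFamily (fun x => latticeToComplex (m x)) η,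
            (∏ y ∈ L, β y) * (monomialAt (∑ y ∈ L, m y) (Z n) : ℂ)) /
            ((∏ y ∈ A, β y) * (monomialAt (∑ y ∈ A, m y) (Z n) : ℂ)) := by
        rw [Finset.sum_div]
        refine Finset.sum_congr rfl fun L _ => ?_
        rw [monomialAt_sub, Units.val_div_eq_div_val]
        field_simp
      rw [h2, eq_neg_iff_add_eq_zero]
      field_simp
      linear_combination h1
    simp only [e]
    rw [← neg_zero]
    refine Tendsto.neg ?_
    rw [← Finset.sum_const_zero (s := restFamily (fun x => latticeToComplex (m x)) η)]
    refine tendsto_finsetSum _ fun L hL => ?_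
    have := (hto0 _ (cross_exponent_neg hm hη0 hL)).const_mul ((∏ y ∈ L, β y) * (∏ y ∈ A, β y)⁻¹)
    rwa [mul_zero] at this
  have hw : ∀ᶠ n in (𝒰 : Filter ℕ), ∀ y ∈ level (fun x => latticeToComplex (m x)) η,
      ‖(monomialAt (m' y) (Z n) : ℂ)‖ < δ := by
    rw [eventually_all_finset]
    intro y hy
    have hneg : cross η (latticeToComplex (m' y)) < 0 := by
      rw [mem_level] at hy
      have hy0 := hm.balanced.ne_zero y
      rw [Complex.arg_eq_arg_iff hy0 hη0] at hy
      have h1 : cross (latticeToComplex (m y)) (latticeToComplex (m' y)) = -1 := by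
        rw [cross_latticeToComplex, hm' y]
        simp
      rw [← hy, ← Complex.ofReal_div, cross_smul_left, h1]
      have := div_pos (norm_pos_iff.mpr hη0) (norm_pos_iff.mpr hy0)
      linarith
    have := (tendsto_zero_iff_norm_tendsto_zero.mp (hto0 _ hneg)).eventually_lt_const hδ
    exact this
  -- The bound δ ^ card forces one factor below δ. It also excludes an empty level, where the
  -- product and the bound would both be one.
  have hsmall : ∀ᶠ n in (𝒰 : Filter ℕ), ‖∏ y ∈ level (fun x => latticeToComplex (m x)) η,
      (1 + β y * (monomialAt (m y) (Z n) : ℂ))‖ <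
      δ ^ (level (fun x => latticeToComplex (m x)) η).card :=
    (tendsto_zero_iff_norm_tendsto_zero.mp hprod).eventually_lt_const (pow_pos hδ _)
  obtain ⟨n, hn1, hn2⟩ := (hw.and hsmall).exists
  obtain ⟨y, hy, hylt⟩ : ∃ y ∈ level (fun x => latticeToComplex (m x)) η,
      ‖1 + β y * (monomialAt (m y) (Z n) : ℂ)‖ < δ := by
    by_contra hcon
    push Not at hcon
    rw [norm_prod] at hn2
    have := Finset.prod_le_prod (s := level (fun x => latticeToComplex (m x)) η)
      (f := fun _ => δ) (fun _ _ => hδ.le) hcon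
    rw [Finset.prod_const] at this
    linarith
  refine ⟨n, y, hn1 y hy, ?_⟩
  have e : -((monomialAt (m y) (Z n) : ℂ) / α y - 1) = 1 + β y * (monomialAt (m y) (Z n) : ℂ) := by
    have hβy : β y = -(α y : ℂ)⁻¹ := rfl
    rw [hβy, div_eq_mul_inv]
    ring
  rw [← norm_neg, e]
  exact hylt

/-- A lattice vector that completes the primitive vector `p` to a basis. -/
noncomputable def complementary (p : ℤ × ℤ) : ℤ × ℤ :=
  if h : ∃ p' : ℤ × ℤ, p.1 * p'.2 - p.2 * p'.1 = -1 then h.choose else 0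

lemma complementary_spec {p : ℤ × ℤ} (h : ∃ p' : ℤ × ℤ, p.1 * p'.2 - p.2 * p'.1 = -1) :
    p.1 * (complementary p).2 - p.2 * (complementary p).1 = -1 := by
  rw [complementary, dif_pos h]
  exact h.choose_spec

/-- The curve consists of a relatively compact part and of disjoint ends at the given positions. -/
theorem exists_ends {m : I → ℤ × ℤ} (hm : IsLatticeFan m) {α : I → ℂˣ}
    (hα : ∏ x, (-(α x : ℂ)⁻¹) = 1) (hsep : ∀ x y, x ≠ y → m x = m y → α x ≠ α y) :
    ∃ (m' : I → ℤ × ℤ) (r : ℝ) (ψ : I → ℂ → ℂ), 0 < r ∧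
      (∀ x, (m x).1 * (m' x).2 - (m x).2 * (m' x).1 = -1 ∧
        DifferentiableOn ℂ (ψ x) (Metric.ball 0 r) ∧ ψ x 0 = 0 ∧
        endGraph (m x) (m' x) (α x) r (ψ x) ⊆ curve (fanPoly m fun x => -(α x : ℂ)⁻¹)) ∧
      (∀ x y, x ≠ y → Disjoint (endGraph (m x) (m' x) (α x) r (ψ x))
        (endGraph (m y) (m' y) (α y) r (ψ y))) ∧
      ∃ K : Set (Fin 2 → ℂˣ), IsCompact K ∧ curve (fanPoly m fun x => -(α x : ℂ)⁻¹) ⊆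
        K ∪ ⋃ x, endGraph (m x) (m' x) (α x) r (ψ x) := by
  have hm' : ∀ x, (m x).1 * (complementary (m x)).2 - (m x).2 * (complementary (m x)).1 = -1 :=
    fun x => complementary_spec (hm.primitive x)
  choose ψ hψ0 hψd hψc hψu using fun x => exists_end hm hα hsep x (hm' x)
  have hψcont : ∀ x, ContinuousAt (ψ x) 0 := fun x => (hψd x).self_of_nhds.continuousAt
  -- A common bound for |log |z^m|| on all ends; the summand 1 absorbs Re ψ, by E3.
  set A : ℝ := 1 + ∑ x, |Real.log ‖(α x : ℂ)‖| with hA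
  have E1 : ∀ᶠ r in 𝓝[>] (0 : ℝ), ∀ x, ∀ w, ‖w‖ < r → DifferentiableAt ℂ (ψ x) w :=
    eventually_all.mpr fun x => eventually_forall_norm_lt (hψd x)
  have E2 := eventually_all.mpr fun x => eventually_forall_norm_lt (hψc x)
  have E3 : ∀ᶠ r in 𝓝[>] (0 : ℝ), ∀ x, ∀ w, ‖w‖ < r → ‖ψ x w‖ < 1 := by
    refine eventually_all.mpr fun x => eventually_forall_norm_lt ?_
    have := (hψcont x).norm
    rw [ContinuousAt, hψ0, norm_zero] at this
    exact this.eventually_lt_const one_pos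
  have E4 : ∀ᶠ r in 𝓝[>] (0 : ℝ), ∀ x y, ∀ w, ‖w‖ < r → x ≠ y → m x = m y →
      (α x : ℂ) * Complex.exp (ψ x w) ≠ α y * Complex.exp (ψ y w) := by
    refine eventually_all.mpr fun x => eventually_all.mpr fun y => eventually_forall_norm_lt ?_
    by_cases h : x ≠ y ∧ m x = m y
    · have h1 : ContinuousAt (fun w => (α x : ℂ) * Complex.exp (ψ x w) -
          α y * Complex.exp (ψ y w)) 0 := by
        have := hψcont x
        have := hψcont y
        fun_prop
      have h2 : (fun w => (α x : ℂ) * Complex.exp (ψ x w) -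
          α y * Complex.exp (ψ y w)) 0 ≠ 0 := by
        simp only [hψ0, Complex.exp_zero, mul_one]
        rw [sub_ne_zero]
        exact fun h3 => hsep x y h.1 h.2 (Units.ext h3)
      filter_upwards [h1.eventually_ne h2] with w hw _ _
      exact sub_ne_zero.mp hw
    · exact Eventually.of_forall fun w h1 h2 => absurd ⟨h1, h2⟩ h
  -- The thresholds on log r required by `not_near_two_rays`, which separates ends in different
  -- directions; E4 separates the parallel ones.
  have E5 : ∀ᶠ r in 𝓝[>] (0 : ℝ), ∀ x y, Real.log r ≤ -(A * (1 + |(((m y).1 *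
      (complementary (m x)).2 - (m y).2 * (complementary (m x)).1 : ℤ) : ℝ)|)) ∧
      2 * Real.log r ≤ -(A * |(((complementary (m y)).1 *
      (complementary (m x)).2 - (complementary (m y)).2 * (complementary (m x)).1 : ℤ) : ℝ)|) := by
    refine eventually_all.mpr fun x => eventually_all.mpr fun y => ?_
    refine ((eventually_log_lt _).mono fun r hr => hr.le).and ?_
    filter_upwards [eventually_log_lt (-(A * |(((complementary (m y)).1 *
      (complementary (m x)).2 - (complementary (m y)).2 * (complementary (m x)).1 : ℤ) : ℝ)|) / 2)]
      with r hr
    linarith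
  obtain ⟨r, ⟨⟨⟨⟨⟨E1, E2⟩, E3⟩, E4⟩, E5⟩, hr⟩⟩ :=
    (((((E1.and E2).and E3).and E4).and E5).and self_mem_nhdsWithin).exists
  have hr0 : 0 < r := hr
  have hlogα : ∀ x (z : Fin 2 → ℂˣ), z ∈ endGraph (m x) (complementary (m x)) (α x) r (ψ x) →
      |Real.log ‖(monomialAt (m x) z : ℂ)‖| ≤ A := by
    rintro x z ⟨hz1, hz2⟩
    rw [hz2, norm_mul, Complex.norm_exp, Real.log_mul (norm_ne_zero_iff.mpr (α x).ne_zero)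
      (Real.exp_ne_zero _), Real.log_exp]
    have h1 := E3 x _ hz1
    have h2 := Complex.abs_re_le_norm (ψ x (monomialAt (complementary (m x)) z))
    have h3 : |Real.log ‖(α x : ℂ)‖| ≤ ∑ x, |Real.log ‖(α x : ℂ)‖| :=
      Finset.single_le_sum (f := fun x => |Real.log ‖(α x : ℂ)‖|)
        (fun y _ => abs_nonneg _) (Finset.mem_univ x)
    have h4 := abs_add_le (Real.log ‖(α x : ℂ)‖) (ψ x (monomialAt (complementary (m x)) z)).re
    linarith
  have hsub : ∀ x, endGraph (m x) (complementary (m x)) (α x) r (ψ x) ⊆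
      curve (fanPoly m fun x => -(α x : ℂ)⁻¹) := fun x z hz => E2 x _ hz.1 z rfl hz.2
  refine ⟨fun x => complementary (m x), r, ψ, hr0,
    fun x => ⟨hm' x, fun w hw => (E1 x w (by simpa using hw)).differentiableWithinAt, hψ0 x, hsub x⟩,
    ?_, ?_⟩
  · intro x y hxy
    rw [Set.disjoint_left]
    intro z hz hz'
    by_cases hmxy : m x = m y
    · have h1 := hz.2
      have h2 : (monomialAt (m y) z : ℂ) =
        α y * Complex.exp (ψ y (monomialAt (complementary (m y)) z)) := hz'.2
      rw [← hmxy] at h2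
      exact E4 x y _ hz.1 hxy hmxy (h1.symm.trans h2)
    · refine not_near_two_rays (hm' x) (hm' y) hmxy z (hlogα x z hz) (hlogα y z hz')
        (E5 x y).1 (E5 x y).2 ?_ ?_
      · exact Real.log_lt_log (norm_monomialAt_pos _ _) hz.1
      · exact Real.log_lt_log (norm_monomialAt_pos _ _) hz'.1
  -- Local uniqueness of ψ, rewritten in terms of w and q = z^m / α with s = log q, so that it
  -- applies to points that are merely close to the position of an end.
  · obtain ⟨δ, hδ, hδ1⟩ : ∃ δ > 0, ∀ x, ∀ w q : ℂ, ‖w‖ < δ → ‖q - 1‖ < δ →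
        q ≠ 0 ∧ ∀ z ∈ curve (fanPoly m fun x => -(α x : ℂ)⁻¹),
          (monomialAt (complementary (m x)) z : ℂ) = w →
          (monomialAt (m x) z : ℂ) = α x * Complex.exp (Complex.log q) →
          ψ x w = Complex.log q := by
      have h1 : ∀ᶠ v in 𝓝 ((0, 1) : ℂ × ℂ), ∀ x, v.2 ≠ 0 ∧
          ∀ z ∈ curve (fanPoly m fun x => -(α x : ℂ)⁻¹),
          (monomialAt (complementary (m x)) z : ℂ) = v.1 →
          (monomialAt (m x) z : ℂ) = α x * Complex.exp (Complex.log v.2) →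
          ψ x v.1 = Complex.log v.2 := by
        rw [eventually_all]
        intro x
        have h2 : ContinuousAt (fun v : ℂ × ℂ => v.2) (0, 1) := continuousAt_snd
        have h3 : ContinuousAt (fun v : ℂ × ℂ => (v.1, Complex.log v.2)) (0, 1) :=
          continuousAt_fst.prodMk (h2.clog (by simp))
        rw [ContinuousAt, Complex.log_one] at h3
        exact (h2.eventually_ne one_ne_zero).and (h3.eventually (hψu x))
      obtain ⟨δ, hδ, h2⟩ := Metric.eventually_nhds_iff_ball.mp h1
      refine ⟨δ, hδ, fun x w q hw hq => h2 (w, q) ?_ x⟩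
      rw [Metric.mem_ball, Prod.dist_eq, max_lt_iff, dist_zero_right, dist_eq_norm]
      exact ⟨hw, hq⟩
    obtain ⟨N, hN⟩ : ∃ N : ℕ, ∀ z ∈ curve (fanPoly m fun x => -(α x : ℂ)⁻¹),
        (∃ k, (N : ℝ) < |Real.log ‖(z k : ℂ)‖|) →
        ∃ x, z ∈ endGraph (m x) (complementary (m x)) (α x) r (ψ x) := by
      by_contra hcon
      push Not at hcon
      choose Z hZ hfar hnot using hcon
      obtain ⟨n, x, hn1, hn2⟩ := exists_near_end_of_tendsto hm hα hm' Z hZ hfar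
        (lt_min hδ hr0)
      rw [lt_min_iff] at hn1 hn2
      obtain ⟨h1, h2⟩ := hδ1 x _ _ hn1.1 hn2.1
      have h3 : (monomialAt (m x) (Z n) : ℂ) =
          α x * Complex.exp (Complex.log ((monomialAt (m x) (Z n) : ℂ) / α x)) := by
        rw [Complex.exp_log h1, mul_div_cancel₀ _ (α x).ne_zero]
      refine hnot n x ⟨hn1.2, ?_⟩
      rw [h2 (Z n) (hZ n) rfl h3]
      exact h3
    refine ⟨_, isCompact_log_norm_le N, fun z hz => ?_⟩
    by_cases h : ∃ k, (N : ℝ) < |Real.log ‖(z k : ℂ)‖|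
    · exact Or.inr (Set.mem_iUnion.mpr (hN z hz h))
    · push Not at h
      exact Or.inl h

end Ends


/-! ### Determinant reduction and the inner product -/

section LinearAlgebra

open Matrix

variable {n : ℕ}

/-- A correction ρ is chosen so that Y = U + GBρK satisfies BᵀY = K. Then the matrix factors as (1 +
GB(iS - ρ)Bᵀ) Y, and det(1 + PQ) = det(1 + QP) moves the first determinant to the small index set.
The factor det Y is real. -/
lemma det_add_I_smul_eq {ι : Type*} [Fintype ι] [DecidableEq ι] (G U : Matrix (Fin n) (Fin n) ℝ)
    (B : Matrix (Fin n) ι ℝ) (X S : Matrix ι ι ℝ) (K : Matrix ι (Fin n) ℝ) (c : ℝ)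
    (hM : IsUnit (Bᵀ * G * B).det) (hU : Bᵀ * U = (X + c • (Bᵀ * G * B * S)) * K) :
    ∃ y : ℝ, (U.map Complex.ofRealHom +
      Complex.I • (G * B * (S * K)).map Complex.ofRealHom).det =
      y * (X.map Complex.ofRealHom + ((c : ℂ) + Complex.I) •
        (Bᵀ * G * B * S).map Complex.ofRealHom).det := by
  set M := Bᵀ * G * B with hMdef
  set ρ := M⁻¹ * (1 - X - c • (M * S)) with hρ
  have hMρ : M * ρ = 1 - X - c • (M * S) := by
    rw [hρ, ← Matrix.mul_assoc, Matrix.mul_nonsing_inv _ hM, Matrix.one_mul]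
  set Y := U + G * B * ρ * K with hY
  have hBY : Bᵀ * Y = K := by
    rw [hY, Matrix.mul_add, hU]
    have : Bᵀ * (G * B * ρ * K) = M * ρ * K := by
      simp only [hMdef, Matrix.mul_assoc]
    rw [this, hMρ, ← Matrix.add_mul]
    have : X + c • (M * S) + (1 - X - c • (M * S)) = 1 := by abel
    rw [this, Matrix.one_mul]
  let φ := Complex.ofRealHom
  have hfact : U.map φ + Complex.I • (G * B * (S * K)).map φ =
      (1 + (G * B).map φ * ((Complex.I • S.map φ - ρ.map φ) * Bᵀ.map φ)) * Y.map φ := by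
    have h1 : Bᵀ.map φ * Y.map φ = K.map φ := by rw [← Matrix.map_mul, hBY]
    rw [Matrix.add_mul, Matrix.one_mul, Matrix.mul_assoc ((G * B).map φ), Matrix.mul_assoc (_ - _),
      h1, hY,
      Matrix.map_add _ (map_add φ), Matrix.sub_mul, Matrix.mul_sub]
    simp only [Matrix.map_mul, Matrix.smul_mul, Matrix.mul_smul, Matrix.mul_assoc]
    abel
  refine ⟨Y.det, ?_⟩
  change (U.map φ + Complex.I • (G * B * (S * K)).map φ).det = _
  rw [hfact, det_mul, mul_comm, det_one_add_mul_comm]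
  congr 1
  · exact (RingHom.map_det φ Y).symm
  · rw [Matrix.mul_assoc, ← Matrix.map_mul, det_one_add_mul_comm]
    congr 1
    have e1 : Bᵀ * (G * B) = M := by rw [hMdef, Matrix.mul_assoc]
    have e2 : M.map φ * ρ.map φ = 1 - X.map φ - (c : ℂ) • (M * S).map φ := by
      rw [← Matrix.map_mul, hMρ, Matrix.map_sub _ (map_sub φ), Matrix.map_sub _ (map_sub φ),
        Matrix.map_one _ (map_zero φ) (map_one φ)]
      congr 1
      ext i j
      simp only [Matrix.map_apply, Matrix.smul_apply, smul_eq_mul, φ, Complex.ofRealHom_eq_coe,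
        Complex.ofReal_mul]
    rw [e1, Matrix.mul_sub, e2, Matrix.mul_smul, ← Matrix.map_mul, add_smul]
    change _ = X.map φ + ((c : ℂ) • (M * S).map φ + Complex.I • (M * S).map φ)
    abel

lemma ip_comm {g : Matrix (Fin n) (Fin n) ℝ} (hg : g.PosDef) (x y : Fin n → ℝ) :
    ip g x y = ip g y x := by
  have hsymm : gᵀ = g := by
    have := hg.1
    rwa [IsHermitian, conjTranspose_eq_transpose_of_trivial] at this
  rw [ip, ip, dotProduct_mulVec, dotProduct_comm, ← mulVec_transpose, hsymm]

lemma ip_add_right (g : Matrix (Fin n) (Fin n) ℝ) (x y z : Fin n → ℝ) :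
    ip g x (y + z) = ip g x y + ip g x z := by
  rw [ip, mulVec_add, dotProduct_add, ip, ip]

lemma ip_smul_right (g : Matrix (Fin n) (Fin n) ℝ) (c : ℝ) (x y : Fin n → ℝ) :
    ip g x (c • y) = c * ip g x y := by
  rw [ip, mulVec_smul, dotProduct_smul, ip, smul_eq_mul]

lemma ip_add_left (g : Matrix (Fin n) (Fin n) ℝ) (x y z : Fin n → ℝ) :
    ip g (x + y) z = ip g x z + ip g y z := by
  rw [ip, add_dotProduct, ip, ip]

lemma ip_smul_left (g : Matrix (Fin n) (Fin n) ℝ) (c : ℝ) (x y : Fin n → ℝ) :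
    ip g (c • x) y = c * ip g x y := by
  rw [ip, smul_dotProduct, ip, smul_eq_mul]

lemma ip_self_pos {g : Matrix (Fin n) (Fin n) ℝ} (hg : g.PosDef) {x : Fin n → ℝ} (hx : x ≠ 0) :
    0 < ip g x x := by
  have := hg.dotProduct_mulVec_pos hx
  simpa [ip] using this

lemma toB_ne_zero {m : Fin n → ℤ} (hm : m ≠ 0) : toB m ≠ 0 := by
  intro h
  apply hm
  ext i
  have := congrFun h i
  simpa [toB] using this

lemma toB_add (m m' : Fin n → ℤ) : toB (m + m') = toB m + toB m' := by
  ext i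
  simp [toB]

lemma toB_zsmul (k : ℤ) (m : Fin n → ℤ) : toB (k • m) = (k : ℝ) • toB m := by
  ext i
  simp [toB]

lemma toB_neg (m : Fin n → ℤ) : toB (-m) = -toB m := by
  ext i
  simp [toB]

/-- A frame is linearly independent over `ℝ`. -/
lemma frame_linearIndependent {b : Fin 2 → Fin n → ℤ} (hb : LinearIndependent ℤ b) {s t : ℝ}
    (h : s • toB (b 0) + t • toB (b 1) = 0) : s = 0 ∧ t = 0 := by
  have hpair : ∀ x y : ℤ, x • b 0 + y • b 1 = 0 → y = 0 := fun x y hxy =>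
    Fintype.linearIndependent_iff.mp hb ![x, y] (by simpa [Fin.sum_univ_two] using hxy) 1
  have hi : ∀ i, s * b 0 i + t * b 1 i = 0 := fun i => by
    simpa [toB] using congrFun h i
  by_contra hne
  -- A real relation annihilates all 2 × 2 minors. These are integers, and a column of vanishing
  -- minors is an integral relation.
  have hminor : ∀ i j, b 0 i * b 1 j - b 0 j * b 1 i = 0 := by
    intro i j
    have h1 : s * (b 0 i * b 1 j - b 0 j * b 1 i : ℝ) = 0 := by
      linear_combination (b 1 j : ℝ) * hi i - (b 1 i : ℝ) * hi j
    have h2 : t * (b 0 i * b 1 j - b 0 j * b 1 i : ℝ) = 0 := by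
      linear_combination (b 0 i : ℝ) * hi j - (b 0 j : ℝ) * hi i
    have : (b 0 i * b 1 j - b 0 j * b 1 i : ℝ) = 0 := by
      by_contra hd
      exact hne ⟨(mul_eq_zero.mp h1).resolve_right hd, (mul_eq_zero.mp h2).resolve_right hd⟩
    exact_mod_cast this
  refine hb.ne_zero 0 (funext fun j => ?_)
  have := hpair (b 1 j) (-b 0 j) (funext fun i => by
    simp only [Pi.add_apply, Pi.smul_apply, smul_eq_mul, Pi.zero_apply]
    linarith [hminor i j])
  simpa using this

end LinearAlgebra


/-! ### A criterion for special Lagrangians; invariant cylinders -/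

section SpecialLagrangian

open Matrix

variable {n : ℕ}

lemma exists_surjective_ker_eq (S : Submodule ℝ (Fin n → ℝ)) {d : ℕ}
    (hd : Module.finrank ℝ S + d = n) :
    ∃ R : (Fin n → ℝ) →L[ℝ] (Fin d → ℝ), Function.Surjective R ∧ ∀ x, R x = 0 ↔ x ∈ S := by
  have hq : Module.finrank ℝ ((Fin n → ℝ) ⧸ S) = Module.finrank ℝ (Fin d → ℝ) := by
    have h := Submodule.finrank_quotient_add_finrank S
    rw [Module.finrank_fin_fun] at h
    rw [Module.finrank_fin_fun]
    omega
  let e := LinearEquiv.ofFinrankEq _ _ hq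
  refine ⟨LinearMap.toContinuousLinearMap (e.toLinearMap ∘ₗ S.mkQ), ?_, fun x => ?_⟩
  · exact e.surjective.comp S.mkQ_surjective
  · change e (S.mkQ x) = 0 ↔ _
    rw [LinearEquiv.map_eq_zero_iff, Submodule.mkQ_apply, Submodule.Quotient.mk_eq_zero]

/-- The conditions for a special Lagrangian, when the projection of the tangent space to the base lies
in the column space of `B`, and a parametrization `κ ↦ (S κ, X κ)` of the projections of tangent
vectors is known. -/
theorem isSpecialLagrangian_of_local {ι A : Type*} [Fintype ι] [DecidableEq ι]
    [NormedAddCommGroup A] [NormedSpace ℝ A] [FiniteDimensional ℝ A]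
    (hA : Module.finrank ℝ A = Fintype.card ι)
    {g : Matrix (Fin n) (Fin n) ℝ} (hg : g.PosDef) (θ : ℝ) {B : Matrix (Fin n) ι ℝ}
    (hB : Function.Injective B.mulVec) {L : Set (CotTorus n)}
    (h : ∀ q : (Fin n → ℝ) × (Fin n → ℝ), covering q ∈ L →
      ∃ (W : Set ((Fin n → ℝ) × (Fin n → ℝ))) (f : (Fin n → ℝ) × (Fin n → ℝ) → A)
        (f' : (Fin n → ℝ) × (Fin n → ℝ) →L[ℝ] A) (X S : Matrix ι ι ℝ),
        IsOpen W ∧ q ∈ W ∧ ContDiff ℝ ∞ f ∧ HasFDerivAt f f' q ∧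
        (∀ y ∈ W, covering y ∈ L ↔ (∃ s, y.1 = q.1 + B *ᵥ s) ∧ f y = 0) ∧
        (∀ ζ, ∃ s δ, f' (B *ᵥ s, δ) = ζ) ∧
        (∀ s δ, f' (B *ᵥ s, δ) = 0 →
          ∃ κ, s = S *ᵥ κ ∧ Bᵀ *ᵥ δ = X *ᵥ κ + Real.cot θ • (Bᵀ * g * B) *ᵥ s) ∧
        (Xᵀ * S)ᵀ = Xᵀ * S ∧
        (Complex.exp (-(Complex.I * (θ : ℂ))) * (X.map Complex.ofRealHom +
          ((Real.cot θ : ℂ) + Complex.I) •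
            (Bᵀ * g * B * S).map Complex.ofRealHom).det).im = 0) :
    IsSpecialLagrangian g θ L := by
  classical
  have hgt : gᵀ = g := by
    have := hg.1
    rwa [IsHermitian, conjTranspose_eq_transpose_of_trivial] at this
  have hrank : Module.finrank ℝ (LinearMap.range B.mulVecLin) = Fintype.card ι := by
    rw [LinearMap.finrank_range_of_inj (by exact hB), Module.finrank_fintype_fun_eq_card]
  have hle : Fintype.card ι ≤ n := by
    have := Submodule.finrank_le (LinearMap.range B.mulVecLin)
    rwa [hrank, Module.finrank_fin_fun] at this
  -- `R` cuts out the affine space through `q.1` parallel to the columns of `B`; together with the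
  -- equation `f` this gives n equations.
  obtain ⟨R, hRsurj, hR⟩ := exists_surjective_ker_eq (LinearMap.range B.mulVecLin)
    (d := n - Fintype.card ι) (by rw [hrank]; omega)
  have hR' : ∀ x, R x = 0 ↔ ∃ s, x = B *ᵥ s := fun x => by
    rw [hR, LinearMap.mem_range]
    exact ⟨fun ⟨s, hs⟩ => ⟨s, hs.symm⟩, fun ⟨s, hs⟩ => ⟨s, hs.symm⟩⟩
  have hdim : Module.finrank ℝ ((Fin (n - Fintype.card ι) → ℝ) × A) =
      Module.finrank ℝ (Fin n → ℝ) := by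
    rw [Module.finrank_prod, Module.finrank_fin_fun, Module.finrank_fin_fun, hA]
    omega
  let e : ((Fin (n - Fintype.card ι) → ℝ) × A) ≃L[ℝ] (Fin n → ℝ) :=
    ContinuousLinearEquiv.ofFinrankEq hdim
  have hM : IsUnit (Bᵀ * g * B).det := by
    have := hg.conjTranspose_mul_mul_same hB
    rw [conjTranspose_eq_transpose_of_trivial] at this
    exact this.det_pos.ne'.isUnit
  intro q hq
  obtain ⟨W, f, f', X, S, hW, hqW, hf, hf', hL, hsurj, htan, hsymm, him⟩ := h q hq
  let P : (Fin n → ℝ) × (Fin n → ℝ) →L[ℝ] (Fin (n - Fintype.card ι) → ℝ) :=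
    R.comp (ContinuousLinearMap.fst ℝ _ _)
  have hder : HasFDerivAt (fun y => e (R (y.1 - q.1), f y))
      ((e : _ →L[ℝ] (Fin n → ℝ)).comp (P.prod f')) q := by
    have h1 : HasFDerivAt (fun y : (Fin n → ℝ) × (Fin n → ℝ) => R (y.1 - q.1)) P q := by
      have := (P.hasFDerivAt (x := q)).sub_const (R q.1)
      refine this.congr_of_eventuallyEq (Filter.Eventually.of_forall fun y => ?_)
      exact map_sub R _ _
    exact (e : _ →L[ℝ] (Fin n → ℝ)).hasFDerivAt.comp q (h1.prodMk hf')
  have hker : ∀ v, fderiv ℝ (fun y => e (R (y.1 - q.1), f y)) q v = 0 →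
      ∃ κ, v.1 = B *ᵥ (S *ᵥ κ) ∧
        Bᵀ *ᵥ v.2 = X *ᵥ κ + Real.cot θ • (Bᵀ * g * B) *ᵥ (S *ᵥ κ) := by
    intro v hv
    rw [hder.fderiv] at hv
    have h0 : (R v.1, f' v) = 0 := e.map_eq_zero_iff.mp hv
    obtain ⟨h1, h2⟩ := Prod.mk_eq_zero.mp h0
    obtain ⟨s, hs⟩ := (hR' _).mp h1
    obtain ⟨κ, hκ, hκ'⟩ := htan s v.2 (by rw [← hs]; exact h2)
    exact ⟨κ, by rw [hs, hκ], by rw [hκ', hκ]⟩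
  refine ⟨W, fun y => e (R (y.1 - q.1), f y), hW, hqW, ?_, fun y hy => ?_, ?_, ?_, ?_⟩
  · exact (e.contDiff.comp (((R.contDiff.comp (contDiff_fst.sub contDiff_const))).prodMk
      hf)).contDiffOn
  · rw [hL y hy, ContinuousLinearEquiv.map_eq_zero_iff, Prod.mk_eq_zero, hR']
    simp only [sub_eq_iff_eq_add']
  · rw [hder.fderiv]
    refine e.surjective.comp ?_
    rintro ⟨a, ζ⟩
    obtain ⟨x, rfl⟩ := hRsurj a
    obtain ⟨s, δ, hs⟩ := hsurj (ζ - f' (x, 0))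
    refine ⟨(x, 0) + (B *ᵥ s, δ), ?_⟩
    change (R (x + B *ᵥ s), f' ((x, 0) + (B *ᵥ s, δ))) = _
    rw [map_add, map_add, hs, (hR' (B *ᵥ s)).mpr ⟨s, rfl⟩]
    simp
  · intro v w hv hw
    obtain ⟨κ, hv1, hv2⟩ := hker v hv
    obtain ⟨κ', hw1, hw2⟩ := hker w hw
    have hd : ∀ (x : Fin n → ℝ) (s : ι → ℝ), x ⬝ᵥ (B *ᵥ s) = (Bᵀ *ᵥ x) ⬝ᵥ s := fun x s => by
      rw [dotProduct_mulVec, mulVec_transpose]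
    have e1 : symp v w = v.2 ⬝ᵥ w.1 - w.2 ⬝ᵥ v.1 := by
      simp only [symp, Finset.sum_sub_distrib, dotProduct]
    -- The cot θ̂ contributions to ω cancel by symmetry of the Gram matrix, and the remaining ones
    -- by symmetry of XᵀS.
    have hMs : (Bᵀ * g * B)ᵀ = Bᵀ * g * B := by
      rw [transpose_mul, transpose_mul, transpose_transpose, hgt, Matrix.mul_assoc]
    have e2 : ∀ x y : ι → ℝ, ((Bᵀ * g * B) *ᵥ x) ⬝ᵥ y = ((Bᵀ * g * B) *ᵥ y) ⬝ᵥ x := by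
      intro x y
      rw [dotProduct_comm, dotProduct_mulVec, ← mulVec_transpose, hMs]
    have e3 : ∀ x y : ι → ℝ, (X *ᵥ x) ⬝ᵥ (S *ᵥ y) = (X *ᵥ y) ⬝ᵥ (S *ᵥ x) := by
      have : ∀ x y : ι → ℝ, (X *ᵥ x) ⬝ᵥ (S *ᵥ y) = x ⬝ᵥ ((Xᵀ * S) *ᵥ y) := by
        intro x y
        rw [← mulVec_mulVec, dotProduct_mulVec x, ← mulVec_transpose, transpose_transpose]
      intro x y
      rw [this, this, dotProduct_mulVec, ← mulVec_transpose, hsymm, dotProduct_comm]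
    rw [e1, hv1, hw1, hd, hd, hv2, hw2, add_dotProduct, add_dotProduct, smul_dotProduct,
      smul_dotProduct, e2, e3]
    ring
  · intro v hv
    choose κ hκ1 hκ2 using fun k => hker (v k) (hv k)
    obtain ⟨y, hy⟩ := det_add_I_smul_eq g (Matrix.of fun i k => (v k).2 i) B X S
      (Matrix.of fun j k => κ k j) (Real.cot θ) hM (by
        ext j k
        have := congrFun (hκ2 k) j
        rw [Matrix.add_mul, Matrix.smul_mul]
        simp only [Pi.add_apply, Pi.smul_apply, mulVec_mulVec] at this
        exact this)
    have hvol : holVol g v = y * (X.map Complex.ofRealHom + ((Real.cot θ : ℂ) + Complex.I) •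
        (Bᵀ * g * B * S).map Complex.ofRealHom).det := by
      rw [← hy, holVol]
      congr 1
      ext i k
      have h1 : g *ᵥ (v k).1 = (g * B * S) *ᵥ κ k := by
        rw [hκ1, mulVec_mulVec, mulVec_mulVec, Matrix.mul_assoc]
      have h2 : (g * B * (S * Matrix.of fun j k => κ k j)) i k = (g *ᵥ (v k).1) i := by
        rw [h1, ← Matrix.mul_assoc]
        rfl
      simp only [of_apply, Matrix.add_apply, map_apply, Matrix.smul_apply, smul_eq_mul, h2,
        Complex.ofRealHom_eq_coe]
    rw [hvol, mul_left_comm, Complex.im_ofReal_mul, him, mul_zero]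

/-- The argument `θ_m - cot θ̂ ⟨m, μ⟩` of a point of the universal covering. -/
noncomputable def phaseForm (g : Matrix (Fin n) (Fin n) ℝ) (θ : ℝ) (m : Fin n → ℤ) :
    (Fin n → ℝ) × (Fin n → ℝ) →L[ℝ] ℝ :=
  LinearMap.toContinuousLinearMap
    { toFun := fun y => toB m ⬝ᵥ y.2 - Real.cot θ * ip g (toB m) y.1
      map_add' := fun x y => by
        simp only [Prod.fst_add, Prod.snd_add, dotProduct_add, ip_add_right]
        ring
      map_smul' := fun c x => by
        simp only [Prod.smul_fst, Prod.smul_snd, dotProduct_smul, ip_smul_right, smul_eq_mul,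
          RingHom.id_apply]
        ring }

lemma phaseForm_apply (g : Matrix (Fin n) (Fin n) ℝ) (θ : ℝ) (m : Fin n → ℤ)
    (y : (Fin n → ℝ) × (Fin n → ℝ)) :
    phaseForm g θ m y = toB m ⬝ᵥ y.2 - Real.cot θ * ip g (toB m) y.1 := rfl

lemma character_apply (m : Fin n → ℤ) (t : Fin n → Circle) :
    character m t = ∏ i, t i ^ m i := by
  simp [character]

lemma character_exp (m : Fin n → ℤ) (t : Fin n → ℝ) :
    character m (fun i => Circle.exp (t i)) = Circle.exp (toB m ⬝ᵥ t) := by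
  rw [character_apply, dotProduct]
  have : ∀ s : Finset (Fin n), ∏ i ∈ s, Circle.exp (t i) ^ m i =
      Circle.exp (∑ i ∈ s, toB m i * t i) := by
    intro s
    induction s using Finset.induction_on with
    | empty => simp
    | insert a s ha ih =>
      rw [Finset.prod_insert ha, Finset.sum_insert ha, ih, Circle.exp_add, toB, ← zsmul_eq_mul, Circle.exp_zsmul]
  exact this _

lemma phaseAt_covering (g : Matrix (Fin n) (Fin n) ℝ) (θ : ℝ) (m : Fin n → ℤ)
    (y : (Fin n → ℝ) × (Fin n → ℝ)) :
    phaseAt g θ m (covering y) = Circle.exp (phaseForm g θ m y) := by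
  rw [phaseAt, covering, character_exp, phaseForm_apply, sub_eq_add_neg, Circle.exp_add]

/-- The case of one column with X = 0 and S = 1: the determinant is a positive multiple of cot θ̂ +
i = exp(iθ̂)/sin θ̂, whose phase is θ̂. -/
theorem isInvariantCylinder_of_isPrimitive {g : Matrix (Fin n) (Fin n) ℝ} (hg : g.PosDef) {θ : ℝ}
    (hθ : θ ∈ Set.Ioo 0 Real.pi) (a : Fin n → ℝ) {d : Fin n → ℤ} (hd : IsPrimitive d)
    (hd0 : d ≠ 0) (φ : Circle) :
    IsInvariantCylinder g θ {q | (∃ s : ℝ, q.1 = a + s • toB d) ∧ phaseAt g θ d q = φ} := by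
  have hsin : (Real.sin θ : ℂ) ≠ 0 :=
    Complex.ofReal_ne_zero.mpr (Real.sin_pos_of_mem_Ioo hθ).ne'
  refine ⟨?_, a, d, φ, hd, rfl⟩
  have hmul : ∀ s : Unit → ℝ, (Matrix.of fun i (_ : Unit) => toB d i) *ᵥ s = s () • toB d := by
    intro s
    ext i
    simp [mulVec, dotProduct, mul_comm]
  have hip : toB d ≠ 0 := toB_ne_zero hd0
  have hip' := (ip_self_pos hg hip).ne'
  refine isSpecialLagrangian_of_local (ι := Unit) (A := ℝ) (by simp) hg θ
    (B := Matrix.of fun i _ => toB d i) ?_ ?_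
  · intro s t hst
    rw [hmul, hmul] at hst
    funext i
    exact smul_left_injective ℝ hip hst
  · rintro q ⟨⟨s₀, hs₀⟩, hφ⟩
    -- On this neighbourhood equality of phases in U(1) lifts to equality of real arguments.
    refine ⟨{y | |phaseForm g θ d y - phaseForm g θ d q| < 2 * Real.pi},
      fun y => phaseForm g θ d y - phaseForm g θ d q, phaseForm g θ d, 0, 1, ?_, ?_, ?_, ?_, ?_, ?_,
      ?_, ?_, ?_⟩
    · exact isOpen_lt (by fun_prop) continuous_const
    · simpa using Real.pi_pos
    · fun_prop
    · exact (phaseForm g θ d).hasFDerivAt.sub_const _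
    · intro y hy
      refine and_congr ⟨?_, ?_⟩ ?_
      · rintro ⟨s, hs⟩
        refine ⟨fun _ => s - s₀, ?_⟩
        change y.1 = a + s • toB d at hs
        change q.1 = a + s₀ • toB d at hs₀
        rw [hmul, hs, hs₀]
        module
      · rintro ⟨s, hs⟩
        refine ⟨s₀ + s (), ?_⟩
        change q.1 = a + s₀ • toB d at hs₀
        change y.1 = _
        rw [hs, hmul, hs₀]
        module
      · rw [← hφ, phaseAt_covering, phaseAt_covering]
        change _ ↔ phaseForm g θ d y - phaseForm g θ d q = 0
        refine ⟨fun h => ?_, fun h => by rw [sub_eq_zero.mp h]⟩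
        have h1 : Circle.exp (phaseForm g θ d y - phaseForm g θ d q) = 1 := by
          rw [Circle.exp_sub, h, div_self']
        obtain ⟨k, hk⟩ := Circle.exp_eq_one.mp h1
        have hk0 : k = 0 := by
          by_contra hk0
          have : (1 : ℝ) ≤ |(k : ℝ)| := by
            rw [← Int.cast_abs]
            exact_mod_cast Int.one_le_abs hk0
          change |phaseForm g θ d y - phaseForm g θ d q| < 2 * Real.pi at hy
          rw [hk, abs_mul, abs_of_pos Real.two_pi_pos] at hy
          nlinarith [Real.two_pi_pos]
        rw [hk, hk0, Int.cast_zero, zero_mul]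
    · intro ζ
      refine ⟨0, (ζ / (toB d ⬝ᵥ toB d)) • toB d, ?_⟩
      have : toB d ⬝ᵥ toB d ≠ 0 := fun h => hip (dotProduct_self_eq_zero.mp h)
      rw [phaseForm_apply]
      simp only [mulVec_zero, dotProduct_smul, smul_eq_mul, ip, dotProduct_zero, mul_zero, sub_zero]
      field_simp
    · intro s δ hs
      refine ⟨s, (one_mulVec s).symm, ?_⟩
      rw [phaseForm_apply] at hs
      funext i
      rw [zero_mulVec, zero_add, ← mulVec_mulVec, ← mulVec_mulVec]
      exact sub_eq_zero.mp hs
    · simp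
    · rw [Matrix.mul_one, Matrix.map_zero _ (map_zero _), zero_add, det_smul, det_unique]
      simp only [Fintype.card_unit, pow_one, map_apply, Complex.ofRealHom_eq_coe]
      rw [Real.cot_eq_cos_div_sin, ← mul_assoc]
      have h1 : Complex.exp (-(Complex.I * (θ : ℂ))) *
          (((Real.cos θ / Real.sin θ : ℝ) : ℂ) + Complex.I) = ((Real.sin θ)⁻¹ : ℝ) := by
        have h2 : (((Real.cos θ / Real.sin θ : ℝ) : ℂ) + Complex.I) =
            Complex.exp (Complex.I * θ) * ((Real.sin θ)⁻¹ : ℝ) := by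
          rw [mul_comm Complex.I, Complex.exp_mul_I, ← Complex.ofReal_cos, ← Complex.ofReal_sin]
          push_cast
          push_cast at hsin
          field_simp
        rw [h2, ← mul_assoc, ← Complex.exp_add, neg_add_cancel, Complex.exp_zero, one_mul]
      rw [h1, ← Complex.ofReal_mul, Complex.ofReal_im]

end SpecialLagrangian


/-! ### The lift of a smooth curve is special Lagrangian -/

section Lift

open Matrix

variable {n : ℕ}

/-- The matrix with columns `b 0`, `b 1`. -/
def frameMatrix (b : Fin 2 → Fin n → ℤ) : Matrix (Fin n) (Fin 2) ℝ :=
  Matrix.of fun i k => toB (b k) i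

lemma frameMatrix_mulVec (b : Fin 2 → Fin n → ℤ) (s : Fin 2 → ℝ) :
    frameMatrix b *ᵥ s = s 0 • toB (b 0) + s 1 • toB (b 1) := by
  ext i
  simp [frameMatrix, mulVec, dotProduct, Fin.sum_univ_two, mul_comm]

lemma frameMatrix_transpose_mulVec (b : Fin 2 → Fin n → ℤ) (x : Fin n → ℝ) (k : Fin 2) :
    ((frameMatrix b)ᵀ *ᵥ x) k = toB (b k) ⬝ᵥ x := rfl

lemma frameMatrix_injective {b : Fin 2 → Fin n → ℤ} (hb : LinearIndependent ℤ b) :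
    Function.Injective (frameMatrix b).mulVec := by
  intro s t hst
  rw [frameMatrix_mulVec, frameMatrix_mulVec] at hst
  have h := frame_linearIndependent hb (s := s 0 - t 0) (t := s 1 - t 1) (by
    rw [sub_smul, sub_smul, sub_add_sub_comm, hst, sub_self])
  funext k
  fin_cases k
  · exact sub_eq_zero.mp h.1
  · exact sub_eq_zero.mp h.2

lemma gram_apply (g : Matrix (Fin n) (Fin n) ℝ) (b : Fin 2 → Fin n → ℤ) (j k : Fin 2) :
    ((frameMatrix b)ᵀ * g * frameMatrix b) j k = ip g (toB (b j)) (toB (b k)) := by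
  rw [Matrix.mul_assoc]
  rfl

lemma gramDet_eq_det {g : Matrix (Fin n) (Fin n) ℝ} (hg : g.PosDef) (b : Fin 2 → Fin n → ℤ) :
    gramDet g b = ((frameMatrix b)ᵀ * g * frameMatrix b).det := by
  rw [det_fin_two, gram_apply, gram_apply, gram_apply, gram_apply, gramDet,
    ip_comm hg (toB (b 1)) (toB (b 0))]
  ring

lemma gram_posDef {g : Matrix (Fin n) (Fin n) ℝ} (hg : g.PosDef) {b : Fin 2 → Fin n → ℤ}
    (hb : LinearIndependent ℤ b) : ((frameMatrix b)ᵀ * g * frameMatrix b).PosDef := by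
  have := hg.conjTranspose_mul_mul_same (frameMatrix_injective hb)
  rwa [conjTranspose_eq_transpose_of_trivial] at this

lemma gramDet_pos {g : Matrix (Fin n) (Fin n) ℝ} (hg : g.PosDef) {b : Fin 2 → Fin n → ℤ}
    (hb : LinearIndependent ℤ b) : 0 < gramDet g b := by
  rw [gramDet_eq_det hg]
  exact (gram_posDef hg hb).det_pos

lemma planeCoord_add (g : Matrix (Fin n) (Fin n) ℝ) (b : Fin 2 → Fin n → ℤ) (x y : Fin n → ℝ) :
    planeCoord g b (x + y) = planeCoord g b x + planeCoord g b y := by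
  funext k
  fin_cases k <;> simp [planeCoord, ip_add_right] <;> ring

lemma planeCoord_smul (g : Matrix (Fin n) (Fin n) ℝ) (b : Fin 2 → Fin n → ℤ) (c : ℝ)
    (x : Fin n → ℝ) : planeCoord g b (c • x) = c • planeCoord g b x := by
  funext k
  fin_cases k <;> simp [planeCoord, ip_smul_right] <;> ring

lemma logMod_add (g : Matrix (Fin n) (Fin n) ℝ) (θ : ℝ) (b : Fin 2 → Fin n → ℤ)
    (x y : Fin n → ℝ) : logMod g θ b (x + y) = logMod g θ b x + logMod g θ b y := by
  funext k
  fin_cases k <;> simp [logMod, planeCoord_add] <;> ring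

lemma logMod_smul (g : Matrix (Fin n) (Fin n) ℝ) (θ : ℝ) (b : Fin 2 → Fin n → ℤ) (c : ℝ)
    (x : Fin n → ℝ) : logMod g θ b (c • x) = c • logMod g θ b x := by
  funext k
  fin_cases k <;> simp [logMod, planeCoord_smul] <;> ring

lemma planeCoord_frame {g : Matrix (Fin n) (Fin n) ℝ} (hg : g.PosDef) {b : Fin 2 → Fin n → ℤ}
    (hb : LinearIndependent ℤ b) (s t : ℝ) :
    planeCoord g b (s • toB (b 0) + t • toB (b 1)) = ![s, t] := by
  have h := (gramDet_pos hg hb).ne'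
  have h' : ip g (toB (b 0)) (toB (b 0)) * ip g (toB (b 1)) (toB (b 1)) -
    ip g (toB (b 0)) (toB (b 1)) ^ 2 ≠ 0 := h
  funext k
  fin_cases k <;>
  · simp only [planeCoord, ip_add_right, ip_smul_right, ip_comm hg (toB (b 1)) (toB (b 0)), gramDet,
      Fin.zero_eta, Fin.mk_one, cons_val_zero, cons_val_one]
    rw [div_eq_iff h']
    ring

/-- The ratio of `log |z_k|` to the coordinates of the base. -/
noncomputable def modScale (g : Matrix (Fin n) (Fin n) ℝ) (θ : ℝ) (b : Fin 2 → Fin n → ℤ) : ℝ :=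
  Real.sqrt (gramDet g b) / Real.sin θ

lemma modScale_pos {g : Matrix (Fin n) (Fin n) ℝ} (hg : g.PosDef) {θ : ℝ}
    (hθ : θ ∈ Set.Ioo 0 Real.pi) {b : Fin 2 → Fin n → ℤ} (hb : LinearIndependent ℤ b) :
    0 < modScale g θ b :=
  div_pos (Real.sqrt_pos.mpr (gramDet_pos hg hb)) (Real.sin_pos_of_mem_Ioo hθ)

lemma logMod_frame {g : Matrix (Fin n) (Fin n) ℝ} (hg : g.PosDef) (θ : ℝ)
    {b : Fin 2 → Fin n → ℤ} (hb : LinearIndependent ℤ b) (s t : ℝ) :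
    logMod g θ b (s • toB (b 0) + t • toB (b 1)) = ![-(modScale g θ b * t), modScale g θ b * s] := by
  rw [logMod, planeCoord_frame hg hb]
  rfl

/-- The complex logarithms of `z_k` on the universal covering. -/
noncomputable def logForm (g : Matrix (Fin n) (Fin n) ℝ) (θ : ℝ) (b : Fin 2 → Fin n → ℤ)
    (k : Fin 2) : (Fin n → ℝ) × (Fin n → ℝ) →L[ℝ] ℂ :=
  LinearMap.toContinuousLinearMap
    { toFun := fun y => (logMod g θ b y.1 k : ℂ) + Complex.I * (phaseForm g θ (b k) y : ℂ)
      map_add' := fun x y => by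
        rw [Prod.fst_add, logMod_add, map_add, Pi.add_apply]
        push_cast
        ring
      map_smul' := fun c x => by
        rw [Prod.smul_fst, logMod_smul, map_smul, Pi.smul_apply, RingHom.id_apply,
          Complex.real_smul, smul_eq_mul, smul_eq_mul]
        push_cast
        ring }

lemma logForm_apply (g : Matrix (Fin n) (Fin n) ℝ) (θ : ℝ) (b : Fin 2 → Fin n → ℤ) (k : Fin 2)
    (y : (Fin n → ℝ) × (Fin n → ℝ)) :
    logForm g θ b k y = (logMod g θ b y.1 k : ℂ) + Complex.I * (phaseForm g θ (b k) y : ℂ) := rfl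

lemma coe_zCoord_covering (g : Matrix (Fin n) (Fin n) ℝ) (θ : ℝ) (b : Fin 2 → Fin n → ℤ)
    (k : Fin 2) (y : (Fin n → ℝ) × (Fin n → ℝ)) :
    (zCoord g θ b (covering y) k : ℂ) = Complex.exp (logForm g θ b k y) := by
  rw [zCoord, phaseAt_covering, logForm_apply, Complex.exp_add, Units.val_mul, Units.val_mk0,
    Complex.ofReal_exp, mul_comm Complex.I]
  rfl

lemma coe_monomialAt_zCoord_covering (g : Matrix (Fin n) (Fin n) ℝ) (θ : ℝ)
    (b : Fin 2 → Fin n → ℤ) (m : ℤ × ℤ) (y : (Fin n → ℝ) × (Fin n → ℝ)) :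
    (monomialAt m (zCoord g θ b (covering y)) : ℂ) =
      Complex.exp (((m.1 : ℝ) • logForm g θ b 0 + (m.2 : ℝ) • logForm g θ b 1) y) := by
  rw [coe_monomialAt, coe_zCoord_covering, coe_zCoord_covering, ← Complex.exp_int_mul,
    ← Complex.exp_int_mul, ← Complex.exp_add]
  simp [Complex.real_smul]

/-- The g-orthogonal complement r of the frame plane is detected by the moment map: g r lies in the
Lie algebra of the subtorus, so equal levels force ⟨r, r⟩ = 0. -/
lemma mem_momentFibre_iff {g : Matrix (Fin n) (Fin n) ℝ} (hg : g.PosDef)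
    {b : Fin 2 → Fin n → ℤ} (hb : LinearIndependent ℤ b) {p : Module.Dual ℝ (lieSubtorus b)}
    {q : CotTorus n} (hq : q ∈ momentFibre b p) (y : CotTorus n) :
    y ∈ momentFibre b p ↔ ∃ s, y.1 = q.1 + frameMatrix b *ᵥ s := by
  set B := frameMatrix b with hB
  have hM : IsUnit (Bᵀ * g * B).det := (gram_posDef hg hb).det_pos.ne'.isUnit
  constructor
  · intro hy
    set w := y.1 - q.1 with hw
    set s := (Bᵀ * g * B)⁻¹ *ᵥ (Bᵀ *ᵥ (g *ᵥ w)) with hs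
    set r := w - B *ᵥ s with hr
    have hBr : Bᵀ *ᵥ (g *ᵥ r) = 0 := by
      rw [hr, mulVec_sub, mulVec_sub, sub_eq_zero]
      have : Bᵀ *ᵥ (g *ᵥ (B *ᵥ s)) = (Bᵀ * g * B) *ᵥ s := by
        rw [mulVec_mulVec, mulVec_mulVec, Matrix.mul_assoc]
      rw [this, hs, mulVec_mulVec _ (Bᵀ * g * B), mul_nonsing_inv _ hM, one_mulVec]
    have hlie : g *ᵥ r ∈ lieSubtorus b := fun k => congrFun hBr k
    have h1 : w ⬝ᵥ (g *ᵥ r) = 0 := by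
      rw [hw, sub_dotProduct, hy ⟨_, hlie⟩, hq ⟨_, hlie⟩, sub_self]
    have h2 : (B *ᵥ s) ⬝ᵥ (g *ᵥ r) = 0 := by
      rw [dotProduct_comm, dotProduct_mulVec, ← mulVec_transpose, hBr, zero_dotProduct]
    have h3 : ip g r r = 0 := by
      rw [ip]
      nth_rw 1 [hr]
      rw [sub_dotProduct, h1, h2, sub_self]
    have h4 : r = 0 := by
      by_contra hne
      exact (ip_self_pos hg hne).ne' h3
    refine ⟨s, ?_⟩
    rw [← sub_eq_iff_eq_add', ← hw, ← sub_eq_zero, ← hr, h4]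
  · rintro ⟨s, hs⟩ ξ
    rw [hs, add_dotProduct, hq ξ, dotProduct_comm, dotProduct_mulVec, ← mulVec_transpose]
    have : Bᵀ *ᵥ (ξ : Fin n → ℝ) = 0 := funext fun k => ξ.2 k
    rw [this, zero_dotProduct, add_zero]

/-- The solutions of a nontrivial complex linear equation in two unknowns. -/
lemma exists_eq_mul_of_add_eq_zero {a b x y : ℂ} (h : a ≠ 0 ∨ b ≠ 0) (hxy : a * x + b * y = 0) :
    ∃ κ, x = κ * b ∧ y = -(κ * a) := by
  rcases h with h | h
  · refine ⟨-y / a, ?_, ?_⟩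
    · field_simp
      linear_combination hxy
    · field_simp
  · refine ⟨x / b, ?_, ?_⟩
    · field_simp
    · field_simp
      linear_combination hxy

/-- Since cot θ̂ + i = exp(iθ̂)/sin θ̂, the determinant is quadratic in exp(iθ̂). After
multiplication by exp(-iθ̂) the hypothesis makes the outer coefficients agree, leaving 2 cos θ̂ det
X plus a real term. -/
lemma im_exp_mul_det_eq_zero {θ : ℝ} (hθ : Real.sin θ ≠ 0) (X N : Matrix (Fin 2) (Fin 2) ℝ)
    (h : N.det = Real.sin θ ^ 2 * X.det) :
    (Complex.exp (-(Complex.I * (θ : ℂ))) * (X.map Complex.ofRealHom +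
      ((Real.cot θ : ℂ) + Complex.I) • N.map Complex.ofRealHom).det).im = 0 := by
  have hsin : (Real.sin θ : ℂ) ≠ 0 := Complex.ofReal_ne_zero.mpr hθ
  set T := X 0 0 * N 1 1 + N 0 0 * X 1 1 - X 0 1 * N 1 0 - N 0 1 * X 1 0 with hT
  set E := Complex.exp (Complex.I * θ) with hE
  have hE0 : E ≠ 0 := Complex.exp_ne_zero _
  have hEeq : E = Real.cos θ + Real.sin θ * Complex.I := by
    rw [hE, mul_comm Complex.I, Complex.exp_mul_I, ← Complex.ofReal_cos, ← Complex.ofReal_sin]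
  have hEinv : E⁻¹ = Real.cos θ - Real.sin θ * Complex.I := by
    rw [hE, ← Complex.exp_neg, show -(Complex.I * (θ : ℂ)) = ((-θ : ℝ) : ℂ) * Complex.I by
      push_cast; ring, Complex.exp_mul_I, ← Complex.ofReal_cos, ← Complex.ofReal_sin, Real.cos_neg,
      Real.sin_neg]
    push_cast
    ring
  have hz : ((Real.cot θ : ℂ) + Complex.I) = E / Real.sin θ := by
    rw [hEeq, Real.cot_eq_cos_div_sin, Complex.ofReal_div]
    field_simp
  have hdet : (X.map Complex.ofRealHom + ((Real.cot θ : ℂ) + Complex.I) •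
      N.map Complex.ofRealHom).det =
      X.det + E / Real.sin θ * T + (E / Real.sin θ) ^ 2 * N.det := by
    rw [hz, det_fin_two, det_fin_two, det_fin_two, hT]
    simp only [Matrix.add_apply, Matrix.smul_apply, map_apply, Complex.ofRealHom_eq_coe,
      smul_eq_mul]
    push_cast
    ring
  have hres : Complex.exp (-(Complex.I * (θ : ℂ))) * (X.det + E / Real.sin θ * T +
      (E / Real.sin θ) ^ 2 * N.det) = ((2 * Real.cos θ * X.det + T / Real.sin θ : ℝ) : ℂ) := by
    rw [Complex.exp_neg, ← hE, h]
    have : E⁻¹ * (X.det + E / Real.sin θ * T + (E / Real.sin θ) ^ 2 *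
        ((Real.sin θ ^ 2 * X.det : ℝ) : ℂ)) = (E⁻¹ + E) * X.det + T / Real.sin θ := by
      rw [Complex.ofReal_mul, Complex.ofReal_pow]
      field_simp
      ring
    rw [this, hEinv, hEeq, Complex.ofReal_add, Complex.ofReal_mul, Complex.ofReal_mul,
      Complex.ofReal_div, Complex.ofReal_ofNat]
    ring
  rw [hdet, hres, Complex.ofReal_im]

lemma phaseForm_frame (g : Matrix (Fin n) (Fin n) ℝ) (θ : ℝ) (b : Fin 2 → Fin n → ℤ) (k : Fin 2)
    (s : Fin 2 → ℝ) (δ : Fin n → ℝ) :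
    phaseForm g θ (b k) (frameMatrix b *ᵥ s, δ) = ((frameMatrix b)ᵀ *ᵥ δ) k -
      Real.cot θ * (((frameMatrix b)ᵀ * g * frameMatrix b) *ᵥ s) k := by
  rw [phaseForm_apply, frameMatrix_transpose_mulVec, ← mulVec_mulVec, ← mulVec_mulVec,
    frameMatrix_transpose_mulVec]
  rfl

/-- Tangent vectors satisfy a₁ dlog z₁ + a₂ dlog z₂ = 0 with (a₁, a₂) ≠ 0, so (dlog z₁, dlog z₂) = κ
(a₂, -a₁) with κ ∈ ℂ. Real parts give the motion in the base, imaginary parts the motion of the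
arguments. -/
theorem isSpecialLagrangian_liftCurve {g : Matrix (Fin n) (Fin n) ℝ} (hg : g.PosDef) {θ : ℝ}
    (hθ : θ ∈ Set.Ioo 0 Real.pi) {b : Fin 2 → Fin n → ℤ} (hb : LinearIndependent ℤ b)
    (p : Module.Dual ℝ (lieSubtorus b)) {f : LaurentPoly} (hf : IsSmoothCurve f) :
    IsSpecialLagrangian g θ (liftCurve g θ b p f) := by
  have hsin := (Real.sin_pos_of_mem_Ioo hθ).ne'
  have hM : IsUnit ((frameMatrix b)ᵀ * g * frameMatrix b).det :=
    (gram_posDef hg hb).det_pos.ne'.isUnit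
  have hκ := (modScale_pos hg hθ hb).ne'
  refine isSpecialLagrangian_of_local (ι := Fin 2) (A := ℂ) (by simp) hg θ
    (frameMatrix_injective hb) ?_
  rintro q ⟨hq, hz⟩
  have hsmooth := hf _ hz
  set a₁ := f.sum fun m a => a * (m.1 : ℂ) * (monomialAt m (zCoord g θ b (covering q)) : ℂ) with ha₁
  set a₂ := f.sum fun m a => a * (m.2 : ℂ) * (monomialAt m (zCoord g θ b (covering q)) : ℂ) with ha₂
  let l : ℤ × ℤ → (Fin n → ℝ) × (Fin n → ℝ) →L[ℝ] ℂ := fun m =>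
    (m.1 : ℝ) • logForm g θ b 0 + (m.2 : ℝ) • logForm g θ b 1
  have hF' : ∀ v, (∑ m ∈ f.support, f m • (Complex.exp (l m q) • l m)) v =
      a₁ * logForm g θ b 0 v + a₂ * logForm g θ b 1 v := by
    intro v
    rw [_root_.sum_apply, ha₁, ha₂, Finsupp.sum, Finsupp.sum, Finset.sum_mul,
      Finset.sum_mul, ← Finset.sum_add_distrib]
    refine Finset.sum_congr rfl fun m _ => ?_
    rw [show (monomialAt m (zCoord g θ b (covering q)) : ℂ) = Complex.exp (l m q) from
      coe_monomialAt_zCoord_covering g θ b m q]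
    change f m * (Complex.exp (l m q) * ((m.1 : ℝ) • logForm g θ b 0 v +
      (m.2 : ℝ) • logForm g θ b 1 v)) = _
    rw [Complex.real_smul, Complex.real_smul]
    push_cast
    ring
  have hlog : ∀ (s : Fin 2 → ℝ) (k : Fin 2), logMod g θ b (frameMatrix b *ᵥ s) k =
      ![-(modScale g θ b * s 1), modScale g θ b * s 0] k := fun s k => by
    rw [frameMatrix_mulVec, logMod_frame hg θ hb]
  -- `X` is the imaginary part of κ (a₂, -a₁). `S` is its real part, solved for the base
  -- coordinates; the row swap and the sign come from the rotation in `logMod`.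
  refine ⟨Set.univ, fun y => ∑ m ∈ f.support, f m * Complex.exp (l m y),
    ∑ m ∈ f.support, f m • (Complex.exp (l m q) • l m), !![a₂.im, a₂.re; -a₁.im, -a₁.re],
    (modScale g θ b)⁻¹ • !![-a₁.re, a₁.im; -a₂.re, a₂.im], isOpen_univ, Set.mem_univ _, ?_, ?_, ?_,
    ?_, ?_, ?_, ?_⟩
  · exact ContDiff.sum fun m _ => contDiff_const.mul (l m).contDiff.cexp
  · exact HasFDerivAt.fun_sum fun m _ => ((l m).hasFDerivAt.cexp).const_mul (f m)
  · intro y _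
    refine and_congr (mem_momentFibre_iff hg hb hq _) ?_
    rw [curve, Set.mem_ofPred_eq, Finsupp.sum]
    simp only [coe_monomialAt_zCoord_covering]
    rfl
  · intro ζ
    obtain ⟨x, hx⟩ : ∃ x : Fin 2 → ℂ, a₁ * x 0 + a₂ * x 1 = ζ := by
      rcases hsmooth with h | h
      · exact ⟨![ζ / a₁, 0], by simp; field_simp⟩
      · exact ⟨![0, ζ / a₂], by simp; field_simp⟩
    let s : Fin 2 → ℝ := ![(x 1).re / modScale g θ b, -(x 0).re / modScale g θ b]
    let c : Fin 2 → ℝ := fun k => (x k).im +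
      Real.cot θ * (((frameMatrix b)ᵀ * g * frameMatrix b) *ᵥ s) k
    let δ := (g * frameMatrix b) *ᵥ (((frameMatrix b)ᵀ * g * frameMatrix b)⁻¹ *ᵥ c)
    have hδ : (frameMatrix b)ᵀ *ᵥ δ = c := by
      simp only [δ]
      rw [mulVec_mulVec, ← Matrix.mul_assoc, mulVec_mulVec, mul_nonsing_inv _ hM, one_mulVec]
    refine ⟨s, δ, ?_⟩
    have hval : ∀ k, logForm g θ b k (frameMatrix b *ᵥ s, δ) = x k := by
      intro k
      rw [logForm_apply, phaseForm_frame, hδ, hlog]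
      have hre : ![-(modScale g θ b * s 1), modScale g θ b * s 0] k = (x k).re := by
        fin_cases k <;> simp [s] <;> field_simp
      have him : c k - Real.cot θ * (((frameMatrix b)ᵀ * g * frameMatrix b) *ᵥ s) k = (x k).im :=
        add_sub_cancel_right _ _
      rw [hre, him, mul_comm, Complex.re_add_im]
    rw [hF', hval, hval, hx]
  · intro s δ h
    rw [hF'] at h
    obtain ⟨κ, hκ0, hκ1⟩ := exists_eq_mul_of_add_eq_zero hsmooth h
    have h0 : ∀ k, (logForm g θ b k (frameMatrix b *ᵥ s, δ)).re =
        ![-(modScale g θ b * s 1), modScale g θ b * s 0] k := fun k => by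
      rw [logForm_apply, hlog]
      simp
    have h1 : ∀ k, (logForm g θ b k (frameMatrix b *ᵥ s, δ)).im =
        ((frameMatrix b)ᵀ *ᵥ δ) k -
          Real.cot θ * (((frameMatrix b)ᵀ * g * frameMatrix b) *ᵥ s) k := fun k => by
      rw [logForm_apply, ← phaseForm_frame]
      simp
    refine ⟨![κ.re, κ.im], ?_, ?_⟩
    · have e0 := h0 0
      have e1 := h0 1
      rw [hκ0] at e0
      rw [hκ1] at e1
      simp only [Complex.mul_re, Complex.neg_re, cons_val_zero, cons_val_one] at e0 e1
      rw [smul_mulVec]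
      funext k
      fin_cases k
      · simp
        field_simp
        linarith
      · simp
        field_simp
        linarith
    · have e0 := h1 0
      have e1 := h1 1
      rw [hκ0] at e0
      rw [hκ1] at e1
      simp only [Complex.mul_im, Complex.neg_im] at e0 e1
      funext k
      fin_cases k
      · simp only [Fin.zero_eta, Pi.add_apply, Pi.smul_apply, smul_eq_mul] at e0 ⊢
        rw [← sub_eq_iff_eq_add, ← e0]
        simp [mulVec, dotProduct, Fin.sum_univ_two]
        ring
      · simp only [Fin.mk_one, Pi.add_apply, Pi.smul_apply, smul_eq_mul] at e1 ⊢
        rw [← sub_eq_iff_eq_add, ← e1]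
        simp [mulVec, dotProduct, Fin.sum_univ_two]
        ring
  · ext i j
    fin_cases i <;> fin_cases j <;> simp [Matrix.mul_apply, Fin.sum_univ_two] <;> ring
  · refine im_exp_mul_det_eq_zero hsin _ _ ?_
    -- The normalization √det/sin θ̂ of the coordinates supplies exactly the factor sin² θ̂ that is
    -- required.
    have h2 : gramDet g b = modScale g θ b ^ 2 * Real.sin θ ^ 2 := by
      rw [modScale, div_pow, Real.sq_sqrt (gramDet_pos hg hb).le]
      field_simp
    rw [det_mul, ← gramDet_eq_det hg, h2, det_smul, det_fin_two_of, det_fin_two_of, Fintype.card_fin]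
    field_simp

end Lift


/-! ### Chains of edges and the torus of phases -/

section Graph

open scoped Classical

variable {n : ℕ} {V E : Type*}

namespace RayGraph

/-- The incidence numbers of vertices and edges. -/
noncomputable def incidence (G : RayGraph V E) : Matrix V E ℤ := Matrix.of fun v e =>
  (if G.src e = v then 1 else 0) - if G.tgt e = some v then 1 else 0

/-- The edge `e` has `v` as an end vertex. -/
def Touches (G : RayGraph V E) (e : E) (v : V) : Prop := G.src e = v ∨ G.tgt e = some v

variable [Fintype E] (G : RayGraph V E)

lemma mem_flags {v : V} {x : E × Bool} : x ∈ G.flags v ↔ G.endpoint x = some v := by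
  simp [flags]

lemma prod_flags {M : Type*} [CommMonoid M] (v : V) (F : E × Bool → M) :
    ∏ x ∈ G.flags v, F x = ∏ e, ((if G.src e = v then F (e, true) else 1) *
      if G.tgt e = some v then F (e, false) else 1) := by
  rw [flags, Finset.prod_filter, Fintype.prod_prod_type]
  refine Finset.prod_congr rfl fun e _ => ?_
  rw [Fintype.prod_bool]
  simp [endpoint]

lemma prod_flags_zpow {M : Type*} [CommGroup M] (v : V) (φ : E → M) :
    ∏ x ∈ G.flags v, (if x.2 then φ x.1 else (φ x.1)⁻¹) = ∏ e, φ e ^ G.incidence v e := by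
  rw [prod_flags]
  refine Finset.prod_congr rfl fun e _ => ?_
  simp only [incidence, Matrix.of_apply, if_true, Bool.false_eq_true, if_false]
  split_ifs <;> simp

lemma incidence_single_mul (e : E) (k : ℤ) (w : V) :
    (G.incidence.mulVec (Pi.single e k)) w = k * G.incidence w e := by
  rw [Matrix.mulVec_single]
  simp [mul_comm]

end RayGraph

namespace TropicalCurve

variable [Fintype E] (Γ : TropicalCurve n V E)

lemma dir_ne_zero (e : E) : Γ.dir e ≠ 0 := by
  intro h
  have := Γ.primitive e
  rw [IsPrimitive, h] at this
  have h0 : Finset.univ.gcd (0 : Fin n → ℤ) = 0 := Finset.gcd_eq_zero_iff.mpr fun _ _ => rfl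
  rw [h0] at this
  exact zero_ne_one this

lemma src_ne_of_tgt {e : E} {w : V} (h : Γ.tgt e = some w) : Γ.src e ≠ w := by
  rintro rfl
  obtain ⟨l, hl, h⟩ := Γ.internal e _ h
  have h1 : l • toB (Γ.dir e) = 0 := by simpa using h.symm
  exact (smul_ne_zero hl.ne' (toB_ne_zero (Γ.dir_ne_zero e))) h1

lemma outward_ne_zero (x : E × Bool) : Γ.outward x ≠ 0 := by
  rw [outward]
  split_ifs
  · exact Γ.dir_ne_zero _
  · exact neg_ne_zero.mpr (Γ.dir_ne_zero _)

lemma pos_of_endpoint {x : E × Bool} {v w : V} (hv : Γ.endpoint x = some v)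
    (hw : Γ.endpoint (x.1, !x.2) = some w) :
    ∃ l : ℝ, 0 < l ∧ Γ.pos w = Γ.pos v + l • toB (Γ.outward x) := by
  obtain ⟨e, s⟩ := x
  cases s with
  | true =>
    simp only [RayGraph.endpoint, if_true, Bool.not_true, Bool.false_eq_true, if_false,
      Option.some.injEq] at hv hw
    subst hv
    exact Γ.internal e w hw
  | false =>
    simp only [RayGraph.endpoint, if_true, Bool.not_false, Bool.false_eq_true, if_false,
      Option.some.injEq] at hv hw
    subst hw
    obtain ⟨l, hl, h⟩ := Γ.internal e v hv
    refine ⟨l, hl, ?_⟩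
    rw [h]
    simp [outward, toB_neg]

variable {Γ}

/-- A finite set of vertices is left by an edge, and this edge can be chosen not to lead to a given
further vertex. -/
lemma exists_exit [Finite V] (hΓ : Γ.LocallyPlanar) {Z : Set V} (hZ : Z.Nonempty) (v : V) :
    ∃ z ∈ Z, ∃ x ∈ Γ.flags z, ∀ w, Γ.endpoint (x.1, !x.2) = some w → w ∉ Z ∧ w ≠ v := by
  by_contra hcon
  push Not at hcon
  -- A linear function that is nonconstant on every edge, so that the maximum principle below is
  -- strict.
  obtain ⟨f, hf⟩ := Module.exists_dual_forall_apply_ne_zero (K := ℝ) (fun e => toB (Γ.dir e))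
    fun e => toB_ne_zero (Γ.dir_ne_zero e)
  have hout : ∀ x : E × Bool, f (toB (Γ.outward x)) ≠ 0 := by
    intro x
    rw [outward]
    split_ifs
    · exact hf _
    · rw [toB_neg, map_neg]
      exact neg_ne_zero.mpr (hf _)
  -- At a maximum of `l` over Z ∪ {v} that is attained in Z, no edge can leave Z ∪ {v}: otherwise
  -- all of them go strictly down, against the balancing condition.
  have hmax : ∀ l : Module.Dual ℝ (Fin n → ℝ), (∀ x : E × Bool, l (toB (Γ.outward x)) ≠ 0) →
      ∀ z ∈ Z, (∀ w ∈ Z, l (Γ.pos w) ≤ l (Γ.pos z)) → l (Γ.pos v) ≤ l (Γ.pos z) → False := by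
    intro l hl z hz h1 h2
    have hneg : ∀ x ∈ Γ.flags z, l (toB (Γ.outward x)) < 0 := by
      intro x hx
      obtain ⟨w, hw, hw'⟩ := hcon z hz x hx
      obtain ⟨t, ht, hpos⟩ := Γ.pos_of_endpoint (Γ.mem_flags.mp hx) hw
      have h3 : l (Γ.pos w) ≤ l (Γ.pos z) := by
        by_cases h : w ∈ Z
        · exact h1 w h
        · rw [hw' h]
          exact h2
      rw [hpos, map_add, map_smul, smul_eq_mul] at h3
      refine lt_of_le_of_ne ?_ (hl x)
      by_contra hlt
      push Not at hlt
      nlinarith [mul_pos ht hlt]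
    have hsum : ∑ x ∈ Γ.flags z, l (toB (Γ.outward x)) = 0 := by
      have h4 : (∑ x ∈ Γ.flags z, toB (Γ.outward x)) = 0 := by
        have h5 := Γ.balanced z
        funext i
        have h6 := congrFun h5 i
        rw [Finset.sum_apply] at h6 ⊢
        have : ((∑ x ∈ Γ.flags z, (Γ.outward x) i : ℤ) : ℝ) = 0 := by
          exact_mod_cast h6
        simpa [toB] using this
      rw [← map_sum, h4, map_zero]
    have hne : (Γ.flags z).Nonempty := by
      rw [← Finset.card_pos]
      have := (hΓ z).1
      omega
    exact (Finset.sum_neg hneg hne).ne hsum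
  obtain ⟨z, hz, hzmax⟩ := Set.exists_max_image Z (fun w => f (Γ.pos w)) Z.toFinite hZ
  obtain ⟨z', hz', hzmin⟩ := Set.exists_min_image Z (fun w => f (Γ.pos w)) Z.toFinite hZ
  -- If `v` lies above all of Z with respect to `f`, it lies below all of Z with respect to -f, and
  -- the minimum of `f` serves instead.
  rcases le_total (f (Γ.pos v)) (f (Γ.pos z)) with h | h
  · exact hmax f hout z hz hzmax h
  · refine hmax (-f) (fun x => ?_) z' hz' (fun w hw => ?_) ?_
    · exact neg_ne_zero.mpr (hout x)
    · exact neg_le_neg (hzmin w hw)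
    · exact neg_le_neg ((hzmin z hz).trans h)

/-- The sign orients the edge away from `z`; the boundary has no second term when the other side is
free. -/
lemma incidence_mulVec_single {x : E × Bool} {z : V} (hx : Γ.endpoint x = some z) :
    Γ.incidence.mulVec (Pi.single x.1 (if x.2 then 1 else -1)) =
      fun u => (if z = u then 1 else 0) - if Γ.endpoint (x.1, !x.2) = some u then 1 else 0 := by
  funext u
  rw [RayGraph.incidence_single_mul]
  obtain ⟨e, s⟩ := x
  cases s <;> simp only [RayGraph.endpoint, RayGraph.incidence, Matrix.of_apply] at hx ⊢
  · simp at hx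
    simp [hx]
  · simp at hx
    simp [hx]

/-- Every vertex other than `v` is the boundary of a chain of edges that do not touch `v`. -/
theorem exists_incidence_mulVec_eq_single [Finite V] (hΓ : Γ.LocallyPlanar) {v w : V}
    (hw : w ≠ v) : ∃ y : E → ℤ, (∀ e, Γ.Touches e v → y e = 0) ∧
      Γ.incidence.mulVec y = Pi.single w 1 := by
  by_contra hcon
  -- An edge leaving the set of counterexamples and avoiding `v` either is external or ends at a
  -- vertex that already has a chain; in both cases its starting vertex has one.
  let Z : Set V := {w | w ≠ v ∧ ¬ ∃ y : E → ℤ, (∀ e, Γ.Touches e v → y e = 0) ∧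
      Γ.incidence.mulVec y = Pi.single w 1}
  obtain ⟨z, ⟨hzv, hz⟩, x, hx, hexit⟩ := exists_exit hΓ (Z := Z) ⟨w, hw, hcon⟩ v
  apply hz
  have hx' := Γ.mem_flags.mp hx
  have hinc := incidence_mulVec_single hx'
  have htouch : ¬ Γ.Touches x.1 v := by
    obtain ⟨e, s⟩ := x
    intro h
    cases s with
    | true =>
      rcases h with h | h
      · simp [RayGraph.endpoint] at hx'
        exact hzv (hx'.symm.trans h)
      · exact (hexit v (by simpa [RayGraph.endpoint] using h)).2 rfl
    | false =>
      rcases h with h | h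
      · exact (hexit v (by simpa [RayGraph.endpoint] using h)).2 rfl
      · simp [RayGraph.endpoint] at hx'
        exact hzv (Option.some_injective _ (hx'.symm.trans h))
  have hsupp : ∀ (k : ℤ) e, Γ.Touches e v → (Pi.single x.1 k : E → ℤ) e = 0 := by
    intro k e he
    rw [Pi.single_apply, if_neg]
    rintro rfl
    exact htouch he
  cases h : Γ.endpoint (x.1, !x.2) with
  | none =>
    refine ⟨_, hsupp _, hinc.trans ?_⟩
    funext u
    simp [h, Pi.single_apply, eq_comm]
  | some u =>
    obtain ⟨huZ, huv⟩ := hexit u h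
    obtain ⟨y, hy, hyu⟩ := not_not.mp fun hne => huZ ⟨huv, hne⟩
    refine ⟨Pi.single x.1 (if x.2 then 1 else -1) + y, fun e he => ?_, (Matrix.mulVec_add _ _ _).trans ?_⟩
    rotate_left
    · rw [hinc, hyu]
      funext u'
      simp [h, Pi.single_apply, eq_comm]
    · rw [Pi.add_apply, hsupp _ e he, hy e he, add_zero]

/-- Only for `v` itself must the chain use an edge at `v`; beyond this edge the preceding result
applies. -/
theorem exists_incidence_mulVec_eq_single' [Finite V] (hΓ : Γ.LocallyPlanar) (v : V) :
    ∃ y : E → ℤ, Γ.incidence.mulVec y = Pi.single v 1 := by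
  obtain ⟨z, hz, x, hx, hexit⟩ := exists_exit hΓ (Set.singleton_nonempty v) v
  obtain rfl : z = v := hz
  have hinc := incidence_mulVec_single (Γ.mem_flags.mp hx)
  cases h : Γ.endpoint (x.1, !x.2) with
  | none =>
    refine ⟨_, hinc.trans ?_⟩
    funext u
    simp [h, Pi.single_apply, eq_comm]
  | some u =>
    obtain ⟨y, -, hyu⟩ := exists_incidence_mulVec_eq_single hΓ (hexit u h).2
    refine ⟨Pi.single x.1 (if x.2 then 1 else -1) + y, (Matrix.mulVec_add _ _ _).trans ?_⟩
    rw [hinc, hyu]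
    funext u'
    simp [h, Pi.single_apply, eq_comm]

end TropicalCurve

/-- The homomorphism of tori given by an integral matrix. -/
noncomputable def torusMap {I J : Type*} [Fintype J] (A : Matrix I J ℤ) :
    (J → Circle) →* (I → Circle) where
  toFun u i := ∏ j, u j ^ A i j
  map_one' := by
    funext i
    simp
  map_mul' u w := by
    funext i
    simp [mul_zpow, Finset.prod_mul_distrib]

section TorusMap

variable {I J K : Type*} [Fintype J] [Fintype K]

lemma torusMap_apply (A : Matrix I J ℤ) (u : J → Circle) (i : I) :
    torusMap A u i = ∏ j, u j ^ A i j := rfl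

lemma continuous_torusMap (A : Matrix I J ℤ) : Continuous (torusMap A) :=
  continuous_pi fun _ => continuous_finsetProd _ fun j _ => (continuous_apply j).zpow _

lemma torusMap_mul (A : Matrix I J ℤ) (B : Matrix J K ℤ) (u : K → Circle) :
    torusMap (A * B) u = torusMap A (torusMap B u) := by
  funext i
  simp only [torusMap_apply, Matrix.mul_apply]
  have h1 : ∀ k, u k ^ (∑ j, A i j * B j k) = ∏ j, (u k ^ B j k) ^ A i j := fun k => by
    simp only [← zpow_mul, mul_comm (B _ _)]
    induction (Finset.univ : Finset J) using Finset.induction_on with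
    | empty => simp
    | insert a s ha ih => rw [Finset.sum_insert ha, Finset.prod_insert ha, zpow_add, ih]
  simp only [h1, ← Finset.prod_zpow]
  exact Finset.prod_comm

lemma torusMap_add (A B : Matrix I J ℤ) (u : J → Circle) :
    torusMap (A + B) u = torusMap A u * torusMap B u := by
  funext i
  simp [torusMap_apply, zpow_add, Finset.prod_mul_distrib]

lemma torusMap_one [DecidableEq J] (u : J → Circle) :
    torusMap (1 : Matrix J J ℤ) u = u := by
  funext i
  rw [torusMap_apply, Finset.prod_eq_single i]
  · simp
  · intro j _ hj
    simp [Matrix.one_apply_ne hj.symm]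
  · simp

lemma torusMap_zero (u : J → Circle) : torusMap (0 : Matrix I J ℤ) u = 1 := by
  funext i
  simp [torusMap_apply]

end TorusMap

/-- A surjective integral matrix splits. -/
theorem exists_splitting [Fintype V] [Fintype E] {D : Matrix V E ℤ}
    (hD : Function.Surjective D.mulVec) :
    Fintype.card V ≤ Fintype.card E ∧
    ∃ (κ : Matrix E (Fin (Fintype.card E - Fintype.card V)) ℤ)
      (ρ : Matrix (Fin (Fintype.card E - Fintype.card V)) E ℤ) (s : Matrix E V ℤ),
      D * s = 1 ∧ D * κ = 0 ∧ ρ * κ = 1 ∧ κ * ρ + s * D = 1 := by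
  have hrank : Module.finrank ℤ (LinearMap.ker D.mulVecLin) =
      Fintype.card E - Fintype.card V ∧ Fintype.card V ≤ Fintype.card E := by
    have h1 := Submodule.finrank_quotient_add_finrank (LinearMap.ker D.mulVecLin)
    have h2 := (D.mulVecLin.quotKerEquivOfSurjective hD).finrank_eq
    rw [Module.finrank_fintype_fun_eq_card] at h1 h2
    omega
  refine ⟨hrank.2, ?_⟩
  let b := Module.finBasisOfFinrankEq ℤ (LinearMap.ker D.mulVecLin) hrank.1
  choose y hy using fun v : V => hD (Pi.single v 1)
  let κ : Matrix E (Fin (Fintype.card E - Fintype.card V)) ℤ := Matrix.of fun e j => (b j : E → ℤ) e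
  let s : Matrix E V ℤ := Matrix.of fun e v => y v e
  have hs : D * s = 1 := by
    ext v w
    have := congrFun (hy w) v
    rw [Matrix.one_apply, ← Pi.single_apply w (1 : ℤ) v, ← this]
    rfl
  have hκ : D * κ = 0 := by
    ext v j
    exact congrFun (LinearMap.mem_ker.mp (b j).2) v
  have hker : ∀ x : E → ℤ, x - s.mulVec (D.mulVec x) ∈ LinearMap.ker D.mulVecLin := by
    intro x
    rw [LinearMap.mem_ker, Matrix.mulVecLin_apply, Matrix.mulVec_sub, Matrix.mulVec_mulVec, hs,
      Matrix.one_mulVec, sub_self]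
  have hsum : ∀ x : Fin (Fintype.card E - Fintype.card V) → ℤ,
      κ.mulVec x = ((∑ j, x j • b j : LinearMap.ker D.mulVecLin) : E → ℤ) := by
    intro x
    rw [Submodule.coe_sum]
    funext e
    rw [Finset.sum_apply]
    change ∑ j, (b j : E → ℤ) e * x j = ∑ j, x j * (b j : E → ℤ) e
    exact Finset.sum_congr rfl fun j _ => mul_comm _ _
  have hrepr : ∀ x : LinearMap.ker D.mulVecLin, κ.mulVec (b.repr x) = x := by
    intro x
    rw [hsum, b.sum_repr]
  -- The columns are the coordinates of the kernel component of each basis vector in the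
  -- decomposition x = (x - sDx) + sDx.
  let ρ : Matrix (Fin (Fintype.card E - Fintype.card V)) E ℤ :=
    Matrix.of fun j e => b.repr ⟨_, hker (Pi.single e 1)⟩ j
  have hsplit : κ * ρ + s * D = 1 := by
    ext e e'
    have h1 := congrFun (hrepr ⟨_, hker (Pi.single e' 1)⟩) e
    have h2 : (s * D) e e' = s.mulVec (D.mulVec (Pi.single e' 1)) e := by
      rw [Matrix.mulVec_mulVec, Matrix.mulVec_single]
      simp
    have h3 : (1 : Matrix E E ℤ) e e' = (Pi.single e' 1 : E → ℤ) e := by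
      rw [Matrix.one_apply, Pi.single_apply]
    rw [Matrix.add_apply, h2, h3]
    have h4 : (κ * ρ) e e' = κ.mulVec (b.repr ⟨_, hker (Pi.single e' 1)⟩) e := rfl
    rw [h4, h1]
    exact sub_add_cancel _ _
  refine ⟨κ, ρ, s, hs, hκ, ?_, hsplit⟩
  have hinj : Function.Injective κ.mulVec := by
    intro x y hxy
    rw [hsum, hsum] at hxy
    have h2 := congrArg b.repr (Subtype.val_injective hxy)
    funext j
    have := congrArg (fun f => f j) h2
    simpa only [b.repr_sum_self] using this
  have hκρκ : κ * (ρ * κ) =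
      κ * (1 : Matrix (Fin (Fintype.card E - Fintype.card V))
        (Fin (Fintype.card E - Fintype.card V)) ℤ) := by
    have h1 : (κ * ρ + s * D) * κ = κ := by rw [hsplit, Matrix.one_mul]
    rw [Matrix.add_mul, Matrix.mul_assoc, Matrix.mul_assoc, hκ, Matrix.mul_zero, add_zero] at h1
    rw [h1, Matrix.mul_one]
  ext j k
  have h1 : κ.mulVec (fun j => (ρ * κ) j k) =
      κ.mulVec (fun j => (1 : Matrix (Fin (Fintype.card E - Fintype.card V)) _ ℤ) j k) := by
    funext e
    exact congrFun (congrFun hκρκ e) k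
  exact congrFun (hinj h1) j

/-- A chain of edges with given boundary. -/
theorem TropicalCurve.incidence_mulVec_surjective [Fintype V] [Fintype E]
    {Γ : TropicalCurve n V E} (hΓ : Γ.LocallyPlanar) :
    Function.Surjective Γ.incidence.mulVec := by
  choose y hy using exists_incidence_mulVec_eq_single' hΓ
  intro x
  refine ⟨∑ v, x v • y v, ?_⟩
  rw [← Matrix.mulVecLin_apply, map_sum]
  simp only [map_smul, Matrix.mulVecLin_apply, hy]
  funext w
  simp [Finset.sum_apply, Pi.single_apply]

/-- The phase balancing equations in terms of the incidence matrix. -/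
lemma TropicalCurve.mem_phaseSolutions_iff [Fintype V] [Fintype E] {Γ : TropicalCurve n V E}
    {φ : E → Circle} : φ ∈ Γ.phaseSolutions ↔
      torusMap Γ.incidence φ = fun v => Circle.exp ((Γ.flags v).card * Real.pi) := by
  rw [funext_iff]
  refine forall_congr' fun v => ?_
  rw [torusMap_apply, RayGraph.prod_flags_zpow]

/-- The outward phase at a side of an edge. -/
noncomputable def outwardPhase (φ : E → Circle) (x : E × Bool) : Circle :=
  if x.2 then φ x.1 else (φ x.1)⁻¹

lemma outwardPhase_mul (φ ψ : E → Circle) (x : E × Bool) :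
    outwardPhase (φ * ψ) x = outwardPhase φ x * outwardPhase ψ x := by
  rw [outwardPhase, outwardPhase, outwardPhase]
  split_ifs
  · rfl
  · exact mul_inv _ _

lemma continuous_outwardPhase (x : E × Bool) :
    Continuous fun φ : E → Circle => outwardPhase φ x := by
  unfold outwardPhase
  split_ifs
  · exact continuous_apply _
  · exact (continuous_apply _).inv

/-- The phases at a vertex `v` satisfying the balancing equation at `v` extend to a solution. -/
theorem TropicalCurve.exists_mem_phaseSolutions [Fintype V] [Fintype E] {Γ : TropicalCurve n V E}
    (hΓ : Γ.LocallyPlanar) (v : V) (τ : E × Bool → Circle)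
    (hτ : ∏ x ∈ Γ.flags v, τ x = Circle.exp ((Γ.flags v).card * Real.pi)) :
    ∃ φ ∈ Γ.phaseSolutions, ∀ x ∈ Γ.flags v, outwardPhase φ x = τ x := by
  -- The prescription is consistent because no edge has both ends at `v`; edges away from `v` get
  -- phase one.
  let φ₀ : E → Circle := fun e =>
    if Γ.src e = v then τ (e, true) else if Γ.tgt e = some v then (τ (e, false))⁻¹ else 1
  have hφ₀ : ∀ x ∈ Γ.flags v, outwardPhase φ₀ x = τ x := by
    rintro ⟨e, s⟩ hx
    have hx' := Γ.mem_flags.mp hx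
    cases s with
    | true =>
      have h : Γ.src e = v := by simpa [RayGraph.endpoint] using hx'
      simp [outwardPhase, φ₀, h]
    | false =>
      have h : Γ.tgt e = some v := by simpa [RayGraph.endpoint] using hx'
      simp [outwardPhase, φ₀, h, Γ.src_ne_of_tgt h]
  have htouch : ∀ x ∈ Γ.flags v, Γ.Touches x.1 v := by
    rintro ⟨e, s⟩ hx
    have hx' := Γ.mem_flags.mp hx
    cases s with
    | true => exact Or.inl (by simpa [RayGraph.endpoint] using hx')
    | false => exact Or.inr (by simpa [RayGraph.endpoint] using hx')
  have hy : ∀ w : V, ∃ y : E → ℤ, (∀ e, Γ.Touches e v → y e = 0) ∧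
      Γ.incidence.mulVec y = if w = v then 0 else Pi.single w 1 := by
    intro w
    split_ifs with h
    · exact ⟨0, fun _ _ => rfl, Matrix.mulVec_zero _⟩
    · exact exists_incidence_mulVec_eq_single hΓ h
  choose y hy0 hy1 using hy
  let Y : Matrix E V ℤ := Matrix.of fun e w => y w e
  -- The failure of `φ₀` to be balanced at each vertex. It is trivial at `v`, so it can be corrected
  -- by chains that do not touch `v`.
  set η : V → Circle := fun w => Circle.exp ((Γ.flags w).card * Real.pi) *
    (torusMap Γ.incidence φ₀ w)⁻¹ with hη
  have hηv : η v = 1 := by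
    rw [hη]
    change _ * (torusMap Γ.incidence φ₀ v)⁻¹ = 1
    rw [mul_inv_eq_one, torusMap_apply, ← RayGraph.prod_flags_zpow, ← hτ]
    exact Finset.prod_congr rfl fun x hx => (hφ₀ x hx).symm
  have hDY : torusMap (Γ.incidence * Y) η = η := by
    funext w
    have h1 : ∀ u, (Γ.incidence * Y) w u = (if u = v then 0 else Pi.single u 1 : V → ℤ) w :=
      fun u => congrFun (hy1 u) w
    rw [torusMap_apply, Finset.prod_eq_single w]
    · rw [h1]
      split_ifs with h
      · rw [h, hηv]
        simp
      · simp
    · intro u _ hu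
      rw [h1]
      split_ifs
      · simp
      · simp [hu.symm]
    · simp
  refine ⟨φ₀ * torusMap Y η, ?_, fun x hx => ?_⟩
  · rw [mem_phaseSolutions_iff, map_mul, ← torusMap_mul, hDY]
    funext w
    simp [hη]
  · rw [outwardPhase_mul, hφ₀ x hx]
    have : torusMap Y η x.1 = 1 := by
      rw [torusMap_apply]
      refine Finset.prod_eq_one fun w _ => ?_
      rw [show Y x.1 w = 0 from hy0 w _ (htouch x hx), zpow_zero]
    simp [outwardPhase, this]

end Graph


/-! ### Genericity in the torus of phases -/

section Generic

open scoped Classical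

/-- A nonzero polynomial does not vanish on a dense subset of the torus. -/
theorem dense_setOf_eval_ne_zero {σ : Type*} [Finite σ] {Δ : MvPolynomial σ ℂ} (hΔ : Δ ≠ 0) :
    Dense {c : σ → Circle | MvPolynomial.eval (fun x => -(c x : ℂ)⁻¹) Δ ≠ 0} := by
  -- A nontrivial connected space has no isolated points, so neighbourhoods in the circle are
  -- infinite. A polynomial vanishing on a product of infinite sets is zero.
  have : Nontrivial Circle := ⟨1, Circle.exp Real.pi, fun h => by
    have h1 := congrArg (fun a : Circle => (a : ℂ)) h
    simp only [Circle.coe_one, Circle.coe_exp, Complex.exp_pi_mul_I] at h1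
    norm_num at h1⟩
  rw [dense_iff_inter_open]
  rintro O hO ⟨c, hc⟩
  obtain ⟨u, hu, hsub⟩ := isOpen_pi_iff'.mp hO c hc
  by_contra hne
  apply hΔ
  refine MvPolynomial.funext_set (fun x => (fun a : Circle => -(a : ℂ)⁻¹) '' u x) (fun x => ?_) ?_
  · refine (infinite_of_mem_nhds (c x) ((hu x).1.mem_nhds (hu x).2)).image ?_
    intro a _ b _ hab
    exact Subtype.val_injective (inv_injective (neg_injective hab))
  · intro y hy
    choose a ha hay using fun x => hy x (Set.mem_univ x)
    rw [map_zero]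
    by_contra h
    refine hne ⟨a, hsub fun x _ => ha x, ?_⟩
    change MvPolynomial.eval (fun x => -(a x : ℂ)⁻¹) Δ ≠ 0
    rwa [show (fun x => -(a x : ℂ)⁻¹) = y from funext hay]

variable {n : ℕ} {V E : Type*} [Fintype E]

/-- The N signs match exp(iNπ) = (-1)^N: phase balancing is the closing condition of the dual
polygon. -/
lemma prod_neg_inv_outwardPhase {Γ : TropicalCurve n V E} {φ : E → Circle}
    (hφ : φ ∈ Γ.phaseSolutions) (v : V) :
    ∏ x : {x // x ∈ Γ.flags v}, (-(outwardPhase φ x.1 : ℂ)⁻¹) = 1 := by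
  have h1 : ∏ x ∈ Γ.flags v, outwardPhase φ x = Circle.exp ((Γ.flags v).card * Real.pi) := hφ v
  have h2 : ∏ x ∈ Γ.flags v, (outwardPhase φ x : ℂ) = (-1) ^ (Γ.flags v).card := by
    have h3 := congrArg Circle.coeHom h1
    rw [map_prod] at h3
    refine h3.trans ?_
    change ((Circle.exp _ : Circle) : ℂ) = _
    rw [Circle.coe_exp]
    push_cast
    rw [mul_assoc, Complex.exp_nat_mul, Complex.exp_pi_mul_I]
  rw [Finset.prod_coe_sort (Γ.flags v) (fun x => -(outwardPhase φ x : ℂ)⁻¹), Finset.prod_neg,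
    Finset.prod_inv_distrib, h2, mul_inv_cancel₀]
  exact pow_ne_zero _ (by norm_num)

/-- For generic solutions of the phase balancing equations, the polynomial at `v` with the prescribed
phases is smooth with distinct ends. -/
theorem exists_isOpen_dense_of_isLatticeFan [Fintype V] {Γ : TropicalCurve n V E} (hΓ : Γ.LocallyPlanar)
    {r : ℕ} {φ₀ : E → Circle} {Ψ : (Fin r → Circle) →* (E → Circle)} (hΨ : Continuous Ψ)
    (hrange : Set.range (fun u => φ₀ * Ψ u) = Γ.phaseSolutions) (v : V) {m : E × Bool → ℤ × ℤ}
    (hm : IsLatticeFan fun x : {x // x ∈ Γ.flags v} => m x) :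
    ∃ U : Set (Fin r → Circle), IsOpen U ∧ Dense U ∧ ∀ u ∈ U,
      (∀ x ∈ Γ.flags v, ∀ y ∈ Γ.flags v, x ≠ y →
        outwardPhase (φ₀ * Ψ u) x ≠ outwardPhase (φ₀ * Ψ u) y) ∧
      ∀ z : Fin 2 → ℂ, (∀ k, z k ≠ 0) → ¬ IsSingularAt (fun x : {x // x ∈ Γ.flags v} => m x)
        (fun x => -(outwardPhase (φ₀ * Ψ u) x.1 : ℂ)⁻¹) z := by
  have hsol : ∀ u, φ₀ * Ψ u ∈ Γ.phaseSolutions := fun u => hrange ▸ ⟨u, rfl⟩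
  obtain ⟨x0, hx0⟩ : (Γ.flags v).Nonempty := by
    rw [← Finset.card_pos]
    have := (hΓ v).1
    omega
  let I := {x // x ∈ Γ.flags v}
  obtain ⟨Δ, hΔ, hgen⟩ := exists_discriminant hm (⟨x0, hx0⟩ : I)
  let J := {x : I // x ≠ ⟨x0, hx0⟩}
  let h : (Fin r → Circle) →* (J → Circle) :=
    { toFun := fun u x => outwardPhase (Ψ u) x.1.1
      map_one' := by
        funext x
        simp [outwardPhase]
      map_mul' := fun u w => by
        funext x
        rw [map_mul, outwardPhase_mul]
        rfl }
  let c : J → Circle := fun x => outwardPhase φ₀ x.1.1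
  have hcont : Continuous h :=
    continuous_pi fun x => (continuous_outwardPhase x.1.1).comp hΨ
  have hsurj : Function.Surjective h := by
    intro t
    let τ' : E × Bool → Circle := fun x =>
      if hx : ∃ hx : x ∈ Γ.flags v, (⟨x, hx⟩ : I) ≠ ⟨x0, hx0⟩ then t ⟨⟨x, hx.1⟩, hx.2⟩ *
        outwardPhase φ₀ x else 1
    -- The phase at `x0` is chosen to satisfy the balancing equation at `v`; the other phases are
    -- free.
    let τ : E × Bool → Circle := Function.update τ' x0
      (Circle.exp ((Γ.flags v).card * Real.pi) * (∏ x ∈ (Γ.flags v).erase x0, τ' x)⁻¹)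
    have hτ : ∏ x ∈ Γ.flags v, τ x = Circle.exp ((Γ.flags v).card * Real.pi) := by
      rw [← Finset.mul_prod_erase _ _ hx0]
      have h1 : ∏ x ∈ (Γ.flags v).erase x0, τ x = ∏ x ∈ (Γ.flags v).erase x0, τ' x :=
        Finset.prod_congr rfl fun x hx =>
          Function.update_of_ne (Finset.ne_of_mem_erase hx) _ _
      rw [h1, show τ x0 = _ from Function.update_self x0 _ _, inv_mul_cancel_right]
    obtain ⟨φ, hφ, hφτ⟩ := TropicalCurve.exists_mem_phaseSolutions hΓ v τ hτ
    rw [← hrange] at hφ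
    obtain ⟨u, rfl⟩ := hφ
    refine ⟨u, funext fun x => ?_⟩
    have h1 := hφτ x.1.1 x.1.2
    have hne : x.1.1 ≠ x0 := fun heq => x.2 (Subtype.ext heq)
    have h2 : τ x.1.1 = t x * outwardPhase φ₀ x.1.1 := by
      rw [show τ x.1.1 = τ' x.1.1 from Function.update_of_ne hne _ _]
      exact dif_pos ⟨x.1.2, x.2⟩
    rw [h2, outwardPhase_mul, mul_comm (t x)] at h1
    exact mul_left_cancel h1
  -- A continuous surjective homomorphism from a compact group is open, and preimages of dense sets
  -- under open maps are dense.
  have hopen : IsOpenMap fun u => c * h u :=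
    (Homeomorph.mulLeft c).isOpenMap.comp (h.isOpenMap_of_sigmaCompact hsurj hcont)
  have hcont' : Continuous fun u => c * h u := continuous_const.mul hcont
  have hval : ∀ (u) (x : J), (c * h u) x = outwardPhase (φ₀ * Ψ u) x.1.1 := fun u x => by
    rw [outwardPhase_mul]
    rfl
  refine ⟨(fun u => c * h u) ⁻¹' {c : J → Circle | MvPolynomial.eval (fun x => -(c x : ℂ)⁻¹) Δ ≠ 0},
    ?_, (dense_setOf_eval_ne_zero hΔ).preimage hopen, fun u hu => ?_⟩
  · refine IsOpen.preimage hcont' (isOpen_ne_fun ?_ continuous_const)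
    refine (MvPolynomial.continuous_eval Δ).comp (continuous_pi fun x => ?_)
    exact (Continuous.inv₀ (continuous_subtype_val.comp (continuous_apply x))
      fun a => Circle.coe_ne_zero _).neg
  · have h1 := hgen (fun x => -(outwardPhase (φ₀ * Ψ u) x.1 : ℂ)⁻¹)
      (prod_neg_inv_outwardPhase (hsol u) v) (by
        have : MvPolynomial.eval (fun x => -((c * h u) x : ℂ)⁻¹) Δ ≠ 0 := hu
        simpa only [hval] using this)
    refine ⟨fun x hx y hy hxy heq => ?_, h1.2⟩
    refine h1.1 ⟨x, hx⟩ ⟨y, hy⟩ (fun h => hxy (congrArg Subtype.val h)) ?_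
    change -(outwardPhase (φ₀ * Ψ u) x : ℂ)⁻¹ = -(outwardPhase (φ₀ * Ψ u) y : ℂ)⁻¹
    rw [heq]

end Generic

/-! ### Primitive frames at the vertices -/

section Frames

open scoped Classical

variable {n : ℕ} {V E : Type*} [Fintype E]

/-- A submodule of `ℤⁿ` of rank two is contained in the span of a primitive frame. -/
theorem exists_isPrimitiveFrame (N : Submodule ℤ (Fin n → ℤ)) (hN : Module.finrank ℤ N = 2) :
    ∃ b : Fin 2 → Fin n → ℤ, IsPrimitiveFrame b ∧ N ≤ Submodule.span ℤ (Set.range b) := by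
  -- The saturation of `N`; the quotient by `N` is torsion, so the rank is unchanged.
  let S : Submodule ℤ (Fin n → ℤ) := (Submodule.torsion ℤ ((Fin n → ℤ) ⧸ N)).comap N.mkQ
  have hmem : ∀ x, x ∈ S ↔ ∃ k : ℤ, k ≠ 0 ∧ k • x ∈ N := by
    intro x
    rw [Submodule.mem_comap, Submodule.mem_torsion_iff]
    constructor
    · rintro ⟨k, hk⟩
      refine ⟨k, nonZeroDivisors.coe_ne_zero k, ?_⟩
      rw [← Submodule.Quotient.mk_eq_zero]
      exact hk
    · rintro ⟨k, hk, h⟩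
      refine ⟨⟨k, mem_nonZeroDivisors_of_ne_zero hk⟩, ?_⟩
      exact (Submodule.Quotient.mk_eq_zero N).mpr h
  have hNS : N ≤ S := fun x hx => (hmem x).mpr ⟨1, one_ne_zero, by rwa [one_smul]⟩
  have hrank : Module.finrank ℤ S = 2 := by
    have h1 := Submodule.finrank_quotient_add_finrank (N.submoduleOf S)
    have h2 : Module.finrank ℤ (S ⧸ N.submoduleOf S) = 0 := by
      rw [Module.finrank_eq_zero_iff_isTorsion]
      intro x
      obtain ⟨y, rfl⟩ := Submodule.mkQ_surjective _ x
      obtain ⟨k, hk, h⟩ := (hmem y).mp y.2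
      exact ⟨⟨k, mem_nonZeroDivisors_of_ne_zero hk⟩,
        (Submodule.Quotient.mk_eq_zero (N.submoduleOf S)).mpr h⟩
    rw [h2, (Submodule.submoduleOfEquivOfLe hNS).finrank_eq, hN] at h1
    exact h1.symm
  let B := Module.finBasisOfFinrankEq ℤ S hrank
  have hspan : Submodule.span ℤ (Set.range fun k => (B k : Fin n → ℤ)) = S := by
    have h1 := congrArg (Submodule.map S.subtype) B.span_eq
    rw [Submodule.map_span, Submodule.map_subtype_top, ← Set.range_comp] at h1
    exact h1
  refine ⟨fun k => B k, ⟨?_, ?_⟩, ?_⟩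
  · exact B.linearIndependent.map' S.subtype (Submodule.ker_subtype S)
  · intro k x hk hx
    rw [hspan] at hx ⊢
    obtain ⟨l, hl, h⟩ := (hmem _).mp hx
    exact (hmem x).mpr ⟨l * k, mul_ne_zero hl hk, by rwa [mul_smul]⟩
  · rw [hspan]
    exact hNS

/-- A common divisor of the two coefficients divides all entries of the vector; coprimality then
gives a Bézout relation. -/
lemma exists_det_eq_neg_one {b : Fin 2 → Fin n → ℤ} {p : ℤ × ℤ}
    (h : IsPrimitive (p.1 • b 0 + p.2 • b 1)) : ∃ p' : ℤ × ℤ, p.1 * p'.2 - p.2 * p'.1 = -1 := by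
  have h1 : IsCoprime p.1 p.2 := by
    rw [Int.isCoprime_iff_gcd_eq_one]
    have h2 : ((Int.gcd p.1 p.2 : ℕ) : ℤ) ∣ Finset.univ.gcd (p.1 • b 0 + p.2 • b 1) := by
      refine Finset.dvd_gcd fun i _ => ?_
      simp only [Pi.add_apply, Pi.smul_apply, smul_eq_mul]
      exact dvd_add (Dvd.dvd.mul_right (Int.gcd_dvd_left ..) _)
        (Dvd.dvd.mul_right (Int.gcd_dvd_right ..) _)
    rw [h] at h2
    have := Int.natCast_dvd_natCast.mp (by exact_mod_cast h2 : ((Int.gcd p.1 p.2 : ℕ) : ℤ) ∣ ((1 : ℕ) : ℤ))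
    exact Nat.dvd_one.mp this
  obtain ⟨a, c, hac⟩ := h1
  exact ⟨(c, -a), by simp only; linarith⟩

lemma TropicalCurve.isPrimitive_outward (Γ : TropicalCurve n V E) (x : E × Bool) : IsPrimitive (Γ.outward x) := by
  rw [outward]
  split_ifs
  · exact Γ.primitive _
  · have h := Γ.primitive x.1
    rw [IsPrimitive] at h ⊢
    have h1 := Finset.gcd_mul_left (s := Finset.univ) (f := Γ.dir x.1) (a := -1)
    rw [h, normalize_eq_one.mpr (by simp), mul_one] at h1
    simpa [Pi.neg_def] using h1

theorem TropicalCurve.exists_frame {Γ : TropicalCurve n V E} (hΓ : Γ.LocallyPlanar) (v : V) :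
    ∃ (b : Fin 2 → Fin n → ℤ) (m : E × Bool → ℤ × ℤ), IsPrimitiveFrame b ∧
      (∀ x ∈ Γ.flags v, Γ.outward x = (m x).1 • b 0 + (m x).2 • b 1) ∧
      IsLatticeFan fun x : {x // x ∈ Γ.flags v} => m x := by
  obtain ⟨b, hb, hle⟩ := exists_isPrimitiveFrame _ (hΓ v).2
  have hm : ∀ x, ∃ m : ℤ × ℤ, x ∈ Γ.flags v → Γ.outward x = m.1 • b 0 + m.2 • b 1 := by
    intro x
    by_cases hx : x ∈ Γ.flags v
    · have h1 := hle (Submodule.subset_span ⟨x, hx, rfl⟩)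
      obtain ⟨c, hc⟩ := (Submodule.mem_span_range_iff_exists_fun ℤ).mp h1
      exact ⟨(c 0, c 1), fun _ => by rw [← hc, Fin.sum_univ_two]⟩
    · exact ⟨0, fun h => absurd h hx⟩
  choose m hm using hm
  have hprim : ∀ x ∈ Γ.flags v, ∃ m' : ℤ × ℤ, (m x).1 * m'.2 - (m x).2 * m'.1 = -1 := by
    intro x hx
    refine exists_det_eq_neg_one (b := b) ?_
    rw [← hm x hx]
    exact Γ.isPrimitive_outward x
  refine ⟨b, m, hb, hm, ⟨?_, ?_, ?_⟩, fun x => hprim x x.2⟩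
  · intro x h0
    have h1 : m x = 0 := by
      have h2 := congrArg Complex.re h0
      have h3 := congrArg Complex.im h0
      simp only [latticeToComplex, Complex.zero_re, Complex.zero_im, Int.cast_eq_zero] at h2 h3
      exact Prod.ext h2 h3
    have := hm x x.2
    rw [h1] at this
    exact Γ.outward_ne_zero x (by simpa using this)
  · have h0 : ∑ x ∈ Γ.flags v, ((m x).1 • b 0 + (m x).2 • b 1) = 0 := by
      rw [← Γ.balanced v]
      exact Finset.sum_congr rfl fun x hx => (hm x hx).symm
    rw [Finset.sum_add_distrib, ← Finset.sum_smul, ← Finset.sum_smul] at h0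
    have h1 : ∀ k, ![∑ x ∈ Γ.flags v, (m x).1, ∑ x ∈ Γ.flags v, (m x).2] k = 0 :=
      Fintype.linearIndependent_iff.mp hb.1 _ (by simpa [Fin.sum_univ_two] using h0)
    rw [← latticeToComplex_sum, Finset.sum_coe_sort (Γ.flags v) m,
      show ∑ x ∈ Γ.flags v, m x = 0 from Prod.ext (by simpa [Prod.fst_sum] using h1 0)
        (by simpa [Prod.snd_sum] using h1 1)]
    simp [latticeToComplex, Complex.ext_iff]
  -- If all vectors were parallel to `η`, they would agree up to sign, being primitive, and span a
  -- lattice of rank at most one.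
  · intro η hη
    by_contra hcon
    push Not at hcon
    have hpar : ∀ x ∈ Γ.flags v, ∀ y ∈ Γ.flags v, (m x).1 * (m y).2 - (m x).2 * (m y).1 = 0 := by
      intro x hx y hy
      have h1 : η.re * (m x).2 - η.im * (m x).1 = 0 := hcon ⟨x, hx⟩
      have h2 : η.re * (m y).2 - η.im * (m y).1 = 0 := hcon ⟨y, hy⟩
      have h3 : ((m x).1 * (m y).2 - (m x).2 * (m y).1 : ℝ) = 0 := by
        by_contra hne
        apply hη
        refine Complex.ext ?_ ?_
        · have : η.re * ((m x).1 * (m y).2 - (m x).2 * (m y).1 : ℝ) = 0 := by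
            linear_combination (m x).1 * h2 - (m y).1 * h1
          exact (mul_eq_zero.mp this).resolve_right hne
        · have : η.im * ((m x).1 * (m y).2 - (m x).2 * (m y).1 : ℝ) = 0 := by
            linear_combination (m x).2 * h2 - (m y).2 * h1
          exact (mul_eq_zero.mp this).resolve_right hne
      exact_mod_cast h3
    obtain ⟨x0, hx0⟩ : (Γ.flags v).Nonempty := by
      rw [← Finset.card_pos]
      have := (hΓ v).1
      omega
    have hsub : Submodule.span ℤ (Γ.outward '' (Γ.flags v : Set (E × Bool))) ≤
        Submodule.span ℤ {Γ.outward x0} := by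
      rw [Submodule.span_le]
      rintro _ ⟨x, hx, rfl⟩
      obtain ⟨p', hp'⟩ := hprim x hx
      obtain ⟨q', hq'⟩ := hprim x0 hx0
      have hmem := Submodule.mem_span_singleton_self (R := ℤ) (Γ.outward x0)
      rcases eq_or_eq_neg_of_parallel hp' hq' (hpar x hx x0 hx0) with h | h
      · rw [SetLike.mem_coe, hm x hx, h, ← hm x0 hx0]
        exact hmem
      · have : Γ.outward x = -Γ.outward x0 := by
          rw [hm x hx, h, hm x0 hx0]
          simp
          abel
        rw [SetLike.mem_coe, this]
        exact neg_mem hmem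
    have h1 := Submodule.finrank_mono hsub
    have h2 := finrank_span_le_card (R := ℤ) ({Γ.outward x0} : Set (Fin n → ℤ))
    rw [(hΓ v).2] at h1
    simp at h2
    omega

end Frames


/-! ### Translation of the curves to their vertices -/

section Translation

variable {n : ℕ}

lemma monomialAt_mul (p : ℤ × ℤ) (z w : Fin 2 → ℂˣ) :
    monomialAt p (z * w) = monomialAt p z * monomialAt p w := by
  simp only [monomialAt, Pi.mul_apply, mul_zpow]
  exact mul_mul_mul_comm _ _ _ _

lemma translateBy_eq_mul (g : Matrix (Fin n) (Fin n) ℝ) (θ : ℝ) (b : Fin 2 → Fin n → ℤ)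
    (a : Fin n → ℝ) (z : Fin 2 → ℂˣ) :
    translateBy g θ b a z = translateBy g θ b a 1 * z := by
  funext k
  simp [translateBy]

lemma coe_translateBy_one (g : Matrix (Fin n) (Fin n) ℝ) (θ : ℝ) (b : Fin 2 → Fin n → ℤ)
    (a : Fin n → ℝ) (k : Fin 2) :
    (translateBy g θ b a 1 k : ℂ) = Complex.exp (logMod g θ b a k) := by
  simp [translateBy]

lemma translateBy_add_one (g : Matrix (Fin n) (Fin n) ℝ) (θ : ℝ) (b : Fin 2 → Fin n → ℤ)
    (x y : Fin n → ℝ) :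
    translateBy g θ b (x + y) 1 = translateBy g θ b x 1 * translateBy g θ b y 1 := by
  funext k
  apply Units.ext
  rw [Pi.mul_apply, Units.val_mul, coe_translateBy_one, coe_translateBy_one, coe_translateBy_one,
    logMod_add, Pi.add_apply, Complex.ofReal_add, Complex.exp_add]

/-- The translation in the direction of an end does not change the monomial of this end. -/
lemma monomialAt_translateBy_eq_one {g : Matrix (Fin n) (Fin n) ℝ} (hg : g.PosDef) (θ : ℝ)
    {b : Fin 2 → Fin n → ℤ} (hb : LinearIndependent ℤ b) (p : ℤ × ℤ) (s : ℝ) :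
    monomialAt p (translateBy g θ b (s • toB (p.1 • b 0 + p.2 • b 1)) 1) = 1 := by
  apply Units.ext
  rw [coe_monomialAt, coe_translateBy_one, coe_translateBy_one, ← Complex.exp_int_mul,
    ← Complex.exp_int_mul, ← Complex.exp_add, logMod_smul, toB_add, toB_zsmul, toB_zsmul,
    logMod_frame hg θ hb, Units.val_one]
  rw [← Complex.exp_zero]
  congr 1
  simp
  ring

lemma character_add (m m' : Fin n → ℤ) (t : Fin n → Circle) :
    character (m + m') t = character m t * character m' t := by
  simp [character_apply, zpow_add, Finset.prod_mul_distrib]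

lemma character_zsmul (k : ℤ) (m : Fin n → ℤ) (t : Fin n → Circle) :
    character (k • m) t = character m t ^ k := by
  simp [character_apply, mul_comm k, zpow_mul, Finset.prod_zpow]

lemma phaseAt_add (g : Matrix (Fin n) (Fin n) ℝ) (θ : ℝ) (m m' : Fin n → ℤ) (q : CotTorus n) :
    phaseAt g θ (m + m') q = phaseAt g θ m q * phaseAt g θ m' q := by
  rw [phaseAt, phaseAt, phaseAt, character_add, toB_add, ip_add_left, mul_add, neg_add,
    Circle.exp_add]
  exact mul_mul_mul_comm _ _ _ _

lemma phaseAt_zsmul (g : Matrix (Fin n) (Fin n) ℝ) (θ : ℝ) (k : ℤ) (m : Fin n → ℤ)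
    (q : CotTorus n) : phaseAt g θ (k • m) q = phaseAt g θ m q ^ k := by
  rw [phaseAt, phaseAt, character_zsmul, toB_zsmul, ip_smul_left, mul_zpow, ← Circle.exp_zsmul,
    zsmul_eq_mul]
  congr 2
  ring

lemma phaseAt_neg (g : Matrix (Fin n) (Fin n) ℝ) (θ : ℝ) (m : Fin n → ℤ) (q : CotTorus n) :
    phaseAt g θ (-m) q = (phaseAt g θ m q)⁻¹ := by
  rw [← neg_one_zsmul, phaseAt_zsmul, zpow_neg_one]

/-- Splits z^p into a modulus, depending only on the base point, and the phase in the lattice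
direction of `p`; a cylinder of this phase over a line in direction `p` is thus contained in some
z^p = α. -/
lemma monomialAt_zCoord (g : Matrix (Fin n) (Fin n) ℝ) (θ : ℝ) (b : Fin 2 → Fin n → ℤ)
    (p : ℤ × ℤ) (q : CotTorus n) :
    monomialAt p (zCoord g θ b q) = monomialAt p (translateBy g θ b q.1 1) *
      Circle.toUnits (phaseAt g θ (p.1 • b 0 + p.2 • b 1) q) := by
  have h : zCoord g θ b q =
      translateBy g θ b q.1 1 * fun k => Circle.toUnits (phaseAt g θ (b k) q) := by
    funext k
    simp [zCoord, translateBy]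
  rw [h, monomialAt_mul, phaseAt_add, phaseAt_zsmul, phaseAt_zsmul, map_mul, map_zpow, map_zpow]
  rfl

/-- The value of the moment map of the subtorus over the point `a` of the base. -/
def levelAt (b : Fin 2 → Fin n → ℤ) (a : Fin n → ℝ) : Module.Dual ℝ (lieSubtorus b) where
  toFun ξ := dotProduct a (ξ : Fin n → ℝ)
  map_add' _ _ := dotProduct_add _ _ _
  map_smul' _ _ := dotProduct_smul _ _ _

lemma mem_momentFibre_levelAt {b : Fin 2 → Fin n → ℤ} {a : Fin n → ℝ} {p : ℤ × ℤ} {s : ℝ}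
    {q : CotTorus n} (hq : q.1 = a + s • toB (p.1 • b 0 + p.2 • b 1)) :
    q ∈ momentFibre b (levelAt b a) := by
  intro ξ
  have h : ∀ k, toB (b k) ⬝ᵥ (ξ : Fin n → ℝ) = 0 := ξ.2
  rw [hq, toB_add, toB_zsmul, toB_zsmul, add_dotProduct, smul_dotProduct, add_dotProduct,
    smul_dotProduct, smul_dotProduct, h, h]
  simp [levelAt]

/-- The polynomial with given ends, for the curve translated by `a`. -/
noncomputable def translatedPoly {I : Type*} [Fintype I] (g : Matrix (Fin n) (Fin n) ℝ) (θ : ℝ)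
    (b : Fin 2 → Fin n → ℤ) (m : I → ℤ × ℤ) (φ : I → Circle) (a : Fin n → ℝ) : LaurentPoly :=
  fanPoly m fun x => -(φ x : ℂ)⁻¹ * (monomialAt (m x) (translateBy g θ b a 1) : ℂ)⁻¹

section

variable {I : Type*} [Fintype I]

lemma curve_translatedPoly (g : Matrix (Fin n) (Fin n) ℝ) (θ : ℝ)
    (b : Fin 2 → Fin n → ℤ) (m : I → ℤ × ℤ) (φ : I → Circle) (a : Fin n → ℝ) :
    curve (translatedPoly g θ b m φ a) =
      translateBy g θ b a '' curve (fanPoly m fun x => -(φ x : ℂ)⁻¹) := by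
  ext z
  constructor
  · intro hz
    refine ⟨(translateBy g θ b a 1)⁻¹ * z, ?_, ?_⟩
    · rw [← mem_curve_fanPoly_mul m _ (translateBy g θ b a 1), mul_inv_cancel_left]
      exact hz
    · rw [translateBy_eq_mul, mul_inv_cancel_left]
  · rintro ⟨w, hw, rfl⟩
    rw [translateBy_eq_mul]
    exact (mem_curve_fanPoly_mul m _ _ _).mpr hw

lemma isSmoothCurve_translatedPoly (g : Matrix (Fin n) (Fin n) ℝ) (θ : ℝ)
    (b : Fin 2 → Fin n → ℤ) (m : I → ℤ × ℤ) (φ : I → Circle) (a : Fin n → ℝ)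
    (h : ∀ z : Fin 2 → ℂ, (∀ k, z k ≠ 0) → ¬ IsSingularAt m (fun x => -(φ x : ℂ)⁻¹) z) :
    IsSmoothCurve (translatedPoly g θ b m φ a) := by
  refine isSmoothCurve_fanPoly _ _ fun z hz => ?_
  let t : Fin 2 → ℂ := fun k => (translateBy g θ b a 1 k : ℂ)
  have ht : ∀ k, t k ≠ 0 := fun k => Units.ne_zero _
  have h1 := h (t⁻¹ * z) fun k => mul_ne_zero (inv_ne_zero (ht k)) (hz k)
  rw [← isSingularAt_mul_iff m _ t _ ht] at h1
  have h2 : t * (t⁻¹ * z) = z := by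
    funext k
    simp [ht k]
  rw [h2] at h1
  simpa only [coe_monomialAt] using h1

end

-- The end positions are α_x = t^{m_x} φ_x with t the translation. The factors t^{m_x} multiply to
-- one since the m_x sum to zero, so the closing condition persists. Along the half cylinder from
-- `a` the modulus stays |t^{m_x}|, because moving in direction m_x does not change |z^{m_x}|.
open scoped Classical in
theorem hasEnds_translatedPoly {ι : Type*} {g : Matrix (Fin n) (Fin n) ℝ} (hg : g.PosDef) (θ : ℝ)
    {b : Fin 2 → Fin n → ℤ} (hb : LinearIndependent ℤ b) (S : Finset ι) {m : ι → ℤ × ℤ}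
    (hm : IsLatticeFan fun x : {x // x ∈ S} => m x) {φ : ι → Circle}
    (hφ : ∏ x : {x // x ∈ S}, (-(φ x : ℂ)⁻¹) = 1) (hsep : ∀ x ∈ S, ∀ y ∈ S, x ≠ y → φ x ≠ φ y)
    (a : Fin n → ℝ) {c : ι → HalfCylinder n}
    (hc : ∀ x ∈ S, c x = ⟨a, (m x).1 • b 0 + (m x).2 • b 1, φ x⟩) :
    HasEnds g θ b (levelAt b a)
      (translatedPoly g θ b (fun x : {x // x ∈ S} => m x) (fun x => φ x) a) S c := by
  set t := translateBy g θ b a 1 with ht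
  let α : ι → ℂˣ := fun x => monomialAt (m x) t * Circle.toUnits (φ x)
  have hα : ∀ x, -(α x : ℂ)⁻¹ = -(φ x : ℂ)⁻¹ * (monomialAt (m x) t : ℂ)⁻¹ := fun x => by
    change -(((monomialAt (m x) t : ℂˣ) : ℂ) * (φ x : ℂ))⁻¹ = _
    rw [mul_inv]
    ring
  have hsum : ∑ x : {x // x ∈ S}, m x = 0 := by
    have h := hm.balanced.sum_eq
    rw [← latticeToComplex_sum] at h
    have h2 := congrArg Complex.re h
    have h3 := congrArg Complex.im h
    simp only [latticeToComplex, Complex.zero_re, Complex.zero_im, Int.cast_eq_zero] at h2 h3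
    exact Prod.ext h2 h3
  have hprod : ∏ x : {x // x ∈ S}, (-(α x : ℂ)⁻¹) = 1 := by
    simp only [hα]
    rw [Finset.prod_mul_distrib, hφ, Finset.prod_inv_distrib, ← Units.coe_prod, ← monomialAt_sum,
      hsum, monomialAt_zero]
    simp
  obtain ⟨m', r, ψ, hr, hends, hdisj, K, hK, hcover⟩ := exists_ends hm (α := fun x => α x) hprod (by
    intro x y hxy hmxy hαxy
    refine hsep x x.2 y y.2 (fun h => hxy (Subtype.ext h)) ?_
    have h1 : monomialAt (m x) t * Circle.toUnits (φ x) = monomialAt (m x) t *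
      Circle.toUnits (φ y) := by
      have h2 : monomialAt (m x) t * Circle.toUnits (φ x) =
        monomialAt (m y) t * Circle.toUnits (φ y) := hαxy
      have h3 : m x = m y := hmxy
      rw [h2, h3]
    have h4 := congrArg Units.val (mul_left_cancel h1)
    exact Subtype.val_injective h4)
  have hpoly : translatedPoly g θ b (fun x : {x // x ∈ S} => m x) (fun x => φ x) a =
      fanPoly (fun x : {x // x ∈ S} => m x) fun x => -(α x : ℂ)⁻¹ := by
    simp only [hα]
    rfl
  obtain ⟨m'', hm''⟩ : ∃ m'' : ι → ℤ × ℤ, ∀ x (hx : x ∈ S), m'' x = m' ⟨x, hx⟩ :=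
    ⟨fun x => if hx : x ∈ S then m' ⟨x, hx⟩ else 0, fun x hx => dif_pos hx⟩
  obtain ⟨ψ', hψ'⟩ : ∃ ψ' : ι → ℂ → ℂ, ∀ x (hx : x ∈ S), ψ' x = ψ ⟨x, hx⟩ :=
    ⟨fun x => if hx : x ∈ S then ψ ⟨x, hx⟩ else 0, fun x hx => dif_pos hx⟩
  refine ⟨m, m'', α, r, ψ', hr, fun x hx => ?_, fun x hx y hy hxy => ?_, K, hK,
    ?_⟩
  · obtain ⟨h1, h2, h3, h4⟩ := hends ⟨x, hx⟩
    rw [hm'' x hx, hψ' x hx, hpoly]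
    refine ⟨by rw [hc x hx], h1, ?_, h2, h3, h4⟩
    rw [hc x hx]
    rintro q ⟨⟨s, -, hs⟩, hq⟩
    change q.1 = a + s • toB ((m x).1 • b 0 + (m x).2 • b 1) at hs
    refine ⟨mem_momentFibre_levelAt hs, ?_⟩
    rw [monomialAt_zCoord, hs, translateBy_add_one, monomialAt_mul,
      monomialAt_translateBy_eq_one hg θ hb, mul_one]
    change _ = monomialAt (m x) t * Circle.toUnits (φ x)
    rw [show phaseAt g θ _ q = φ x from hq]
  · rw [hm'' x hx, hψ' x hx, hm'' y hy, hψ' y hy]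
    exact hdisj ⟨x, hx⟩ ⟨y, hy⟩ fun h => hxy (congrArg Subtype.val h)
  · rw [hpoly]
    refine hcover.trans (Set.union_subset_union_right K ?_)
    refine Set.iUnion_subset fun x => ?_
    refine Set.subset_iUnion₂_of_subset x.1 x.2 ?_
    rw [hm'' x x.2, hψ' x x.2]

end Translation

/-! ### Opposite half cylinders -/

section Overlap

variable {n : ℕ}

lemma exists_character_eq {d : Fin n → ℤ} (hd : d ≠ 0) (c : Circle) :
    ∃ t : Fin n → Circle, character d t = c := by
  obtain ⟨i, hi⟩ := Function.ne_iff.mp hd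
  have hi' : (d i : ℝ) ≠ 0 := Int.cast_ne_zero.mpr hi
  obtain ⟨x, rfl⟩ := Circle.exp_surjective c
  refine ⟨fun j => Circle.exp ((Pi.single i (x / d i) : Fin n → ℝ) j), ?_⟩
  rw [character_exp, dotProduct_single, toB, mul_div_cancel₀ _ hi']

lemma exists_phaseAt_eq (g : Matrix (Fin n) (Fin n) ℝ) (θ : ℝ) {d : Fin n → ℤ} (hd : d ≠ 0)
    (μ : Fin n → ℝ) (φ : Circle) : ∃ t, phaseAt g θ d (μ, t) = φ := by
  obtain ⟨t, ht⟩ := exists_character_eq hd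
    (φ * (Circle.exp (-(Real.cot θ * ip g (toB d) μ)))⁻¹)
  exact ⟨t, by rw [phaseAt, ht, inv_mul_cancel_right]⟩

lemma HalfCylinder.fst_image_carrier (c : HalfCylinder n) (hc : c.dir ≠ 0)
    (g : Matrix (Fin n) (Fin n) ℝ) (θ : ℝ) :
    Prod.fst '' c.carrier g θ = ray c.start (toB c.dir) := by
  ext μ
  constructor
  · rintro ⟨q, hq, rfl⟩
    exact hq.1
  · intro hμ
    obtain ⟨t, ht⟩ := exists_phaseAt_eq g θ hc μ c.phase
    exact ⟨(μ, t), ⟨hμ, ht⟩, rfl⟩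

/-- Two opposite half cylinders overlap over a segment. -/
lemma fst_image_inter_carrier (g : Matrix (Fin n) (Fin n) ℝ) (θ : ℝ) (a : Fin n → ℝ)
    {d : Fin n → ℤ} (hd : d ≠ 0) (φ : Circle) {l : ℝ} (hl : 0 < l) :
    Prod.fst '' ((HalfCylinder.mk a d φ).carrier g θ ∩
      (HalfCylinder.mk (a + l • toB d) (-d) φ⁻¹).carrier g θ) = segment ℝ a (a + l • toB d) := by
  have hd' := toB_ne_zero hd
  rw [segment_eq_image']
  ext μ
  constructor
  · rintro ⟨q, ⟨⟨⟨s, hs, hs'⟩, -⟩, ⟨⟨s', hs0, hs''⟩, -⟩⟩, rfl⟩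
    change q.1 = a + s • toB d at hs'
    change q.1 = a + l • toB d + s' • toB (-d) at hs''
    have h1 : s • toB d = (l - s') • toB d := by
      have := hs'.symm.trans hs''
      rw [toB_neg, add_assoc] at this
      rw [add_left_cancel this, sub_smul, smul_neg, sub_eq_add_neg]
    have h2 : s = l - s' := smul_left_injective ℝ hd' h1
    refine ⟨s / l, ⟨div_nonneg hs hl.le, (div_le_one hl).mpr (by linarith)⟩, ?_⟩
    change a + (s / l) • (a + l • toB d - a) = q.1
    rw [add_sub_cancel_left, smul_smul, div_mul_cancel₀ _ hl.ne', hs']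
  · rintro ⟨s, ⟨hs0, hs1⟩, rfl⟩
    change a + s • (a + l • toB d - a) ∈ _
    rw [add_sub_cancel_left, smul_smul]
    obtain ⟨t, ht⟩ := exists_phaseAt_eq g θ hd (a + (s * l) • toB d) φ
    refine ⟨(_, t), ⟨⟨⟨s * l, by positivity, rfl⟩, ht⟩, ⟨⟨(1 - s) * l, ?_, ?_⟩, ?_⟩⟩, rfl⟩
    · exact mul_nonneg (sub_nonneg.mpr hs1) hl.le
    · change a + (s * l) • toB d = a + l • toB d + ((1 - s) * l) • toB (-d)
      rw [toB_neg]
      module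
    · change phaseAt g θ (-d) _ = φ⁻¹
      rw [phaseAt_neg, ht]

lemma carrier_subset_left (g : Matrix (Fin n) (Fin n) ℝ) (θ : ℝ) (a : Fin n → ℝ)
    (d : Fin n → ℤ) (φ : Circle) : (HalfCylinder.mk a d φ).carrier g θ ⊆
      {q | (∃ s : ℝ, q.1 = a + s • toB d) ∧ phaseAt g θ d q = φ} := by
  rintro q ⟨⟨s, -, hs⟩, hq⟩
  exact ⟨⟨s, hs⟩, hq⟩

lemma carrier_subset_right (g : Matrix (Fin n) (Fin n) ℝ) (θ : ℝ) (a : Fin n → ℝ)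
    (d : Fin n → ℤ) (φ : Circle) (l : ℝ) :
    (HalfCylinder.mk (a + l • toB d) (-d) φ⁻¹).carrier g θ ⊆
      {q | (∃ s : ℝ, q.1 = a + s • toB d) ∧ phaseAt g θ d q = φ} := by
  rintro q ⟨⟨s, -, hs⟩, hq⟩
  change q.1 = a + l • toB d + s • toB (-d) at hs
  refine ⟨⟨l - s, ?_⟩, ?_⟩
  · rw [hs, toB_neg]
    module
  · change phaseAt g θ (-d) q = φ⁻¹ at hq
    rw [phaseAt_neg] at hq
    exact inv_injective hq

end Overlap


/-! ### The matching data of the dilated tropical curve -/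

section MatchingFamily

open scoped Classical

variable {n : ℕ} {V E : Type*} [Fintype E]

/-- The polynomial at the vertex `v` before translation. -/
noncomputable def TropicalCurve.vertexPoly (Γ : TropicalCurve n V E) (v : V)
    (m : E × Bool → ℤ × ℤ) (φ : E → Circle) : LaurentPoly :=
  fanPoly (fun x : {x // x ∈ Γ.flags v} => m x) fun x => -(outwardPhase φ x.1 : ℂ)⁻¹

lemma TropicalCurve.exists_vertexPoly_support_subset (Γ : TropicalCurve n V E) (v : V)
    (m : E × Bool → ℤ × ℤ) : ∃ s : Finset (ℤ × ℤ), ∀ φ, (Γ.vertexPoly v m φ).support ⊆ s :=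
  ⟨_, fun _ => fanPoly_support _ _⟩

lemma TropicalCurve.continuous_vertexPoly_apply (Γ : TropicalCurve n V E) (v : V)
    (m : E × Bool → ℤ × ℤ) (q : ℤ × ℤ) : Continuous fun φ => Γ.vertexPoly v m φ q :=
  (continuous_fanPoly_apply _ q).comp (continuous_pi fun x =>
    (Continuous.inv₀ (continuous_subtype_val.comp (continuous_outwardPhase x.1))
      fun _ => Circle.coe_ne_zero _).neg)

/-- The matching datum for the dilated curve, with the given frames at the vertices, coordinates of the
edges in these frames, and phases. -/
noncomputable def TropicalCurve.matchingDatum (Γ : TropicalCurve n V E)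
    (g : Matrix (Fin n) (Fin n) ℝ) (θ : ℝ) (b : V → Fin 2 → Fin n → ℤ)
    (m : V → E × Bool → ℤ × ℤ) (φ : E → Circle) (T : ℝ) : MatchingDatum n V E where
  torus v := subtorus (b v)
  frame := b
  level v := levelAt (b v) (T • Γ.pos v)
  poly v := translatedPoly g θ (b v) (fun x : {x // x ∈ Γ.flags v} => m v x)
    (fun x => outwardPhase φ x.1) (T • Γ.pos v)
  -- The starting point 0 is a dummy for the free side of an external edge. At the target side both
  -- direction and phase are inverted, which describes the same cylinder.
  cyl x := ⟨(Γ.endpoint x).elim 0 fun v => T • Γ.pos v, Γ.outward x, outwardPhase φ x⟩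

variable {Γ : TropicalCurve n V E} {g : Matrix (Fin n) (Fin n) ℝ} {θ : ℝ}
  {b : V → Fin 2 → Fin n → ℤ} {m : V → E × Bool → ℤ × ℤ} {φ : E → Circle} {T : ℝ}

lemma matchingDatum_cyl_of_mem_flags {v : V} {x : E × Bool} (hx : x ∈ Γ.flags v) :
    (Γ.matchingDatum g θ b m φ T).cyl x = ⟨T • Γ.pos v, Γ.outward x, outwardPhase φ x⟩ := by
  simp only [TropicalCurve.matchingDatum, Γ.mem_flags.mp hx, Option.elim_some]

lemma matchingDatum_cyl_src (e : E) :
    (Γ.matchingDatum g θ b m φ T).cyl (e, true) = ⟨T • Γ.pos (Γ.src e), Γ.dir e, φ e⟩ :=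
  rfl

lemma matchingDatum_cyl_tgt {e : E} {w : V} (hw : Γ.tgt e = some w) {l : ℝ}
    (hl : Γ.pos w = Γ.pos (Γ.src e) + l • toB (Γ.dir e)) :
    (Γ.matchingDatum g θ b m φ T).cyl (e, false) =
      ⟨T • Γ.pos (Γ.src e) + (T * l) • toB (Γ.dir e), -Γ.dir e, (φ e)⁻¹⟩ := by
  rw [matchingDatum_cyl_of_mem_flags (v := w) (Γ.mem_flags.mpr (by simpa [RayGraph.endpoint] using hw)),
    hl, smul_add, smul_smul]
  rfl

theorem isMatching_matchingDatum (hg : g.PosDef) (hθ : θ ∈ Set.Ioo 0 Real.pi)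
    (hb : ∀ v, IsPrimitiveFrame (b v))
    (hbm : ∀ v, ∀ x ∈ Γ.flags v, Γ.outward x = (m v x).1 • b v 0 + (m v x).2 • b v 1)
    (hm : ∀ v, IsLatticeFan fun x : {x // x ∈ Γ.flags v} => m v x)
    (hφ : φ ∈ Γ.phaseSolutions)
    (hsep : ∀ v, ∀ x ∈ Γ.flags v, ∀ y ∈ Γ.flags v, x ≠ y → outwardPhase φ x ≠ outwardPhase φ y)
    (hsing : ∀ v, ∀ z : Fin 2 → ℂ, (∀ k, z k ≠ 0) →
      ¬ IsSingularAt (fun x : {x // x ∈ Γ.flags v} => m v x)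
        (fun x => -(outwardPhase φ x.1 : ℂ)⁻¹) z)
    (hT : 0 < T) {Λ : ℝ} (hΛ : ∀ e w, Γ.tgt e = some w →
      ∀ l : ℝ, 0 < l → Γ.pos w = Γ.pos (Γ.src e) + l • toB (Γ.dir e) →
        Λ < T * (l * Real.sqrt (ip g (toB (Γ.dir e)) (toB (Γ.dir e))))) :
    (Γ.matchingDatum g θ b m φ T).IsMatching Γ.toRayGraph g θ Λ where
  frame_primitive := hb
  torus_eq _ := rfl
  smooth v := isSmoothCurve_translatedPoly _ _ _ _ _ _ (hsing v)
  lift_special v := isSpecialLagrangian_liftCurve hg hθ (hb v).1 _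
    (isSmoothCurve_translatedPoly _ _ _ _ _ _ (hsing v))
  cyl_primitive v x _ := Γ.isPrimitive_outward x
  ends v := by
    refine hasEnds_translatedPoly hg θ (hb v).1 (Γ.flags v) (hm v)
      (prod_neg_inv_outwardPhase hφ v) (hsep v) (T • Γ.pos v) fun x hx => ?_
    rw [matchingDatum_cyl_of_mem_flags hx, hbm v x hx]
  common_cylinder e he := by
    obtain ⟨w, hw⟩ := Option.isSome_iff_exists.mp he
    obtain ⟨l, hl, hpos⟩ := Γ.internal e w hw
    refine ⟨_, isInvariantCylinder_of_isPrimitive hg hθ (T • Γ.pos (Γ.src e)) (Γ.primitive e)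
      (Γ.dir_ne_zero e) (φ e), ?_, ?_⟩
    · rw [matchingDatum_cyl_src]
      exact carrier_subset_left _ _ _ _ _
    · rw [matchingDatum_cyl_tgt hw hpos]
      exact carrier_subset_right _ _ _ _ _ _
  overlap e he := by
    obtain ⟨w, hw⟩ := Option.isSome_iff_exists.mp he
    obtain ⟨l, hl, hpos⟩ := Γ.internal e w hw
    refine ⟨T • Γ.pos (Γ.src e), T • Γ.pos (Γ.src e) + (T * l) • toB (Γ.dir e), ?_, ?_⟩
    · rw [matchingDatum_cyl_src, matchingDatum_cyl_tgt hw hpos]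
      exact fst_image_inter_carrier g θ _ (Γ.dir_ne_zero e) (φ e) (mul_pos hT hl)
    · rw [add_sub_cancel_left, ip_smul_left, ip_smul_right, ← mul_assoc,
        Real.sqrt_mul (mul_self_nonneg _), Real.sqrt_mul_self (mul_pos hT hl).le, mul_assoc]
      exact hΛ e w hw l hl hpos

/-- Dilation makes all internal edges long. -/
lemma TropicalCurve.eventually_lt_length (Γ : TropicalCurve n V E) (hg : g.PosDef) (Λ : ℝ) :
    ∀ᶠ T : ℝ in Filter.atTop, ∀ e w, Γ.tgt e = some w →
      ∀ l : ℝ, 0 < l → Γ.pos w = Γ.pos (Γ.src e) + l • toB (Γ.dir e) →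
        Λ < T * (l * Real.sqrt (ip g (toB (Γ.dir e)) (toB (Γ.dir e)))) := by
  refine Filter.eventually_all.mpr fun e => ?_
  have hd := toB_ne_zero (Γ.dir_ne_zero e)
  have hs := Real.sqrt_pos.mpr (ip_self_pos hg hd)
  cases he : Γ.tgt e with
  | none => simp
  | some w =>
    obtain ⟨l, hl, hpos⟩ := Γ.internal e w he
    filter_upwards [(Filter.tendsto_id.atTop_mul_const (mul_pos hl hs)).eventually_gt_atTop Λ]
      with T hT w' hw' l' hl' hpos'
    obtain rfl : w = w' := Option.some_injective _ hw'
    have h1 : l' • toB (Γ.dir e) = l • toB (Γ.dir e) := add_left_cancel (hpos'.symm.trans hpos)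
    have h2 : l' = l := smul_left_injective ℝ hd h1
    rw [h2]
    exact hT

end MatchingFamily

end TropSL

/-! ### Assembly of the proposition -/

theorem proposition3p4 {n : ℕ} {V E : Type*} [Fintype V] [Fintype E]
    (g : Matrix (Fin n) (Fin n) ℝ) (hg : g.PosDef) (θ : ℝ) (hθ : θ ∈ Set.Ioo 0 Real.pi)
    (Γ : TropSL.TropicalCurve n V E) (hΓ : Γ.LocallyPlanar) :
    Fintype.card V ≤ Fintype.card E ∧
    -- the torus of solutions of the phase balancing equations is parametrized by `u ↦ φ₀ * Ψ u`
    ∃ (φ₀ : E → Circle)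
      (Ψ : (Fin (Fintype.card E - Fintype.card V) → Circle) →ₜ* (E → Circle))
      (U : Set (Fin (Fintype.card E - Fintype.card V) → Circle))
      -- the subtori with their coordinate frames, and the curves before translation
      (tor : V → Subgroup (Fin n → Circle)) (b : V → Fin 2 → Fin n → ℤ)
      (supp : V → Finset (ℤ × ℤ))
      (f : (Fin (Fintype.card E - Fintype.card V) → Circle) → V → TropSL.LaurentPoly)
      -- the family of matching data
      (D : ℝ → (Fin (Fintype.card E - Fintype.card V) → Circle) → TropSL.MatchingDatum n V E),
      Function.Injective Ψ ∧
      Set.range (fun u => φ₀ * Ψ u) = Γ.phaseSolutions ∧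
      IsOpen U ∧ Dense U ∧
      (∀ v, ∀ u ∈ U, (f u v).support ⊆ supp v) ∧
      (∀ v m, ContinuousOn (fun u => f u v m) U) ∧
      ∀ Λ : ℝ, ∃ T₀ > 0, ∀ T ≥ T₀, ∀ u ∈ U,
        (D T u).IsMatching Γ.toRayGraph g θ Λ ∧
        (∀ v, (D T u).torus v = tor v ∧ (D T u).frame v = b v) ∧
        (∀ v, TropSL.curve ((D T u).poly v) =
          TropSL.translateBy g θ (b v) (T • Γ.pos v) '' TropSL.curve (f u v)) ∧
        (∀ v, ∀ x ∈ Γ.flags v,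
          Prod.fst '' ((D T u).cyl x).carrier g θ =
            TropSL.ray (T • Γ.pos v) (TropSL.toB (Γ.outward x))) ∧
        (∀ e, ((D T u).cyl (e, true)).phase = (φ₀ * Ψ u) e) := by
  classical
  obtain ⟨hcard, κ, ρ, s, hs, hκ, hρκ, hsplit⟩ :=
    TropSL.exists_splitting (TropSL.TropicalCurve.incidence_mulVec_surjective hΓ)
  refine ⟨hcard, ?_⟩
  choose b m hb hbm hm using TropSL.TropicalCurve.exists_frame hΓ
  -- A particular solution comes from the section `s` of the incidence matrix, the homogeneous ones
  -- from the kernel basis `κ`; the retraction `ρ` gives injectivity and recovers the parameter of a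
  -- solution.
  let ε : V → Circle := fun v => Circle.exp ((Γ.flags v).card * Real.pi)
  let φ₀ := TropSL.torusMap s ε
  let Ψ : (Fin (Fintype.card E - Fintype.card V) → Circle) →ₜ* (E → Circle) :=
    ⟨TropSL.torusMap κ, TropSL.continuous_torusMap κ⟩
  have hΨ : ∀ u, Ψ u = TropSL.torusMap κ u := fun _ => rfl
  have hrange : Set.range (fun u => φ₀ * Ψ u) = Γ.phaseSolutions := by
    ext φ
    rw [TropSL.TropicalCurve.mem_phaseSolutions_iff]
    constructor
    · rintro ⟨u, rfl⟩
      rw [map_mul, hΨ, ← TropSL.torusMap_mul, ← TropSL.torusMap_mul, hs, hκ, TropSL.torusMap_one,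
        TropSL.torusMap_zero, mul_one]
    · intro hφ
      refine ⟨TropSL.torusMap ρ φ, ?_⟩
      change TropSL.torusMap s ε * TropSL.torusMap κ (TropSL.torusMap ρ φ) = φ
      rw [← TropSL.torusMap_mul, mul_comm, show ε = TropSL.torusMap _ φ from hφ.symm,
        ← TropSL.torusMap_mul, ← TropSL.torusMap_add, hsplit, TropSL.torusMap_one]
  have hsol : ∀ u, φ₀ * Ψ u ∈ Γ.phaseSolutions := fun u => hrange ▸ ⟨u, rfl⟩
  choose U hUo hUd hU using fun v => TropSL.exists_isOpen_dense_of_isLatticeFan hΓ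
    (Ψ := Ψ.toMonoidHom) (TropSL.continuous_torusMap κ) hrange v (hm v)
  choose supp hsupp using fun v => Γ.exists_vertexPoly_support_subset v (m v)
  refine ⟨φ₀, Ψ, ⋂ v, U v, fun v => TropSL.subtorus (b v), b, supp,
    fun u v => Γ.vertexPoly v (m v) (φ₀ * Ψ u),
    fun T u => Γ.matchingDatum g θ b m (φ₀ * Ψ u) T, ?_, hrange, isOpen_iInter_of_finite hUo,
    dense_iInter_of_isOpen hUo hUd, ?_, ?_, ?_⟩
  · intro u w huw
    have h := congrArg (TropSL.torusMap ρ) huw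
    rwa [hΨ, hΨ, ← TropSL.torusMap_mul, ← TropSL.torusMap_mul, hρκ, TropSL.torusMap_one,
      TropSL.torusMap_one] at h
  · exact fun v u _ => hsupp v _
  · intro v q
    exact ((Γ.continuous_vertexPoly_apply v (m v) q).comp
      (continuous_const.mul (TropSL.continuous_torusMap κ))).continuousOn
  · intro Λ
    obtain ⟨T₁, hT₁⟩ := Filter.eventually_atTop.mp (Γ.eventually_lt_length hg Λ)
    -- The maximum with 1 ensures T > 0, which is needed for the overlaps to be segments in the
    -- direction of the edges.
    refine ⟨max T₁ 1, lt_max_of_lt_right one_pos, fun T hT u hu => ⟨?_, fun v => ⟨rfl, rfl⟩,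
      fun v => TropSL.curve_translatedPoly _ _ _ _ _ _, fun v x hx => ?_, fun e => rfl⟩⟩
    · exact TropSL.isMatching_matchingDatum hg hθ hb hbm hm (hsol u)
        (fun v => (hU v u (Set.mem_iInter.mp hu v)).1)
        (fun v => (hU v u (Set.mem_iInter.mp hu v)).2)
        (one_pos.trans_le ((le_max_right _ _).trans hT)) (hT₁ T ((le_max_left _ _).trans hT))
    · rw [TropSL.matchingDatum_cyl_of_mem_flags hx]
      exact TropSL.HalfCylinder.fst_image_carrier _ (Γ.outward_ne_zero x) g θ
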